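/- Let $\ell\ge 1$. A generalized Frobenius manifold of charge $d$ is a complex manifold with a flat holomorphic metric $\eta$, a holomorphic family of commutative associative products on the tangent spaces with $\eta(X\cdot Y,Z)=\eta(X,Y\cdot Z)$, a unit field $e$ (not required to be flat), and an Euler field $E$ such that $\nabla c$ is totally symmetric for $c(X,Y,Z)=\eta(X\cdot Y,Z)$, $\nabla\nabla E=0$, $\mathcal L_E(\cdot)=(\cdot)$ and $\mathcal L_E\eta=(2-d)\eta$; its intersection form is $g(\omega,\omega')=i_E(\omega\cdot\omega')$, with covectors multiplied via $\eta$. *Superpotentials.* For $a=(a_1,\dots,a_\ell)\in\mathbb C^\ell$ let $\Lambda(p)=p^{\ell+1}+a_1p^\ell+\dots+a_\ell p$ and $$\tilde\eta(\partial',\partial'')=\sum_{\Lambda'(q)=0}\operatorname*{Res}_{p=q}\frac{\partial'(\Lambda)\,\partial''(\Lambda)}{p^2\Lambda'(p)}\,dp,\qquad \tilde c(\partial',\partial'',\partial''')=\sum_{\Lambda'(q)=0}\operatorname*{Res}_{p=q}\frac{\partial'(\Lambda)\,\partial''(\Lambda)\,\partial'''(\Lambda)}{p^2\Lambda'(p)}\,dp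 .$$ *Orbit space.* Let $\alpha_r=e_r-e_{r+1}$ and $\omega_r$ $(1\le r\le\ell)$ be the simple roots and fundamental weights of $A_\ell$, $\theta_j=(\omega_j,\omega_\ell)=\frac j{\ell+1}$, $W=S_{\ell+1}$, $N_j=\#\{w\in W: w\omega_j=\omega_j\}$, and $$y^j=\frac{1}{N_j}e^{-2\pi i\theta_jc}\sum_{w\in W}e^{2\pi i(\omega_j,w(\mathbf x))},\qquad \mathbf x=c\,\omega_\ell+\sum_r x^r\alpha_r,\qquad \lambda=e^{-2\pi ic}.$$ The $y^j$ are polynomial in $\lambda$ and are extended to all $\lambda\in\mathbb C$: $y^j=\sigma_j(u_1,\dots,u_{\ell+1})$, the $j$-th elementary symmetric polynomial of $u_k=e^{2\pi i(x^k-x^{k-1})}$ $(k\le\ell,\ x^0=0)$ and $u_{\ell+1}=\lambda e^{-2\pi ix^\ell}$. With $(a^{rs})=((\alpha_r,\alpha_s))^{-1}$ put $g^{ij}_\lambda=\frac1{4\pi^2}\sum_{r,s}\frac{\partial y^i}{\partial x^r}a^{rs}\frac{\partial y^j}{\partial x^s}$, and $E=\sum_r\theta_ry^r\partial_{y^r}$.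 **Theorem.** 1. $\tilde\eta$ is nondegenerate on all of $\mathbb C^\ell$, so $\tilde\eta(\partial'\cdot\partial'',\partial''')=\tilde c(\partial',\partial'',\partial''')$ defines a product there. The set $\mathcal M_\ell=\{a\in\mathbb C^\ell: a_\ell\ne0\}$ with this metric and product, the unit $\tilde e=-\operatorname{grad}_{\tilde\eta}\log a_\ell$ and the Euler field $\tilde E=\sum_\alpha\frac{\alpha}{\ell+1}a_\alpha\partial_{a_\alpha}$ is a generalized Frobenius manifold of charge $1$. At every critical point $q$ of $\Lambda$ one has $(\tilde e\Lambda)(q)=1$ and $(\tilde E\Lambda)(q)=\Lambda(q)$. Where $\Lambda$ and $\Lambda'$ have no common zero, the inverse of the intersection form is $\sum_{\Lambda'(q)=0}\operatorname{Res}_{p=q}\frac{\partial'(\Lambda)\partial''(\Lambda)}{p^2\Lambda(p)\Lambda'(p)}dp$. 2. There are unique matrix-valued functions $g,\eta$ of $y\in\mathbb C^\ell$ with $g_\lambda=g+\lambda\eta$ for all $\lambda$, and there are global flat coordinates $t^1,\dots,t^\ell$ of $\eta$ on $\mathbb C^\ell$ with $E=\sum_\alpha d_\alpha t^\alpha\partial_{t^\alpha}$,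 $d_\alpha\in\mathbb R$. For every such choice of coordinates, the contravariant components $\Gamma^{\alpha\beta}_\gamma=-g^{\alpha\rho}\Gamma^\beta_{\rho\gamma}$ of the Levi-Civita connection of $g$ in the coordinates $t$ extend uniquely to holomorphic functions on $\mathbb C^\ell$, and $\mathcal M_D(A_\ell,\omega_\ell)=\{y:\det\eta\ne0,\ y^\ell\ne0\}$ with the metric $(\eta_{ij})=(\eta^{ij})^{-1}$, the product with structure constants $c_{\alpha\beta}^\gamma=\sum_{\nu,\rho,\zeta}\frac1{d_\rho}\eta_{\alpha\nu}\eta_{\beta\rho}\eta^{\gamma\zeta}\Gamma^{\nu\rho}_\zeta$ in the coordinates $t$, the unit $e=-\operatorname{grad}_\eta\log y^\ell$ and the Euler field $E$ is a generalized Frobenius manifold of charge $1$ whose intersection form is $g$. 3. The map $h:\mathcal M_D(A_\ell,\omega_\ell)\to\mathcal M_\ell$, $a_\alpha=y^\alpha$ $(1\le\alpha\le\ell)$, is an isomorphism of generalized Frobenius manifolds: it is biholomorphic and carries $\eta$, the product, $e$, $E$ and $g$ to $\tilde\eta$, the product, $\tilde e$, $\tilde E$ and the intersection form of $\mathcal M_\ell$.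 4. The map $h^-$, $a_\alpha=(-1)^\alpha y^\alpha$, is biholomorphic, carries $E$ to $\tilde E$ and $g$ to the intersection form of $\mathcal M_\ell$, and satisfies $(h^-)^*\tilde\eta=(-1)^{\ell+1}\eta$, $h^-_*X\cdot h^-_*Y=(-1)^{\ell+1}h^-_*(X\cdot Y)$, $h^-_*e=(-1)^{\ell+1}\tilde e$; in particular it is an isomorphism of generalized Frobenius manifolds when $\ell$ is odd. For $\varepsilon=1$ (the map $h$) and $\varepsilon=-1$ (the map $h^-$), and indeed for every $\varepsilon\in\mathbb C$, the point $a_\alpha=\varepsilon^\alpha y^\alpha|_{\lambda=0}$ corresponds to $\Lambda(p)=p\prod_{k=1}^\ell(p+\varepsilon u_k)$. -/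

import Mathlib

namespace GenFrob

noncomputable section

/-! ### Generalized Frobenius manifolds on open subsets of `ℂⁿ` -/

/-- Points, tangent vectors and covectors of `ℂⁿ`, in the standard coordinates. -/
abbrev Vec (n : ℕ) : Type := Fin n → ℂ

/-- The partial derivative `∂f/∂zⁱ`. -/
def pd {n : ℕ} (f : Vec n → ℂ) (z : Vec n) (i : Fin n) : ℂ :=
  fderiv ℂ f z (Pi.single i 1)

/-- The Jacobian matrix `(∂f^α/∂zⁱ)`. -/
def jac {n : ℕ} (f : Vec n → Vec n) (z : Vec n) : Matrix (Fin n) (Fin n) ℂ :=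
  Matrix.of fun α i => fderiv ℂ f z (Pi.single i 1) α

/-- A domain in `ℂⁿ` with a pairing and a product of tangent vectors at each point and two vector
fields. Only the values at points of `carrier` are meaningful. -/
structure Data (n : ℕ) where
  carrier : Set (Vec n)
  metric : Vec n → Vec n → Vec n → ℂ
  mul : Vec n → Vec n → Vec n → Vec n
  unit : Vec n → Vec n
  euler : Vec n → Vec n

/-- The covariant components `η_{ij}`. -/
def Data.gram {n : ℕ} (F : Data n) (z : Vec n) : Matrix (Fin n) (Fin n) ℂ :=
  Matrix.of fun i j => F.metric z (Pi.single i 1) (Pi.single j 1)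

/-- The isomorphism `η^♯` from covectors to vectors. -/
def Data.sharp {n : ℕ} (F : Data n) (z : Vec n) (w : Vec n) : Vec n :=
  (F.gram z)⁻¹.mulVec w

/-- The intersection form `g(dzⁱ, dzʲ) = i_E (dzⁱ · dzʲ)`, where covectors are multiplied through
the identification `η^♯`. -/
def Data.intersectionForm {n : ℕ} (F : Data n) (z : Vec n) : Matrix (Fin n) (Fin n) ℂ :=
  Matrix.of fun i j => F.metric z (F.euler z)
    (F.mul z (F.sharp z (Pi.single i 1)) (F.sharp z (Pi.single j 1)))

/-- The coordinate vector field `∂/∂t^α` of a chart `t`. -/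
def chartVec {n : ℕ} (t : Vec n → Vec n) (z : Vec n) (α : Fin n) : Vec n :=
  (jac t z)⁻¹.mulVec (Pi.single α 1)

/-- `t` is a system of flat holomorphic coordinates for the metric of `F` on the open set `W`. -/
structure IsFlatChart {n : ℕ} (F : Data n) (W : Set (Vec n)) (t : Vec n → Vec n) : Prop where
  isOpen : IsOpen W
  holo : DifferentiableOn ℂ t W
  inj : Set.InjOn t W
  nondeg : ∀ z ∈ W, IsUnit (jac t z).det
  const : ∃ H : Matrix (Fin n) (Fin n) ℂ, ∀ z ∈ W, ∀ α β,
    F.metric z (chartVec t z α) (chartVec t z β) = H α β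

/-- `F` is a generalized Frobenius manifold (flatness of the unit is not required) of charge `d`. -/
structure IsGenFrobenius {n : ℕ} (F : Data n) (d : ℂ) : Prop where
  isOpen : IsOpen F.carrier
  -- holomorphic, symmetric, nondegenerate metric
  metric_holo : ∀ X Y, DifferentiableOn ℂ (fun z => F.metric z X Y) F.carrier
  metric_form : ∀ z ∈ F.carrier, ∃ B : LinearMap.BilinForm ℂ (Vec n),
    B.IsSymm ∧ B.Nondegenerate ∧ ∀ X Y, F.metric z X Y = B X Y
  -- holomorphic family of Frobenius algebras
  mul_holo : ∀ X Y, DifferentiableOn ℂ (fun z => F.mul z X Y) F.carrier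
  mul_bilin : ∀ z ∈ F.carrier, ∃ m : Vec n →ₗ[ℂ] Vec n →ₗ[ℂ] Vec n,
    ∀ X Y, F.mul z X Y = m X Y
  mul_comm : ∀ z ∈ F.carrier, ∀ X Y, F.mul z X Y = F.mul z Y X
  mul_assoc : ∀ z ∈ F.carrier, ∀ X Y Z, F.mul z (F.mul z X Y) Z = F.mul z X (F.mul z Y Z)
  metric_mul : ∀ z ∈ F.carrier, ∀ X Y Z, F.metric z (F.mul z X Y) Z = F.metric z X (F.mul z Y Z)
  unit_holo : DifferentiableOn ℂ F.unit F.carrier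
  unit_mul : ∀ z ∈ F.carrier, ∀ X, F.mul z (F.unit z) X = X
  euler_holo : DifferentiableOn ℂ F.euler F.carrier
  -- `η` is flat; in flat coordinates `∂_ξ c_{αβγ}` is totally symmetric (`c_{αβγ}` itself being
  -- symmetric by the previous fields) and `E` is affine, that is, `∇∇E = 0`
  flat : ∀ z ∈ F.carrier, ∃ (W : Set (Vec n)) (t : Vec n → Vec n),
    z ∈ W ∧ W ⊆ F.carrier ∧ IsFlatChart F W t ∧
    (∀ w ∈ W, ∀ α β γ ξ,
      fderiv ℂ (fun v => F.metric v (F.mul v (chartVec t v α) (chartVec t v β)) (chartVec t v γ)) w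
          (chartVec t w ξ) =
        fderiv ℂ (fun v => F.metric v (F.mul v (chartVec t v α) (chartVec t v β)) (chartVec t v ξ))
          w (chartVec t w γ)) ∧
    ∃ (A : Matrix (Fin n) (Fin n) ℂ) (b : Vec n), ∀ w ∈ W,
      (jac t w).mulVec (F.euler w) = A.mulVec (t w) + b
  -- the Lie derivative along `E`: `L_E (·) = (·)` and `L_E η = (2 - d) η`
  euler_mul : ∀ X Y : Vec n → Vec n,
    DifferentiableOn ℂ X F.carrier → DifferentiableOn ℂ Y F.carrier → ∀ z ∈ F.carrier,
      VectorField.lieBracket ℂ F.euler (fun w => F.mul w (X w) (Y w)) z =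
        F.mul z (VectorField.lieBracket ℂ F.euler X z) (Y z) +
          F.mul z (X z) (VectorField.lieBracket ℂ F.euler Y z) + F.mul z (X z) (Y z)
  euler_metric : ∀ X Y : Vec n → Vec n,
    DifferentiableOn ℂ X F.carrier → DifferentiableOn ℂ Y F.carrier → ∀ z ∈ F.carrier,
      fderiv ℂ (fun w => F.metric w (X w) (Y w)) z (F.euler z) =
        F.metric z (VectorField.lieBracket ℂ F.euler X z) (Y z) +
          F.metric z (X z) (VectorField.lieBracket ℂ F.euler Y z) +
            (2 - d) * F.metric z (X z) (Y z)

/-- `h` is a biholomorphic map that respects the Euler fields and the intersection forms and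
respects the metrics, the products and the units up to the constant `σ`:
`h^*η' = σ η`, `h_*X · h_*Y = σ h_*(X · Y)`, `h_* e = σ e'`. -/
structure IsIsoUpTo {n : ℕ} (σ : ℂ) (F F' : Data n) (h : Vec n → Vec n) : Prop where
  bij : Set.BijOn h F.carrier F'.carrier
  holo : DifferentiableOn ℂ h F.carrier
  holo_inv : ∃ k : Vec n → Vec n, DifferentiableOn ℂ k F'.carrier ∧
    Set.InvOn k h F.carrier F'.carrier
  metric : ∀ z ∈ F.carrier, ∀ X Y,
    F'.metric (h z) (fderiv ℂ h z X) (fderiv ℂ h z Y) = σ * F.metric z X Y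
  mul : ∀ z ∈ F.carrier, ∀ X Y,
    F'.mul (h z) (fderiv ℂ h z X) (fderiv ℂ h z Y) = σ • fderiv ℂ h z (F.mul z X Y)
  unit : ∀ z ∈ F.carrier, fderiv ℂ h z (F.unit z) = σ • F'.unit (h z)
  euler : ∀ z ∈ F.carrier, fderiv ℂ h z (F.euler z) = F'.euler (h z)
  intersection : ∀ z ∈ F.carrier,
    jac h z * F.intersectionForm z * (jac h z).transpose = F'.intersectionForm (h z)

/-- Isomorphism of generalized Frobenius manifolds. -/
def IsIso {n : ℕ} (F F' : Data n) (h : Vec n → Vec n) : Prop := IsIsoUpTo 1 F F' h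

/-- The Euler field `∑ α/(ℓ+1) z^α ∂/∂z^α`; the entry `i : Fin ℓ` stands for `α = i + 1`. -/
def eulerField {ℓ : ℕ} (z : Vec ℓ) : Vec ℓ :=
  fun i => ((i : ℕ) + 1 : ℂ) / (ℓ + 1 : ℂ) * z i

/-- The covector `- d log z^ℓ`. -/
def unitForm {ℓ : ℕ} (z : Vec ℓ) : Vec ℓ :=
  fun i => if (i : ℕ) + 1 = ℓ then -(z i)⁻¹ else 0

/-! ### The space of superpotentials -/

/-- The derivative `v(Λ) = ∑ v_α p^{ℓ+1-α}` of the superpotential along a tangent vector `v`. -/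
def dLam {ℓ : ℕ} (v : Vec ℓ) : Polynomial ℂ :=
  ∑ i : Fin ℓ, Polynomial.C (v i) * Polynomial.X ^ (ℓ - (i : ℕ))

/-- `Λ(p) = p^{ℓ+1} + a_1 p^ℓ + ⋯ + a_ℓ p`. -/
def superpotential {ℓ : ℕ} (a : Vec ℓ) : Polynomial ℂ :=
  Polynomial.X ^ (ℓ + 1) + dLam a

/-- `Λ'(p)`. -/
def dpLam {ℓ : ℕ} (a : Vec ℓ) : Polynomial ℂ :=
  Polynomial.derivative (superpotential a)

/-- The residue of `P(p)/Q(p) dp` at `p = q`: the coefficient of `(p - q)⁻¹` in the Laurent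
expansion at `q`. -/
def residue (P Q : Polynomial ℂ) (q : ℂ) : ℂ :=
  HahnSeries.coeff
    ((((Polynomial.taylor q P : Polynomial ℂ) : PowerSeries ℂ) : LaurentSeries ℂ) /
      (((Polynomial.taylor q Q : Polynomial ℂ) : PowerSeries ℂ) : LaurentSeries ℂ)) (-1)

/-- The sum of the residues of `P/Q dp` over the (distinct) critical points of `Λ`. -/
def critResidue {ℓ : ℕ} (a : Vec ℓ) (P Q : Polynomial ℂ) : ℂ :=
  ∑ q ∈ (dpLam a).roots.toFinset, residue P Q q

def lgMetric {ℓ : ℕ} (a X Y : Vec ℓ) : ℂ :=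
  critResidue a (dLam X * dLam Y) (Polynomial.X ^ 2 * dpLam a)

def lgCubic {ℓ : ℕ} (a X Y Z : Vec ℓ) : ℂ :=
  critResidue a (dLam X * dLam Y * dLam Z) (Polynomial.X ^ 2 * dpLam a)

def lgGram {ℓ : ℕ} (a : Vec ℓ) : Matrix (Fin ℓ) (Fin ℓ) ℂ :=
  Matrix.of fun i j => lgMetric a (Pi.single i 1) (Pi.single j 1)

/-- The product determined by `η̃(X · Y, Z) = c̃(X, Y, Z)`. -/
def lgMul {ℓ : ℕ} (a X Y : Vec ℓ) : Vec ℓ :=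
  (lgGram a)⁻¹.mulVec fun k => lgCubic a X Y (Pi.single k 1)

/-- The residue formula for the covariant intersection form, off the locus where `Λ` and `Λ'` have
a common zero. -/
def lgIntersectionGram {ℓ : ℕ} (a : Vec ℓ) : Matrix (Fin ℓ) (Fin ℓ) ℂ :=
  Matrix.of fun i j => critResidue a (dLam (Pi.single i 1 : Vec ℓ) * dLam (Pi.single j 1 : Vec ℓ))
    (Polynomial.X ^ 2 * superpotential a * dpLam a)

/-- The space of superpotentials, on the locus `a_ℓ ≠ 0` where the unit `- grad log a_ℓ` of the
product exists. -/
def lgData (ℓ : ℕ) : Data ℓ where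
  carrier := {a | ∀ i : Fin ℓ, (i : ℕ) + 1 = ℓ → a i ≠ 0}
  metric := lgMetric
  mul := lgMul
  unit := fun a => (lgGram a)⁻¹.mulVec (unitForm a)
  euler := eulerField

/-! ### The orbit space of the affine Weyl group of type `A_ℓ` with the weight `ω_ℓ` -/

/-- The simple roots (and coroots) `α_r = e_r - e_{r+1}` of `A_ℓ`. -/
def simpleRoot {ℓ : ℕ} (r : Fin ℓ) : Fin (ℓ + 1) → ℂ :=
  Pi.single r.castSucc 1 - Pi.single r.succ 1

/-- The Gram matrix `((α_i^∨, α_j^∨))`. -/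
def corootGram (ℓ : ℕ) : Matrix (Fin ℓ) (Fin ℓ) ℂ :=
  Matrix.of fun i j => simpleRoot i ⬝ᵥ simpleRoot j

/-- The fundamental weight `ω_j = e_1 + ⋯ + e_j - j/(ℓ+1) (e_1 + ⋯ + e_{ℓ+1})` of `A_ℓ`. -/
def fundWeight (ℓ j : ℕ) : Fin (ℓ + 1) → ℂ :=
  fun k => (if (k : ℕ) < j then 1 else 0) - (j : ℂ) / (ℓ + 1 : ℂ)

/-- The basic generators `y^j = N_j⁻¹ e^{-2πi θ_j c} ∑_w e^{2πi (ω_j, w(x))}` at the point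
`x = c ω_ℓ + ∑ x^r α_r^∨`, where `w` runs over the Weyl group, `N_j` is the order of the stabilizer
of `ω_j` and `θ_j = (ω_j, ω_ℓ)`. The entry `j : Fin ℓ` stands for `y^{j+1}`. -/
def weylGenerator {ℓ : ℕ} (c : ℂ) (x : Vec ℓ) (j : Fin ℓ) : ℂ :=
  (Nat.card {w : Equiv.Perm (Fin (ℓ + 1)) //
      fundWeight ℓ (j + 1) ∘ w = fundWeight ℓ (j + 1)} : ℂ)⁻¹ *
    Complex.exp (-(2 * Real.pi * Complex.I *
      (fundWeight ℓ (j + 1) ⬝ᵥ fundWeight ℓ ℓ) * c)) *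
    ∑ w : Equiv.Perm (Fin (ℓ + 1)), Complex.exp (2 * Real.pi * Complex.I *
      (fundWeight ℓ (j + 1) ⬝ᵥ
        ((c • fundWeight ℓ ℓ + ∑ r : Fin ℓ, x r • simpleRoot r) ∘ w)))

/-- `u_k = e^{2πi (x^k - x^{k-1})}` for `k ≤ ℓ` (with `x^0 = 0`) and
`u_{ℓ+1} = λ e^{-2πi x^ℓ}`; the first argument is `λ`. -/
def orbitU {ℓ : ℕ} (lam : ℂ) (x : Vec ℓ) (k : Fin (ℓ + 1)) : ℂ :=
  (if k = Fin.last ℓ then lam else 1) *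
    Complex.exp (2 * Real.pi * Complex.I * (∑ r : Fin ℓ, x r • simpleRoot r) k)

/-- The basic generators as polynomials in `λ`, that is, extended from `λ = e^{-2πi c}` to all
`λ ∈ ℂ`: the elementary symmetric functions of the `u_k`. This is the map
`φ_λ : (x^1, …, x^ℓ) ↦ (y^1, …, y^ℓ)`. -/
def generators {ℓ : ℕ} (lam : ℂ) (x : Vec ℓ) : Vec ℓ :=
  fun j => Multiset.esymm (Finset.univ.val.map (orbitU lam x)) ((j : ℕ) + 1)

/-- `(1/4π²) ∑ ∂y^i/∂x^r a^{rs} ∂y^j/∂x^s` with `(a^{rs}) = ((α_r^∨, α_s^∨))⁻¹`. -/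
def gLambda {ℓ : ℕ} (lam : ℂ) (x : Vec ℓ) (i j : Fin ℓ) : ℂ :=
  1 / (4 * Real.pi ^ 2) * ∑ r, ∑ s, pd (fun v => generators lam v i) x r *
    (corootGram ℓ)⁻¹ r s * pd (fun v => generators lam v j) x s

/-- The contravariant metrics `g`, `η` on the orbit space, in the coordinates `y^1, …, y^ℓ`, with
`g_λ = g + λ η`. -/
def IsPencil {ℓ : ℕ} (g η : Vec ℓ → Matrix (Fin ℓ) (Fin ℓ) ℂ) : Prop :=
  ∀ (lam : ℂ) (x : Vec ℓ) (i j : Fin ℓ),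
    gLambda lam x i j = g (generators lam x) i j + lam * η (generators lam x) i j

/-- The components of a contravariant metric `g` in new coordinates `t` with inverse `s`, as
functions of `t`. -/
def inCoords {n : ℕ} (t s : Vec n → Vec n) (g : Vec n → Matrix (Fin n) (Fin n) ℂ) (τ : Vec n) :
    Matrix (Fin n) (Fin n) ℂ :=
  jac t (s τ) * g (s τ) * (jac t (s τ)).transpose

/-- `t` (with inverse `s`) is a global system of flat coordinates of the contravariant metric `η`
in which the Euler field is `∑ d_α t^α ∂/∂t^α`. -/
structure IsFlatDiagonal {ℓ : ℕ} (η : Vec ℓ → Matrix (Fin ℓ) (Fin ℓ) ℂ) (t s : Vec ℓ → Vec ℓ)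
    (d : Fin ℓ → ℝ) : Prop where
  left_inv : Function.LeftInverse s t
  right_inv : Function.RightInverse s t
  holo : Differentiable ℂ t
  holo_inv : Differentiable ℂ s
  flat : ∀ τ τ', inCoords t s η τ = inCoords t s η τ'
  euler : ∀ z, fderiv ℂ t z (eulerField z) = fun α => (d α : ℂ) * t z α

/-- The Christoffel symbols `Γ^j_{rk}` of a covariant metric `G`. -/
def christoffel {n : ℕ} (G : Vec n → Matrix (Fin n) (Fin n) ℂ) (z : Vec n) (j r k : Fin n) : ℂ :=
  1 / 2 * ∑ m, (G z)⁻¹ j m * (pd (fun w => G w m k) z r + pd (fun w => G w m r) z k -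
    pd (fun w => G w r k) z m)

/-- `Γ z i j k = Γ^{ij}_k = - g^{ir} Γ^j_{rk}` are the contravariant components of the Levi-Civita
connection of the contravariant metric `g`, continued holomorphically to the points where `g` is
degenerate. -/
def IsContraLeviCivita {n : ℕ} (g : Vec n → Matrix (Fin n) (Fin n) ℂ)
    (Γ : Vec n → Fin n → Fin n → Fin n → ℂ) : Prop :=
  (∀ i j k, Differentiable ℂ fun z => Γ z i j k) ∧
  ∀ z, IsUnit (g z).det → ∀ i j k,
    Γ z i j k = -∑ r, g z i r * christoffel (fun w => (g w)⁻¹) z j r k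

/-- `c_{αβ}^γ = (κ/d_ρ) η_{αν} η_{βρ} η^{γζ} Γ^{νρ}_ζ` with `κ = 1`; here `H = (η^{αβ})`. -/
def structureConst {n : ℕ} (H : Matrix (Fin n) (Fin n) ℂ) (d : Fin n → ℝ)
    (Γ : Fin n → Fin n → Fin n → ℂ) (α β γ : Fin n) : ℂ :=
  ∑ ν, ∑ ρ, ∑ ζ, 1 / (d ρ : ℂ) * H⁻¹ α ν * H⁻¹ β ρ * H γ ζ * Γ ν ρ ζ

/-- The structure on `ℳ_D(A_ℓ, ω_ℓ)` in the coordinates `y^1, …, y^ℓ`: the complement of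
`{det η = 0} ∪ {y^ℓ = 0}`, the metric `(η^{ij})⁻¹`, the product with structure constants
`c_{αβ}^γ` in the flat coordinates `t`, the unit `- grad_η log y^ℓ` and the Euler field.
`Γ` is a function of `t`. -/
def orbitData {ℓ : ℕ} (η : Vec ℓ → Matrix (Fin ℓ) (Fin ℓ) ℂ) (t s : Vec ℓ → Vec ℓ)
    (d : Fin ℓ → ℝ) (Γ : Vec ℓ → Fin ℓ → Fin ℓ → Fin ℓ → ℂ) : Data ℓ where
  carrier := {z | (η z).det ≠ 0 ∧ ∀ i : Fin ℓ, (i : ℕ) + 1 = ℓ → z i ≠ 0}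
  metric := fun z X Y => X ⬝ᵥ (η z)⁻¹.mulVec Y
  mul := fun z X Y => fderiv ℂ s (t z) fun γ => ∑ α, ∑ β,
    structureConst (inCoords t s η (t z)) d (Γ (t z)) α β γ *
      fderiv ℂ t z X α * fderiv ℂ t z Y β
  unit := fun z => (η z).mulVec (unitForm z)
  euler := eulerField

/-- The map `y ↦ a` with `a_α = ε^α y^α`. -/
def hMap {ℓ : ℕ} (ε : ℂ) (y : Vec ℓ) : Vec ℓ := fun i => ε ^ ((i : ℕ) + 1) * y i

end

end GenFrob

/-! Dividing `∂(Λ)` by `p` identifies the tangent space at `a` with the polynomials of degree less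
than `ℓ` (`toPoly`), that is, with `ℂ[p]/(Λ')`. The factors `p` cancel the `p²` of the residue
formulas, and the residue theorem turns a sum over critical points into the top coefficient of a
remainder modulo `Λ'` (`residueSum_roots`). So `η̃` is the residue pairing of `x y / Λ'`. It is
nondegenerate for every `a`, and its inverse is the Hankel matrix of the coefficients of `Λ'`
(`lgGram_mul_hankel`). The product is `p x y` modulo `Λ'`; its unit is the inverse of `p`, which
exists exactly when `Λ'(0) = a_ℓ` is nonzero. The Euler field acts as multiplication by `Λ`.

The quotient `K` in `p x y = x·y + Λ' K(x, y)` carries the differential geometry. Its derivative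
`∂_p K` is, up to sign, the Christoffel tensor (`kappa`, `fderiv_lgMetric`), and differentiating the
associativity relation for `K` in `p` gives the total symmetry of `∇c` (`nablaMul_symm`). The
rescaling `Λ(p) ↦ c^{ℓ+1} Λ(p/c)` multiplies metric and product by `c^{ℓ+1}`: to first order at `c =
1` this is homogeneity along `E`, and at `c = -1` it is the map `h^-`. Flat coordinates are constant
terms of the powers `Λ^{k/(ℓ+1)}` expanded at infinity (`flatCoord_flat`); they are triangular in
`a`, hence globally invertible.

On the orbit space everything follows from `∏ (p + u_k) = Λ_y(p) + λ` (`prod_X_add_C_orbitU`).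
Paired with the covectors `v ↦ v(Λ)(s)`, the form `g_λ` becomes a rational expression in `Λ_y + λ`
and `Λ_y'`, affine in `λ`, whose two parts are the intersection form and the Hankel matrix
(`gLambda_eq`). Every `y` is reached for each `λ ≠ 0`, so the pencil is unique. In flat coordinates
`d_β c^{αβ}_γ` satisfies the two equations that characterize the contravariant Levi-Civita
connection of `g`, and no `d_β` vanishes. Dividing by `d_ρ` therefore returns the product of
`ℂ[p]/(Λ')`: the orbit space data coincide with the superpotential data
(`IsFlatDiagonal.orbitData_eq`), `h` is the identity and `h^-` is a rescaling. -/

namespace GenFrob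

open Polynomial

/-! ### Residues -/

/-- The Laurent expansion of a polynomial at `q`. -/
noncomputable def laurentAt (q : ℂ) : ℂ[X] →+* LaurentSeries ℂ :=
  (HahnSeries.ofPowerSeries ℤ ℂ).comp
    ((Polynomial.coeToPowerSeries.ringHom).comp (taylorAlgHom q : ℂ[X] →ₐ[ℂ] ℂ[X]).toRingHom)

theorem residue_eq_coeff (P Q : ℂ[X]) (q : ℂ) :
    residue P Q q = (laurentAt q P / laurentAt q Q).coeff (-1) := rfl

theorem laurentAt_ne_zero {P : ℂ[X]} (hP : P ≠ 0) (q : ℂ) : laurentAt q P ≠ 0 := by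
  intro h
  have h1 : ((taylor q P : ℂ[X]) : PowerSeries ℂ) = 0 :=
    (HahnSeries.ofPowerSeries_injective (Γ := ℤ)) (by rw [map_zero]; exact h)
  rw [Polynomial.coe_eq_zero_iff, taylor_eq_zero] at h1
  exact hP h1

theorem laurentAt_C (q c : ℂ) : laurentAt q (C c) = HahnSeries.C c := by
  simp [laurentAt]

theorem laurentAt_X_sub_C (q : ℂ) : laurentAt q (X - C q) = HahnSeries.single 1 1 := by
  simp [laurentAt, taylor_X]

theorem residue_add (P P' Q : ℂ[X]) (q : ℂ) :
    residue (P + P') Q q = residue P Q q + residue P' Q q := by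
  simp [residue_eq_coeff, add_div]

theorem residue_C_mul (c : ℂ) (P Q : ℂ[X]) (q : ℂ) :
    residue (C c * P) Q q = c * residue P Q q := by
  simp only [residue_eq_coeff, map_mul, mul_div_assoc, laurentAt_C]
  rw [HahnSeries.C_mul_eq_smul]; rfl

theorem residue_mul_cancel (P Q : ℂ[X]) {R : ℂ[X]} (hR : R ≠ 0) (q : ℂ) :
    residue (R * P) (R * Q) q = residue P Q q := by
  simp only [residue_eq_coeff, map_mul]
  rw [mul_div_mul_left _ _ (laurentAt_ne_zero hR q)]

/-- The expansion of `Q` at `q` is an invertible power series, so the quotient has no negative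
powers. -/
theorem residue_eq_zero (P : ℂ[X]) {Q : ℂ[X]} {q : ℂ} (hQ : Q.eval q ≠ 0) :
    residue P Q q = 0 := by
  set p' : PowerSeries ℂ := ((taylor q P : ℂ[X]) : PowerSeries ℂ)
  set q' : PowerSeries ℂ := ((taylor q Q : ℂ[X]) : PowerSeries ℂ) with hq'
  have hc : PowerSeries.constantCoeff q' ≠ 0 := by
    rw [← PowerSeries.coeff_zero_eq_constantCoeff_apply, hq', Polynomial.coeff_coe,
      taylor_coeff_zero]
    exact hQ
  have hu : q' * q'⁻¹ = 1 := PowerSeries.mul_inv_cancel q' hc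
  have hL : HahnSeries.ofPowerSeries ℤ ℂ q' * HahnSeries.ofPowerSeries ℤ ℂ q'⁻¹ = 1 := by
    rw [← map_mul, hu, map_one]
  have h1 : HahnSeries.ofPowerSeries ℤ ℂ p' / HahnSeries.ofPowerSeries ℤ ℂ q'
      = HahnSeries.ofPowerSeries ℤ ℂ (p' * q'⁻¹) := by
    rw [div_eq_iff (left_ne_zero_of_mul_eq_one hL), map_mul, mul_assoc, mul_comm _
      (HahnSeries.ofPowerSeries ℤ ℂ q'), hL, mul_one]
  change (HahnSeries.ofPowerSeries ℤ ℂ p' / HahnSeries.ofPowerSeries ℤ ℂ q').coeff (-1) = 0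
  rw [h1, HahnSeries.ofPowerSeries_apply]
  apply HahnSeries.embDomain_of_notMem_range
  rintro ⟨n, hn⟩
  have : (n : ℤ) = -1 := hn
  omega

theorem residue_one_X_sub_C_pow (q : ℂ) (n : ℕ) :
    residue 1 ((X - C q) ^ n) q = if n = 1 then 1 else 0 := by
  rw [residue_eq_coeff, map_one, map_pow, laurentAt_X_sub_C, HahnSeries.single_pow, one_div,
    HahnSeries.inv_single, HahnSeries.coeff_single]
  simp [neg_inj, eq_comm]

/-- The sum of the residues of `P / Q` at the points of `S`. -/
noncomputable def residueSum (S : Finset ℂ) (Q P : ℂ[X]) : ℂ := ∑ q ∈ S, residue P Q q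

theorem residueSum_add (S : Finset ℂ) (Q P P' : ℂ[X]) :
    residueSum S Q (P + P') = residueSum S Q P + residueSum S Q P' := by
  simp [residueSum, residue_add, Finset.sum_add_distrib]

theorem residueSum_C_mul (S : Finset ℂ) (Q : ℂ[X]) (c : ℂ) (P : ℂ[X]) :
    residueSum S Q (C c * P) = c * residueSum S Q P := by
  simp [residueSum, residue_C_mul, Finset.mul_sum]

theorem residueSum_mul_cancel (S : Finset ℂ) (P Q : ℂ[X]) {R : ℂ[X]} (hR : R ≠ 0) :
    residueSum S (R * Q) (R * P) = residueSum S Q P := by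
  simp [residueSum, residue_mul_cancel _ _ hR]

theorem residueSum_one_X_sub_C_pow (S : Finset ℂ) (q : ℂ) (hq : q ∈ S) (n : ℕ) :
    residueSum S ((X - C q) ^ n) 1 = if n = 1 then 1 else 0 := by
  rw [residueSum, Finset.sum_eq_single q, residue_one_X_sub_C_pow]
  · intro b _ hb
    apply residue_eq_zero
    simpa using pow_ne_zero n (sub_ne_zero.2 hb)
  · exact fun h => absurd hq h

/-- Induction on the number of roots. If all roots agree, the denominator is a pure power. Otherwise
partial fractions at two distinct roots write the sum as a multiple of the difference of two sums
with one root fewer, which are equal by induction. -/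
theorem residueSum_one (S : Finset ℂ) (s : Multiset ℂ) (hs : ∀ r ∈ s, r ∈ S) :
    residueSum S (s.map fun r => X - C r).prod 1 = if s.card = 1 then 1 else 0 := by
  induction hn : s.card generalizing s with
  | zero =>
    rw [Multiset.card_eq_zero] at hn
    subst hn
    simp only [Multiset.map_zero, Multiset.prod_zero, zero_ne_one, if_false]
    exact Finset.sum_eq_zero fun q _ => residue_eq_zero 1 (by simp)
  | succ n ih =>
    by_cases hall : ∃ a ∈ s, ∀ b ∈ s, b = a
    · obtain ⟨a, ha, hb⟩ := hall
      have : s = Multiset.replicate (n + 1) a := Multiset.eq_replicate.2 ⟨hn, hb⟩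
      rw [this, Multiset.map_replicate, Multiset.prod_replicate,
        residueSum_one_X_sub_C_pow S a (hs a ha)]
    · push Not at hall
      obtain ⟨a, ha⟩ : ∃ a, a ∈ s := Multiset.card_pos_iff_exists_mem.1 (by omega)
      obtain ⟨b, hb, hab⟩ := hall a ha
      obtain ⟨u, rfl⟩ := Multiset.exists_cons_of_mem ha
      have hbu : b ∈ u := (Multiset.mem_cons.1 hb).resolve_left hab
      obtain ⟨v, rfl⟩ := Multiset.exists_cons_of_mem hbu
      simp only [Multiset.card_cons] at hn
      have h1 := ih (a ::ₘ v) (fun r hr => hs r (by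
        rcases Multiset.mem_cons.1 hr with h | h <;> simp [h])) (by simp; omega)
      have h2 := ih (b ::ₘ v) (fun r hr => hs r (by
        rcases Multiset.mem_cons.1 hr with h | h <;> simp [h])) (by simp; omega)
      set Q := (v.map fun r => X - C r).prod with hQ
      simp only [Multiset.map_cons, Multiset.prod_cons, ← hQ] at h1 h2 ⊢
      rw [← residueSum_mul_cancel S _ _ (X_sub_C_ne_zero b)] at h1
      rw [← residueSum_mul_cancel S _ _ (X_sub_C_ne_zero a)] at h2
      rw [show (X - C b) * ((X - C a) * Q) = (X - C a) * ((X - C b) * Q) by ring] at h1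
      have hne : b - a ≠ 0 := sub_ne_zero.2 hab
      have h3 : (1 : ℂ[X]) = C ((b - a)⁻¹) * (C (-1) * ((X - C b) * 1) + (X - C a) * 1) := by
        rw [show C (-1) * ((X - C b) * 1) + (X - C a) * 1 = C (b - a) by
          simp only [C_neg, C_1, C_sub]; ring]
        rw [← C_mul, inv_mul_cancel₀ hne, C_1]
      rw [h3, residueSum_C_mul, residueSum_add, residueSum_C_mul, h1, h2]
      have : n ≠ 0 := by omega
      simp only [this, Nat.add_eq_right, if_false, mul_eq_zero]
      right
      split_ifs <;> norm_num

/-- The residue theorem on the projective line. -/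
theorem residueSum_eq_coeff (S : Finset ℂ) (s : Multiset ℂ) (hs : ∀ r ∈ s, r ∈ S) (P : ℂ[X])
    (hP : P.degree < s.card) :
    residueSum S (s.map fun r => X - C r).prod P = P.coeff (s.card - 1) := by
  induction s using Multiset.induction_on generalizing P with
  | empty =>
    have : P = 0 := by simpa using hP
    simp [this, residueSum, residue]
  | cons a u ih =>
    set P1 := P /ₘ (X - C a)
    have hdiv : P = (X - C a) * P1 + C (P.eval a) * 1 := by
      have := modByMonic_add_div P (X - C a)
      rw [modByMonic_X_sub_C_eq_C_eval] at this
      rw [mul_one, add_comm]; exact this.symm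
    -- `natDegree` truncates at zero, so a constant `P`, for which the quotient vanishes, is treated
    -- apart.
    have hd : P1.degree < u.card := by
      by_cases h0 : P1 = 0
      · rw [h0, degree_zero]; exact WithBot.bot_lt_coe _
      have h1 := natDegree_divByMonic P (monic_X_sub_C a)
      rw [natDegree_X_sub_C] at h1
      have hPn : P ≠ 0 := by
        rintro rfl
        exact h0 (zero_divByMonic _)
      have h2 : P.natDegree < u.card + 1 := by
        rw [natDegree_lt_iff_degree_lt hPn]
        simpa using hP
      have h3 : P.natDegree ≠ 0 := by
        intro h
        apply h0
        apply (divByMonic_eq_zero_iff (monic_X_sub_C a)).2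
        rw [degree_X_sub_C]
        exact lt_of_le_of_lt (degree_le_of_natDegree_le h.le) (by norm_num)
      rw [← natDegree_lt_iff_degree_lt h0]
      change P1.natDegree = _ at h1
      omega
    have h1 := ih (fun r hr => hs r (Multiset.mem_cons_of_mem hr)) P1 hd
    have h2 := residueSum_one S (a ::ₘ u) hs
    rw [hdiv, residueSum_add, residueSum_C_mul, h2, Multiset.map_cons, Multiset.prod_cons,
      residueSum_mul_cancel S _ _ (X_sub_C_ne_zero a), h1]
    rw [← hdiv]
    -- The constant remainder contributes a residue only when `a` is the single root; with more
    -- roots the coefficient comes from the quotient alone.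
    rcases Nat.eq_zero_or_pos u.card with h0 | h0
    · have hP1 : P1 = 0 := by simpa [h0] using hd
      rw [hP1] at hdiv ⊢
      have : P.coeff 0 = P.eval a := by
        conv_lhs => rw [hdiv]
        simp
      simp [h0, this]
    · have : P.coeff u.card = P1.coeff (u.card - 1) := by
        conv_lhs => rw [hdiv]
        obtain ⟨m, hm⟩ : ∃ m, u.card = m + 1 := ⟨u.card - 1, by omega⟩
        rw [coeff_add, sub_mul, coeff_sub, hm, coeff_X_mul, coeff_C_mul, coeff_C_mul, coeff_one]
        have hz : P1.coeff (m + 1) = 0 := coeff_eq_zero_of_degree_lt (by rw [← hm]; exact hd)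
        simp [hz]
      simp [this]
      intro h; simp [h] at h0

/-- Multiples of `D` give polynomials, which have no residues, so only the remainder counts; the
residue theorem applies to it because its degree is less than that of `D`. -/
theorem residueSum_roots (D : ℂ[X]) (hD : D ≠ 0) (P : ℂ[X]) :
    residueSum D.roots.toFinset D P =
      (P % D).coeff (D.natDegree - 1) / D.leadingCoeff := by
  have hsplit := IsAlgClosed.splits D
  have hfac : D = C D.leadingCoeff * (D.roots.map fun r => X - C r).prod :=
    Splits.eq_prod_roots hsplit
  have hcard : D.roots.card = D.natDegree := by
    have := Splits.natDegree_eq_card_roots hsplit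
    exact this.symm
  have hl : D.leadingCoeff ≠ 0 := leadingCoeff_ne_zero.2 hD
  have h1 : residueSum D.roots.toFinset D P = residueSum D.roots.toFinset D (P % D) := by
    conv_lhs => rw [← EuclideanDomain.mod_add_div P D]
    rw [residueSum_add]
    have : residueSum D.roots.toFinset D (D * (P / D)) = 0 := by
      have := residueSum_mul_cancel D.roots.toFinset (P / D) 1 hD
      rw [mul_one] at this
      rw [this]
      exact Finset.sum_eq_zero fun q _ => residue_eq_zero _ (by simp)
    rw [this, add_zero]
  rw [h1]
  have h2 : residueSum D.roots.toFinset D (P % D)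
      = residueSum D.roots.toFinset (C D.leadingCoeff * (D.roots.map fun r => X - C r).prod)
        (C D.leadingCoeff * (C (D.leadingCoeff⁻¹) * (P % D))) := by
    rw [← hfac, ← mul_assoc, ← C_mul, mul_inv_cancel₀ hl, C_1, one_mul]
  rw [h2, residueSum_mul_cancel _ _ _ (C_ne_zero.2 hl), residueSum_C_mul,
    residueSum_eq_coeff _ _ (fun r hr => by simpa using hr), hcard, div_eq_inv_mul]
  rw [hcard, ← degree_eq_natDegree hD]
  exact degree_mod_lt P hD

variable {ℓ : ℕ}

/-! ### The residue pairing and the product -/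

/-- Tangent vectors as polynomials of degree less than `ℓ`. -/
noncomputable def toPoly : Vec ℓ →ₗ[ℂ] ℂ[X] :=
  ∑ i : Fin ℓ, (monomial (ℓ - 1 - (i : ℕ))) ∘ₗ LinearMap.proj i

/-- The tangent vector with given coefficients. -/
noncomputable def ofPoly (ℓ : ℕ) : ℂ[X] →ₗ[ℂ] Vec ℓ :=
  LinearMap.pi fun i => lcoeff ℂ (ℓ - 1 - (i : ℕ))

theorem ofPoly_apply (P : ℂ[X]) (i : Fin ℓ) : ofPoly ℓ P i = P.coeff (ℓ - 1 - (i : ℕ)) := rfl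

theorem toPoly_apply (v : Vec ℓ) :
    toPoly v = ∑ i : Fin ℓ, C (v i) * X ^ (ℓ - 1 - (i : ℕ)) := by
  simp [toPoly, C_mul_X_pow_eq_monomial]

theorem coeff_toPoly (v : Vec ℓ) (i : Fin ℓ) : (toPoly v).coeff (ℓ - 1 - (i : ℕ)) = v i := by
  rw [toPoly_apply, finsetSum_coeff, Finset.sum_eq_single i]
  · simp
  · intro j _ hj
    rw [coeff_C_mul_X_pow, if_neg]
    intro h
    exact hj (Fin.ext (by omega))
  · simp

theorem degree_toPoly_lt (v : Vec ℓ) : (toPoly v).degree < ℓ := by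
  rw [degree_lt_iff_coeff_zero]
  intro m hm
  rw [toPoly_apply, finsetSum_coeff]
  refine Finset.sum_eq_zero fun i _ => ?_
  rw [coeff_C_mul_X_pow, if_neg (by omega)]

theorem ofPoly_toPoly (v : Vec ℓ) : ofPoly ℓ (toPoly v) = v := by
  ext i
  rw [ofPoly_apply, coeff_toPoly]

theorem toPoly_injective : Function.Injective (toPoly : Vec ℓ → ℂ[X]) :=
  Function.LeftInverse.injective ofPoly_toPoly

theorem toPoly_ofPoly {P : ℂ[X]} (hP : P.degree < ℓ) : toPoly (ofPoly ℓ P) = P := by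
  ext n
  by_cases hn : n < ℓ
  · have h := coeff_toPoly (ofPoly ℓ P) (⟨ℓ - 1 - n, by omega⟩ : Fin ℓ)
    rw [ofPoly_apply] at h
    have e : ℓ - 1 - (ℓ - 1 - n) = n := by omega
    simpa only [e] using h
  · rw [coeff_eq_zero_of_degree_lt (lt_of_lt_of_le (degree_toPoly_lt _) (by exact_mod_cast not_lt.1 hn)),
      coeff_eq_zero_of_degree_lt (lt_of_lt_of_le hP (by exact_mod_cast not_lt.1 hn))]

theorem dLam_eq (v : Vec ℓ) : dLam v = X * toPoly v := by
  rw [dLam, toPoly_apply, Finset.mul_sum]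
  refine Finset.sum_congr rfl fun i _ => ?_
  rw [← mul_assoc, mul_comm X, mul_assoc, ← pow_succ']
  congr 2
  omega

theorem degree_dLam_le (v : Vec ℓ) : (dLam v).degree ≤ ℓ := by
  rw [degree_le_iff_coeff_zero]
  intro m hm
  have hm' : ℓ < m := by exact_mod_cast hm
  obtain ⟨k, rfl⟩ : ∃ k, m = k + 1 := ⟨m - 1, by omega⟩
  rw [dLam_eq, coeff_X_mul]
  exact coeff_eq_zero_of_degree_lt (lt_of_lt_of_le (degree_toPoly_lt v) (by exact_mod_cast (by omega)))

theorem coeff_superpotential (a : Vec ℓ) (n : ℕ) :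
    (superpotential a).coeff n = (if n = ℓ + 1 then 1 else 0) + (dLam a).coeff n := by
  rw [superpotential, coeff_add, coeff_X_pow]

theorem coeff_dpLam_top (a : Vec ℓ) : (dpLam a).coeff ℓ = ℓ + 1 := by
  rw [dpLam, coeff_derivative, coeff_superpotential, coeff_eq_zero_of_degree_lt
    (lt_of_le_of_lt (degree_dLam_le a) (by exact_mod_cast Nat.lt_succ_self ℓ))]
  simp

theorem degree_dpLam_le (a : Vec ℓ) : (dpLam a).degree ≤ ℓ := by
  rw [degree_le_iff_coeff_zero]
  intro m hm
  have hm' : ℓ < m := by exact_mod_cast hm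
  rw [dpLam, coeff_derivative, coeff_superpotential, coeff_eq_zero_of_degree_lt
    (lt_of_le_of_lt (degree_dLam_le a) (by exact_mod_cast (by omega))), if_neg (by omega)]
  simp

theorem natDegree_dpLam (a : Vec ℓ) : (dpLam a).natDegree = ℓ := by
  apply natDegree_eq_of_le_of_coeff_ne_zero (natDegree_le_of_degree_le (degree_dpLam_le a))
  rw [coeff_dpLam_top]
  exact_mod_cast Nat.succ_ne_zero ℓ

theorem leadingCoeff_dpLam (a : Vec ℓ) : (dpLam a).leadingCoeff = ℓ + 1 := by
  rw [leadingCoeff, natDegree_dpLam, coeff_dpLam_top]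

theorem succ_ne_zero_complex (ℓ : ℕ) : (ℓ + 1 : ℂ) ≠ 0 := by exact_mod_cast Nat.succ_ne_zero ℓ

theorem dpLam_ne_zero (a : Vec ℓ) : dpLam a ≠ 0 := by
  rw [← leadingCoeff_ne_zero, leadingCoeff_dpLam]
  exact succ_ne_zero_complex ℓ

theorem degree_dpLam (a : Vec ℓ) : (dpLam a).degree = ℓ := by
  rw [degree_eq_natDegree (dpLam_ne_zero a), natDegree_dpLam]

/-- The sum of the residues of `P / Λ'` over the critical points of `Λ`. -/
noncomputable def resFun (a : Vec ℓ) : ℂ[X] →ₗ[ℂ] ℂ where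
  toFun P := residueSum (dpLam a).roots.toFinset (dpLam a) P
  map_add' P Q := residueSum_add _ _ _ _
  map_smul' c P := by rw [smul_eq_C_mul, residueSum_C_mul]; rfl

/-- From here on residues enter only as this linear functional on `ℂ[p]/(Λ')`; multiplicities of
critical points no longer matter. -/
theorem resFun_apply (a : Vec ℓ) (P : ℂ[X]) :
    resFun a P = (P % dpLam a).coeff (ℓ - 1) / (ℓ + 1) := by
  change residueSum _ _ _ = _
  rw [residueSum_roots _ (dpLam_ne_zero a), natDegree_dpLam, leadingCoeff_dpLam]

theorem resFun_of_dvd (a : Vec ℓ) {P : ℂ[X]} (h : dpLam a ∣ P) : resFun a P = 0 := by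
  rw [resFun_apply, EuclideanDomain.mod_eq_zero.2 h]
  simp

theorem resFun_congr (a : Vec ℓ) {P Q : ℂ[X]} (h : dpLam a ∣ P - Q) :
    resFun a P = resFun a Q := by
  rw [← sub_eq_zero, ← map_sub, resFun_of_dvd a h]

theorem resFun_of_degree_lt (a : Vec ℓ) {P : ℂ[X]} (h : P.degree < ℓ) :
    resFun a P = P.coeff (ℓ - 1) / (ℓ + 1) := by
  rw [resFun_apply, (mod_eq_self_iff (dpLam_ne_zero a)).2 (by rwa [degree_dpLam])]

/-- Each `∂(Λ)` is divisible by `p`, which removes `p²` from the denominator. Hence nothing special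
happens on `a_ℓ = 0`, where `p = 0` is a critical point. -/
theorem lgMetric_eq (a X' Y : Vec ℓ) : lgMetric a X' Y = resFun a (toPoly X' * toPoly Y) := by
  have h := residueSum_mul_cancel (dpLam a).roots.toFinset (toPoly X' * toPoly Y) (dpLam a)
    (pow_ne_zero 2 X_ne_zero : (X : ℂ[X]) ^ 2 ≠ 0)
  rw [lgMetric, dLam_eq, dLam_eq,
    show (X : ℂ[X]) * toPoly X' * (X * toPoly Y) = X ^ 2 * (toPoly X' * toPoly Y) by ring]
  exact h

/-- One factor `p` survives. It twists the multiplication of `ℂ[p]/(Λ')`, and it is why a unit needs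
`p` to be invertible modulo `Λ'`. -/
theorem lgCubic_eq (a X' Y Z : Vec ℓ) :
    lgCubic a X' Y Z = resFun a (X * toPoly X' * toPoly Y * toPoly Z) := by
  have h := residueSum_mul_cancel (dpLam a).roots.toFinset (X * toPoly X' * toPoly Y * toPoly Z)
    (dpLam a) (pow_ne_zero 2 X_ne_zero : (X : ℂ[X]) ^ 2 ≠ 0)
  rw [lgCubic, dLam_eq, dLam_eq, dLam_eq,
    show (X : ℂ[X]) * toPoly X' * (X * toPoly Y) * (X * toPoly Z)
      = X ^ 2 * (X * toPoly X' * toPoly Y * toPoly Z) by ring]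
  exact h

/-- The residue pairing as a bilinear form. -/
noncomputable def lgBilin (a : Vec ℓ) : LinearMap.BilinForm ℂ (Vec ℓ) :=
  LinearMap.mk₂ ℂ (fun X' Y => resFun a (toPoly X' * toPoly Y))
    (by intros; simp [add_mul]) (by intros; simp) (by intros; simp [mul_add]) (by intros; simp)

theorem lgBilin_apply (a X' Y : Vec ℓ) : lgBilin a X' Y = lgMetric a X' Y := by
  rw [lgMetric_eq]; rfl

theorem lgMetric_comm (a X' Y : Vec ℓ) : lgMetric a X' Y = lgMetric a Y X' := by
  rw [lgMetric_eq, lgMetric_eq, mul_comm]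

theorem lgGram_eq (a : Vec ℓ) : lgGram a = LinearMap.BilinForm.toMatrix' (lgBilin a) := by
  ext i j
  rw [LinearMap.BilinForm.toMatrix'_apply, lgBilin_apply]
  rfl

theorem lgMetric_eq_dotProduct (a X' Y : Vec ℓ) :
    lgMetric a X' Y = X' ⬝ᵥ (lgGram a).mulVec Y := by
  rw [← lgBilin_apply, lgGram_eq]
  conv_lhs => rw [← Matrix.toBilin'_toMatrix' (lgBilin a)]
  rw [Matrix.toBilin'_apply']

/-! ### The Hankel matrix as inverse of the residue pairing -/

/-- The quotient of a polynomial by `X ^ n`. -/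
noncomputable def shift (n : ℕ) (P : ℂ[X]) : ℂ[X] := divX^[n] P

theorem coeff_shift (n : ℕ) (P : ℂ[X]) (m : ℕ) : (shift n P).coeff m = P.coeff (m + n) := by
  induction n generalizing m with
  | zero => rfl
  | succ n ih =>
    rw [shift, Function.iterate_succ_apply', coeff_divX]
    have := ih (m + 1)
    rw [shift] at this
    rw [this, add_right_comm, add_assoc]

theorem degree_sub_shift_lt (n : ℕ) (P : ℂ[X]) : (P - X ^ n * shift n P).degree < (n : WithBot ℕ) := by
  rw [degree_lt_iff_coeff_zero]
  intro m hm
  rw [coeff_sub, coeff_X_pow_mul', if_pos hm, coeff_shift, Nat.sub_add_cancel hm, sub_self]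

theorem degree_shift_lt {n m k : ℕ} {P : ℂ[X]} (hP : P.degree < k) (h : k ≤ n + m) :
    (shift n P).degree < m := by
  rw [degree_lt_iff_coeff_zero]
  intro j hj
  rw [coeff_shift]
  exact coeff_eq_zero_of_degree_lt (lt_of_lt_of_le hP (by exact_mod_cast (by omega)))

/-- The contravariant metric, the inverse of the residue pairing. -/
noncomputable def hankel (a : Vec ℓ) : Matrix (Fin ℓ) (Fin ℓ) ℂ :=
  Matrix.of fun i j => (dpLam a).coeff (ℓ - 1 - (i : ℕ) + (ℓ - (j : ℕ)))

theorem hankel_transpose (a : Vec ℓ) : (hankel a).transpose = hankel a := by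
  ext i j
  simp only [hankel, Matrix.transpose_apply, Matrix.of_apply]
  congr 1
  omega

theorem hankel_col (a : Vec ℓ) (j : Fin ℓ) :
    (hankel a).mulVec (Pi.single j 1) = ofPoly ℓ (shift (ℓ - j) (dpLam a)) := by
  ext i
  rw [ofPoly_apply, coeff_shift]
  simp [hankel]

theorem toPoly_hankel_col (a : Vec ℓ) (j : Fin ℓ) :
    toPoly ((hankel a).mulVec (Pi.single j 1)) = shift (ℓ - j) (dpLam a) := by
  rw [hankel_col, toPoly_ofPoly]
  refine degree_shift_lt (k := ℓ + 1) (lt_of_le_of_lt (degree_dpLam_le a) ?_) (by omega)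
  exact_mod_cast Nat.lt_succ_self ℓ

theorem toPoly_single (i : Fin ℓ) : toPoly (Pi.single i 1 : Vec ℓ) = X ^ (ℓ - 1 - (i : ℕ)) := by
  rw [toPoly_apply, Finset.sum_eq_single i]
  · simp
  · intro j _ hj; simp [Pi.single_eq_of_ne hj]
  · simp

/-- Euler's dual bases: the powers of `p` are dual, under the residue pairing modulo `Λ'`, to the
truncations of `Λ'` divided by powers of `p`. For `j ≤ i` the product has degree below `ℓ` and its
top coefficient can be read off. -/
theorem resFun_shift (a : Vec ℓ) (i j : Fin ℓ) :
    resFun a (X ^ (ℓ - 1 - (i : ℕ)) * shift (ℓ - j) (dpLam a)) = if i = j then 1 else 0 := by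
  have hi := i.2
  have hj := j.2
  by_cases hij : j ≤ i
  · have hij' : (j : ℕ) ≤ i := hij
    have hdeg : (X ^ (ℓ - 1 - (i : ℕ)) * shift (ℓ - j) (dpLam a)).degree < (ℓ : WithBot ℕ) := by
      rw [degree_lt_iff_coeff_zero]
      intro m hm
      rw [coeff_X_pow_mul']
      split_ifs
      · rw [coeff_shift]
        exact coeff_eq_zero_of_degree_lt (lt_of_le_of_lt (degree_dpLam_le a)
          (by exact_mod_cast (by omega)))
      · rfl
    rw [resFun_of_degree_lt a hdeg, coeff_X_pow_mul', if_pos (by omega), coeff_shift,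
      show ℓ - 1 - (ℓ - 1 - (i : ℕ)) + (ℓ - j) = ℓ + (i - j) by omega]
    by_cases h : i = j
    · subst h
      rw [if_pos rfl, Nat.sub_self, add_zero, coeff_dpLam_top, div_self (succ_ne_zero_complex ℓ)]
    · have : (i : ℕ) ≠ j := fun h' => h (Fin.ext h')
      rw [if_neg h, coeff_eq_zero_of_degree_lt (lt_of_le_of_lt (degree_dpLam_le a)
          (by exact_mod_cast (by omega))), zero_div]
  -- Here the product is a multiple of `Λ'` minus a power of `p` times the discarded low part of
  -- `Λ'`, which has degree below `ℓ - 1`.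
  · have hij' : (i : ℕ) < j := not_le.1 hij
    rw [if_neg (fun h => hij h.ge)]
    have h1 := degree_sub_shift_lt (ℓ - j) (dpLam a)
    have h2 : (X ^ ((j : ℕ) - 1 - i) * (dpLam a - X ^ (ℓ - j) * shift (ℓ - j) (dpLam a))).degree
        < ((ℓ - 1 : ℕ) : WithBot ℕ) := by
      rw [degree_lt_iff_coeff_zero] at h1 ⊢
      intro m hm
      rw [coeff_X_pow_mul']
      split_ifs
      · exact h1 _ (by omega)
      · rfl
    have h3 : X ^ (ℓ - 1 - (i : ℕ)) * shift (ℓ - j) (dpLam a) = dpLam a * X ^ ((j : ℕ) - 1 - i)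
        - X ^ ((j : ℕ) - 1 - i) * (dpLam a - X ^ (ℓ - j) * shift (ℓ - j) (dpLam a)) := by
      rw [show ℓ - 1 - (i : ℕ) = (j - 1 - i) + (ℓ - j) by omega, pow_add]
      ring
    rw [h3, map_sub, resFun_of_dvd a (dvd_mul_right _ _), resFun_of_degree_lt a
      (lt_of_lt_of_le h2 (by exact_mod_cast (by omega))), coeff_eq_zero_of_degree_lt h2]
    simp

theorem lgGram_mul_hankel (a : Vec ℓ) : lgGram a * hankel a = 1 := by
  ext i j
  have h1 : (lgGram a * hankel a) i j
      = lgMetric a (Pi.single i 1) ((hankel a).mulVec (Pi.single j 1)) := by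
    rw [lgMetric_eq_dotProduct, Matrix.mulVec_mulVec]
    simp
  rw [h1, lgMetric_eq, toPoly_hankel_col, toPoly_single, resFun_shift, Matrix.one_apply]

theorem hankel_mul_lgGram (a : Vec ℓ) : hankel a * lgGram a = 1 :=
  mul_eq_one_comm.1 (lgGram_mul_hankel a)

theorem isUnit_det_lgGram (a : Vec ℓ) : IsUnit (lgGram a).det :=
  Matrix.isUnit_det_of_right_inverse (lgGram_mul_hankel a)

theorem isUnit_det_hankel (a : Vec ℓ) : IsUnit (hankel a).det :=
  Matrix.isUnit_det_of_right_inverse (hankel_mul_lgGram a)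

theorem lgGram_inv (a : Vec ℓ) : (lgGram a)⁻¹ = hankel a :=
  Matrix.inv_eq_right_inv (lgGram_mul_hankel a)

theorem hankel_inv (a : Vec ℓ) : (hankel a)⁻¹ = lgGram a :=
  Matrix.inv_eq_right_inv (hankel_mul_lgGram a)

theorem lgGram_transpose (a : Vec ℓ) : (lgGram a).transpose = lgGram a := by
  ext i j
  exact lgMetric_comm a _ _

theorem lgMetric_hankel (a X' w : Vec ℓ) : lgMetric a X' ((hankel a).mulVec w) = X' ⬝ᵥ w := by
  rw [lgMetric_eq_dotProduct, Matrix.mulVec_mulVec, lgGram_mul_hankel, Matrix.one_mulVec]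

theorem eq_of_lgMetric (a : Vec ℓ) {X' Y : Vec ℓ}
    (h : ∀ Z, lgMetric a X' Z = lgMetric a Y Z) : X' = Y := by
  apply dotProduct_eq
  intro w
  rw [← lgMetric_hankel a, ← lgMetric_hankel a, h]

theorem lgMetric_add_left (a X' Y Z : Vec ℓ) :
    lgMetric a (X' + Y) Z = lgMetric a X' Z + lgMetric a Y Z := by
  simp [← lgBilin_apply]

theorem lgMetric_smul_left (a : Vec ℓ) (c : ℂ) (X' Z : Vec ℓ) :
    lgMetric a (c • X') Z = c * lgMetric a X' Z := by
  simp [← lgBilin_apply]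

theorem degree_mod_dpLam (a : Vec ℓ) (P : ℂ[X]) : (P % dpLam a).degree < ℓ := by
  rw [← degree_dpLam a]
  exact degree_mod_lt P (dpLam_ne_zero a)

/-- Pairing the remainder with each coordinate vector gives the cubic form, because the residue
functional does not see multiples of `Λ'`; nondegeneracy then identifies the product. -/
theorem lgMul_eq_ofPoly (a X' Y : Vec ℓ) :
    lgMul a X' Y = ofPoly ℓ ((X * toPoly X' * toPoly Y) % dpLam a) := by
  have h : (fun k => lgCubic a X' Y (Pi.single k 1))
      = (lgGram a).mulVec (ofPoly ℓ ((X * toPoly X' * toPoly Y) % dpLam a)) := by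
    ext k
    have h1 : ((lgGram a).mulVec (ofPoly ℓ ((X * toPoly X' * toPoly Y) % dpLam a))) k
        = lgMetric a (Pi.single k 1) (ofPoly ℓ ((X * toPoly X' * toPoly Y) % dpLam a)) := by
      rw [lgMetric_eq_dotProduct]; simp
    rw [h1, lgMetric_eq, toPoly_ofPoly (degree_mod_dpLam a _), lgCubic_eq]
    apply resFun_congr
    rw [mul_comm (toPoly (Pi.single k 1)), ← sub_mul]
    apply Dvd.dvd.mul_right
    have := EuclideanDomain.mod_add_div (X * toPoly X' * toPoly Y) (dpLam a)
    exact ⟨_, by rw [sub_eq_iff_eq_add', this]⟩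
  rw [lgMul, h, Matrix.mulVec_mulVec, Matrix.nonsing_inv_mul _ (isUnit_det_lgGram a),
    Matrix.one_mulVec]

theorem toPoly_lgMul (a X' Y : Vec ℓ) :
    toPoly (lgMul a X' Y) = (X * toPoly X' * toPoly Y) % dpLam a := by
  rw [lgMul_eq_ofPoly, toPoly_ofPoly (degree_mod_dpLam a _)]

/-- The quotient in `∂'Λ ∂''Λ = (∂' · ∂'')Λ + p Λ' K(∂', ∂'')`. -/
noncomputable def kQuot (a X' Y : Vec ℓ) : ℂ[X] := (X * toPoly X' * toPoly Y) / dpLam a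

theorem toPoly_lgMul_add (a X' Y : Vec ℓ) :
    toPoly (lgMul a X' Y) + dpLam a * kQuot a X' Y = X * toPoly X' * toPoly Y := by
  rw [toPoly_lgMul, kQuot, EuclideanDomain.mod_add_div]

theorem eq_of_dvd_sub (a : Vec ℓ) {P Q : ℂ[X]} (hP : P.degree < ℓ) (hQ : Q.degree < ℓ)
    (h : dpLam a ∣ P - Q) : P = Q := by
  rw [← sub_eq_zero]
  apply eq_zero_of_dvd_of_degree_lt h
  rw [degree_dpLam]
  exact lt_of_le_of_lt (degree_sub_le _ _) (max_lt hP hQ)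

theorem vec_eq_of_dvd_sub (a : Vec ℓ) {v w : Vec ℓ} (h : dpLam a ∣ toPoly v - toPoly w) : v = w :=
  toPoly_injective (eq_of_dvd_sub a (degree_toPoly_lt v) (degree_toPoly_lt w) h)

/-- Uniqueness of division by `Λ'`. Identities for the product are proved by exhibiting both
remainder `Z` and quotient `K`. -/
theorem lgMul_eq_of_eq (a : Vec ℓ) {X' Y Z : Vec ℓ} {K : ℂ[X]}
    (h : toPoly Z + dpLam a * K = X * toPoly X' * toPoly Y) :
    lgMul a X' Y = Z ∧ kQuot a X' Y = K := by
  have h1 : lgMul a X' Y = Z := by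
    apply vec_eq_of_dvd_sub a
    exact ⟨K - kQuot a X' Y, by linear_combination toPoly_lgMul_add a X' Y - h⟩
  refine ⟨h1, ?_⟩
  apply mul_left_cancel₀ (dpLam_ne_zero a)
  have h2 := toPoly_lgMul_add a X' Y
  rw [h1] at h2
  linear_combination h2 - h

theorem dvd_lgMul (a X' Y : Vec ℓ) :
    dpLam a ∣ toPoly (lgMul a X' Y) - X * toPoly X' * toPoly Y :=
  ⟨-kQuot a X' Y, by linear_combination toPoly_lgMul_add a X' Y⟩

theorem lgMul_comm (a X' Y : Vec ℓ) : lgMul a X' Y = lgMul a Y X' := by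
  apply (lgMul_eq_of_eq a (K := kQuot a Y X') _).1
  linear_combination toPoly_lgMul_add a Y X'

theorem kQuot_comm (a X' Y : Vec ℓ) : kQuot a X' Y = kQuot a Y X' := by
  exact congrArg (· / dpLam a) (by ring)

theorem lgMul_assoc (a X' Y Z : Vec ℓ) :
    lgMul a (lgMul a X' Y) Z = lgMul a X' (lgMul a Y Z) := by
  apply (lgMul_eq_of_eq a (K := kQuot a X' (lgMul a Y Z) + X * toPoly X' * kQuot a Y Z
    - X * kQuot a X' Y * toPoly Z) _).1
  linear_combination toPoly_lgMul_add a X' (lgMul a Y Z)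
    + X * toPoly X' * toPoly_lgMul_add a Y Z - X * toPoly Z * toPoly_lgMul_add a X' Y

/-- The product as a bilinear map. -/
noncomputable def lgMulBilin (a : Vec ℓ) : Vec ℓ →ₗ[ℂ] Vec ℓ →ₗ[ℂ] Vec ℓ :=
  LinearMap.mk₂ ℂ (lgMul a)
    (fun X' X'' Y => (lgMul_eq_of_eq a (K := kQuot a X' Y + kQuot a X'' Y) (by
      simp only [map_add]
      linear_combination toPoly_lgMul_add a X' Y + toPoly_lgMul_add a X'' Y)).1)
    (fun c X' Y => (lgMul_eq_of_eq a (K := C c * kQuot a X' Y) (by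
      simp only [map_smul, smul_eq_C_mul]
      linear_combination C c * toPoly_lgMul_add a X' Y)).1)
    (fun X' Y Y' => (lgMul_eq_of_eq a (K := kQuot a X' Y + kQuot a X' Y') (by
      simp only [map_add]
      linear_combination toPoly_lgMul_add a X' Y + toPoly_lgMul_add a X' Y')).1)
    (fun c X' Y => (lgMul_eq_of_eq a (K := C c * kQuot a X' Y) (by
      simp only [map_smul, smul_eq_C_mul]
      linear_combination C c * toPoly_lgMul_add a X' Y)).1)

theorem lgMulBilin_apply (a X' Y : Vec ℓ) : lgMulBilin a X' Y = lgMul a X' Y := rfl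

theorem lgMetric_lgMul (a X' Y Z : Vec ℓ) :
    lgMetric a (lgMul a X' Y) Z = lgCubic a X' Y Z := by
  rw [lgMetric_eq, lgCubic_eq]
  apply resFun_congr
  rw [← sub_mul]
  exact (dvd_lgMul a X' Y).mul_right _

theorem lgMetric_lgMul_assoc (a X' Y Z : Vec ℓ) :
    lgMetric a (lgMul a X' Y) Z = lgMetric a X' (lgMul a Y Z) := by
  rw [lgMetric_comm a X', lgMetric_lgMul, lgMetric_lgMul, lgCubic_eq, lgCubic_eq]
  exact congrArg (resFun a) (by ring)

/-! ### The unit, the Euler field and the intersection form -/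

theorem unitForm_eq (a : Vec ℓ) (n : Fin ℓ) (hn : (n : ℕ) + 1 = ℓ) :
    unitForm a = -(a n)⁻¹ • (Pi.single n 1 : Vec ℓ) := by
  ext i
  by_cases h : i = n
  · subst h; simp [unitForm, hn]
  · have : (i : ℕ) + 1 ≠ ℓ := fun h' => h (Fin.ext (by omega))
    simp [unitForm, this, Pi.single_eq_of_ne h]

theorem coeff_zero_dpLam (a : Vec ℓ) (n : Fin ℓ) (hn : (n : ℕ) + 1 = ℓ) :
    (dpLam a).coeff 0 = a n := by
  rw [dpLam, coeff_derivative, coeff_superpotential, if_neg (by omega), dLam_eq, coeff_X_mul]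
  have := coeff_toPoly a n
  rw [show ℓ - 1 - (n : ℕ) = 0 by omega] at this
  simp [this]

theorem X_mul_shift_one (P : ℂ[X]) : X * shift 1 P = P - C (P.coeff 0) := by
  rw [eq_sub_iff_add_eq]
  exact X_mul_divX_add P

/-- The gradient of `a_ℓ` is `(Λ' - a_ℓ)/p` after division by `p`. The result is `1` modulo `Λ'`,
which gives both the unit property and `e(Λ) = 1` at critical points. -/
theorem dLam_unit (a : Vec ℓ) (n : Fin ℓ) (hn : (n : ℕ) + 1 = ℓ) (ha : a n ≠ 0) :
    dLam ((hankel a).mulVec (unitForm a)) = 1 - C (a n)⁻¹ * dpLam a := by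
  rw [dLam_eq, unitForm_eq a n hn, Matrix.mulVec_smul, map_smul, toPoly_hankel_col,
    show ℓ - (n : ℕ) = 1 by omega, mul_smul_comm, X_mul_shift_one, coeff_zero_dpLam a n hn,
    smul_eq_C_mul, mul_sub, ← C_mul]
  simp [ha]
  ring

/-- Euler's relation for the weights `deg p = 1/(ℓ+1)`, `deg a_α = α/(ℓ+1)`. Modulo `Λ'`,
multiplication by `E` is therefore multiplication by `Λ`. -/
theorem dLam_euler (a : Vec ℓ) :
    dLam (eulerField a) = superpotential a - C (ℓ + 1 : ℂ)⁻¹ * (X * dpLam a) := by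
  have h : X * derivative (dLam a)
      = ∑ i : Fin ℓ, C ((ℓ - (i : ℕ) : ℂ) * a i) * X ^ (ℓ - (i : ℕ)) := by
    rw [dLam, derivative_sum, Finset.mul_sum]
    refine Finset.sum_congr rfl fun i _ => ?_
    have hi := i.2
    obtain ⟨m, hm⟩ : ∃ m, ℓ - (i : ℕ) = m + 1 := ⟨ℓ - i - 1, by omega⟩
    have hc : (ℓ - (i : ℕ) : ℂ) = (m + 1 : ℕ) := by
      rw [← hm, Nat.cast_sub hi.le]
    rw [derivative_C_mul_X_pow, hm, hc]
    simp only [Nat.add_sub_cancel, C_mul, C_eq_natCast, pow_succ]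
    ring
  have hN := succ_ne_zero_complex ℓ
  rw [dpLam, superpotential, derivative_add, mul_add, h, derivative_X_pow]
  have h2 : C (ℓ + 1 : ℂ)⁻¹ * (X * (C ((ℓ + 1 : ℕ) : ℂ) * X ^ (ℓ + 1 - 1))) = X ^ (ℓ + 1) := by
    rw [show C (ℓ + 1 : ℂ)⁻¹ * (X * (C ((ℓ + 1 : ℕ) : ℂ) * X ^ (ℓ + 1 - 1)))
      = C (ℓ + 1 : ℂ)⁻¹ * C ((ℓ + 1 : ℕ) : ℂ) * (X * X ^ (ℓ + 1 - 1)) by ring, ← C_mul]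
    push_cast
    rw [inv_mul_cancel₀ hN, C_1, one_mul, pow_succ']
  rw [mul_add, h2, add_sub_add_left_eq_sub, dLam, dLam, Finset.mul_sum, ← Finset.sum_sub_distrib]
  refine Finset.sum_congr rfl fun i _ => ?_
  rw [← mul_assoc, ← C_mul, ← sub_mul, ← C_sub]
  congr 2
  rw [eulerField]
  field_simp
  ring

/-! ### Generating functions over evaluation covectors -/

/-- The covector `v ↦ v(Λ)(s)`. -/
def evalCovector (s : ℂ) : Vec ℓ := fun i => s ^ (ℓ - (i : ℕ))

theorem dotProduct_evalCovector (v : Vec ℓ) (s : ℂ) : v ⬝ᵥ evalCovector s = (dLam v).eval s := by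
  simp [dLam, eval_finsetSum, dotProduct, evalCovector]

theorem eq_zero_of_dotProduct_evalCovector (v : Vec ℓ) (r : ℂ)
    (h : ∀ s, s ≠ r → v ⬝ᵥ evalCovector s = 0) : v = 0 := by
  have h1 : dLam v = 0 := by
    apply eq_zero_of_infinite_isRoot
    apply Set.Infinite.mono (s := {r}ᶜ)
    · intro s hs
      change (dLam v).eval s = 0
      rw [← dotProduct_evalCovector]
      exact h s hs
    · exact (Set.finite_singleton r).infinite_compl
  rw [dLam_eq] at h1
  have h2 := (mul_eq_zero.1 h1).resolve_left X_ne_zero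
  exact toPoly_injective (by rw [h2, map_zero])

/-- The pairings are polynomial in `s` and `p`, so values off the diagonal suffice. This permits
closed forms that carry a factor `p - s`. -/
theorem matrix_eq_of_evalCovector {M M' : Matrix (Fin ℓ) (Fin ℓ) ℂ}
    (h : ∀ p s : ℂ, s ≠ p → evalCovector s ⬝ᵥ M.mulVec (evalCovector p)
      = evalCovector s ⬝ᵥ M'.mulVec (evalCovector p)) : M = M' := by
  rw [← sub_eq_zero]
  have h1 : ∀ p, (M - M').mulVec (evalCovector p) = 0 := by
    intro p
    apply eq_zero_of_dotProduct_evalCovector _ p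
    intro s hs
    rw [dotProduct_comm, Matrix.sub_mulVec, dotProduct_sub, h p s hs, sub_self]
  ext i j
  have h2 : (M - M') i = 0 := by
    apply eq_zero_of_dotProduct_evalCovector _ 0
    intro s _
    exact congrFun (h1 s) i
  rw [h2]
  rfl

theorem shift_succ_mul (m : ℕ) (P : ℂ[X]) : X * shift (m + 1) P = shift m P - C (P.coeff m) := by
  have := X_mul_shift_one (shift m P)
  rw [coeff_shift, zero_add] at this
  rw [← this, shift, Function.iterate_succ_apply']
  rfl

theorem sub_mul_sum_shift (s : ℂ) (n : ℕ) (P : ℂ[X]) :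
    (X - C s) * ∑ m ∈ Finset.range n, C (s ^ (m + 1)) * shift (m + 1) P
      = C s * (P - C (s ^ n) * shift n P - ∑ m ∈ Finset.range n, C (P.coeff m * s ^ m)) := by
  induction n with
  | zero => simp [shift]
  | succ n ih =>
    rw [Finset.sum_range_succ, Finset.sum_range_succ, mul_add, ih]
    have h := shift_succ_mul n P
    simp only [C_mul, C_pow, pow_succ]
    linear_combination (C s ^ n * C s) * h

/-- The sum telescopes to `s` times the difference quotient of `P`; with `P = Λ'` this is the
generating function of the Hankel columns. -/
theorem sub_mul_sum_shift_fin (s : ℂ) (P : ℂ[X]) (hP : P.degree ≤ ℓ) :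
    (X - C s) * ∑ j : Fin ℓ, C (s ^ (ℓ - (j : ℕ))) * shift (ℓ - j) P
      = C s * (P - C (P.eval s)) := by
  have h1 : ∑ j : Fin ℓ, C (s ^ (ℓ - (j : ℕ))) * shift (ℓ - j) P
      = ∑ m ∈ Finset.range ℓ, C (s ^ (m + 1)) * shift (m + 1) P := by
    rw [Fin.sum_univ_eq_sum_range (fun j => C (s ^ (ℓ - j)) * shift (ℓ - j) P) ℓ,
      ← Finset.sum_range_reflect]
    refine Finset.sum_congr rfl fun m hm => ?_
    have : m < ℓ := Finset.mem_range.1 hm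
    rw [show ℓ - (ℓ - 1 - m) = m + 1 by omega]
  have h2 : shift ℓ P = C (P.coeff ℓ) := by
    ext n
    rw [coeff_shift, coeff_C]
    split_ifs with h
    · rw [h, zero_add]
    · exact coeff_eq_zero_of_degree_lt (lt_of_le_of_lt hP (by exact_mod_cast (by omega)))
  have h3 : P.eval s = ∑ m ∈ Finset.range (ℓ + 1), P.coeff m * s ^ m :=
    eval_eq_sum_range' (Nat.lt_succ_of_le (natDegree_le_of_degree_le hP)) s
  rw [h1, sub_mul_sum_shift, h2, h3, Finset.sum_range_succ, C_add, map_sum]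
  simp only [C_mul]
  ring

theorem mulVec_eq_sum_single (M : Matrix (Fin ℓ) (Fin ℓ) ℂ) (w : Vec ℓ) :
    M.mulVec w = ∑ j, w j • M.mulVec (Pi.single j 1) := by
  conv_lhs => rw [← Finset.univ_sum_single w]
  rw [Matrix.mulVec_sum]
  refine Finset.sum_congr rfl fun j _ => ?_
  rw [← Matrix.mulVec_smul, ← Pi.single_smul, smul_eq_mul, mul_one]

theorem sub_mul_toPoly_hankel (a : Vec ℓ) (s : ℂ) :
    (X - C s) * toPoly ((hankel a).mulVec (evalCovector s))
      = C s * (dpLam a - C ((dpLam a).eval s)) := by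
  rw [← sub_mul_sum_shift_fin s (dpLam a) (degree_dpLam_le a), mulVec_eq_sum_single, map_sum]
  congr 1
  refine Finset.sum_congr rfl fun j _ => ?_
  rw [map_smul, toPoly_hankel_col, smul_eq_C_mul]
  rfl

theorem sub_mul_hankel (a : Vec ℓ) (p s : ℂ) :
    (p - s) * (evalCovector p ⬝ᵥ (hankel a).mulVec (evalCovector s))
      = p * s * ((dpLam a).eval p - (dpLam a).eval s) := by
  rw [dotProduct_comm, dotProduct_evalCovector, dLam_eq, eval_mul, eval_X]
  have h := congrArg (eval p) (sub_mul_toPoly_hankel a s)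
  simp only [eval_mul, eval_sub, eval_X, eval_C] at h
  linear_combination p * h

theorem degree_superpotential_le (a : Vec ℓ) {m : ℕ} (hm : ℓ + 1 < m) :
    (superpotential a).coeff m = 0 := by
  rw [coeff_superpotential, if_neg (by omega), coeff_eq_zero_of_degree_lt
    (lt_of_le_of_lt (degree_dLam_le a) (by exact_mod_cast (by omega))), add_zero]

/-- Since `E` acts as `Λ`, this is the remainder of `Λ` times the difference quotient of `Λ'`, found
in closed form instead of by division. -/
theorem sub_mul_toPoly_euler_mul (a : Vec ℓ) (s : ℂ) :
    (X - C s) * toPoly (lgMul a (eulerField a) ((hankel a).mulVec (evalCovector s)))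
      = C s * (dpLam a * C ((superpotential a).eval s) - superpotential a * C ((dpLam a).eval s)
        + (X - C s) * dpLam a * C ((dpLam a).eval s / (ℓ + 1))) := by
  obtain ⟨W, hW⟩ := X_sub_C_dvd_sub_C_eval (a := s) (p := superpotential a)
  have hB := sub_mul_toPoly_hankel a s
  set B := toPoly ((hankel a).mulVec (evalCovector s))
  set D := dpLam a with hD
  set Λ := superpotential a with hΛ
  -- `Q` differs from `Λ B` by multiples of `Λ'`: the term with the difference quotient `W` of `Λ`
  -- gives `(p - s) Q` a closed form, and the last term cancels its coefficient of `p^{ℓ+1}`, so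
  -- that `Q` has degree less than `ℓ`.
  set Q := Λ * B - C s * D * W + C (s * (D.eval s / (ℓ + 1))) * D with hQ
  have hN := succ_ne_zero_complex ℓ
  have h1 : (X - C s) * Q = C s * (D * C (Λ.eval s) - Λ * C (D.eval s)
        + (X - C s) * D * C (D.eval s / (ℓ + 1))) := by
    rw [hQ, C_mul]
    linear_combination Λ * hB + C s * D * hW
  have hdeg : Q.degree < ℓ := by
    by_cases h0 : Q = 0
    · rw [h0, degree_zero]; exact WithBot.bot_lt_coe _
    have h2 : ((X - C s) * Q).degree < ((ℓ + 1 : ℕ) : WithBot ℕ) := by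
      rw [h1, degree_lt_iff_coeff_zero]
      intro m hm
      have hDm : D.coeff m = 0 := coeff_eq_zero_of_degree_lt
        (lt_of_le_of_lt (degree_dpLam_le a) (by exact_mod_cast (by omega)))
      obtain ⟨k, rfl⟩ : ∃ k, m = k + 1 := ⟨m - 1, by omega⟩
      have hk : D.coeff k / (ℓ + 1) = Λ.coeff (k + 1) := by
        rcases (show k = ℓ ∨ ℓ < k by omega) with rfl | hk
        · rw [hD, coeff_dpLam_top, div_self hN, coeff_superpotential, if_pos rfl,
            coeff_eq_zero_of_degree_lt (lt_of_le_of_lt (degree_dLam_le a)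
              (by exact_mod_cast (by omega))), add_zero]
        · rw [degree_superpotential_le a (by omega), coeff_eq_zero_of_degree_lt
            (lt_of_le_of_lt (degree_dpLam_le a) (by exact_mod_cast hk)), zero_div]
      rw [coeff_C_mul, coeff_add, coeff_sub, coeff_mul_C, coeff_mul_C, coeff_mul_C, sub_mul,
        coeff_sub, coeff_X_mul, coeff_C_mul, hDm, ← hk]
      ring
    rw [degree_mul, degree_X_sub_C, degree_eq_natDegree h0] at h2
    rw [degree_eq_natDegree h0]
    have h3 : 1 + Q.natDegree < ℓ + 1 := by exact_mod_cast h2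
    exact_mod_cast (by omega : Q.natDegree < ℓ)
  rw [← h1]
  congr 1
  have hE : X * toPoly (eulerField a) = Λ - C (ℓ + 1 : ℂ)⁻¹ * (X * D) := by
    rw [← dLam_eq, dLam_euler]
  rw [(lgMul_eq_of_eq a (Z := ofPoly ℓ Q)
    (K := C s * W - C (s * (D.eval s / (ℓ + 1))) - C (ℓ + 1 : ℂ)⁻¹ * X * B) _).1,
    toPoly_ofPoly hdeg]
  rw [toPoly_ofPoly hdeg, hE, hQ]
  ring

theorem lgData_sharp (a w : Vec ℓ) : (lgData ℓ).sharp a w = (hankel a).mulVec w := by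
  rw [← lgGram_inv]
  rfl

theorem intersectionForm_apply (a : Vec ℓ) (i j : Fin ℓ) :
    (lgData ℓ).intersectionForm a i j
      = lgMul a (eulerField a) ((hankel a).mulVec (Pi.single i 1)) j := by
  have h : (lgData ℓ).intersectionForm a i j = lgMetric a (eulerField a)
      (lgMul a ((lgData ℓ).sharp a (Pi.single i 1)) ((lgData ℓ).sharp a (Pi.single j 1))) := rfl
  rw [h, lgData_sharp, lgData_sharp, ← lgMetric_lgMul_assoc, lgMetric_hankel]
  simp

theorem intersectionForm_dotProduct (a w w' : Vec ℓ) :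
    w ⬝ᵥ ((lgData ℓ).intersectionForm a).mulVec w'
      = lgMul a (eulerField a) ((hankel a).mulVec w) ⬝ᵥ w' := by
  have h : lgMul a (eulerField a) ((hankel a).mulVec w)
      = ∑ i, w i • lgMul a (eulerField a) ((hankel a).mulVec (Pi.single i 1)) := by
    rw [mulVec_eq_sum_single]
    simp only [← lgMulBilin_apply, map_sum, map_smul]
  rw [h, Matrix.dotProduct_mulVec]
  congr 1
  ext j
  simp [Matrix.vecMul, dotProduct, intersectionForm_apply]

theorem intersectionForm_symm (a : Vec ℓ) :
    ((lgData ℓ).intersectionForm a).transpose = (lgData ℓ).intersectionForm a := by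
  ext i j
  have h : ∀ i j, (lgData ℓ).intersectionForm a i j = lgMetric a (eulerField a)
      (lgMul a ((lgData ℓ).sharp a (Pi.single i 1)) ((lgData ℓ).sharp a (Pi.single j 1))) :=
    fun _ _ => rfl
  rw [Matrix.transpose_apply, h, h, lgMul_comm]

theorem sub_mul_intersectionForm (a : Vec ℓ) (p s : ℂ) :
    (p - s) * (evalCovector s ⬝ᵥ ((lgData ℓ).intersectionForm a).mulVec (evalCovector p))
      = p * s * ((dpLam a).eval p * (superpotential a).eval s
        - (superpotential a).eval p * (dpLam a).eval s
        + (p - s) * ((dpLam a).eval p * (dpLam a).eval s / (ℓ + 1))) := by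
  rw [intersectionForm_dotProduct, dotProduct_evalCovector, dLam_eq, eval_mul, eval_X]
  have h := congrArg (eval p) (sub_mul_toPoly_euler_mul a s)
  simp only [eval_mul, eval_sub, eval_X, eval_C, eval_add] at h
  linear_combination p * h

/-- The Bézout coefficient `u` replaces `1/Λ`: the term with `v` cancels `Λ'` from the denominator
and leaves only `Λ`, which does not vanish at critical points. -/
theorem lgIntersectionGram_apply (a : Vec ℓ) {u v : ℂ[X]}
    (h : u * superpotential a + v * dpLam a = 1) (i j : Fin ℓ) :
    lgIntersectionGram a i j
      = resFun a (toPoly (Pi.single i 1) * u * toPoly (Pi.single j 1)) := by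
  have hΛ : superpotential a ≠ 0 := by
    intro h0
    apply dpLam_ne_zero a
    rw [dpLam, h0, derivative_zero]
  change ∑ q ∈ _, residue _ _ q = ∑ q ∈ _, residue _ _ q
  refine Finset.sum_congr rfl fun q hq => ?_
  have hroot : (dpLam a).eval q = 0 := by
    have := (mem_roots'.1 (Multiset.mem_toFinset.1 hq)).2
    exact this
  have hev : (superpotential a).eval q ≠ 0 := by
    intro h0
    have := congrArg (eval q) h
    simp [h0, hroot] at this
  set x := toPoly (Pi.single i 1 : Vec ℓ)
  set y := toPoly (Pi.single j 1 : Vec ℓ)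
  have e1 : dLam (Pi.single i 1 : Vec ℓ) * dLam (Pi.single j 1 : Vec ℓ)
      = X ^ 2 * (superpotential a * (x * u * y) + dpLam a * (x * v * y)) := by
    rw [dLam_eq, dLam_eq]
    linear_combination -(X ^ 2 * x * y) * h
  rw [e1, mul_assoc (X ^ 2), residue_mul_cancel _ _ (pow_ne_zero 2 X_ne_zero), residue_add,
    residue_mul_cancel _ _ hΛ, mul_comm (superpotential a) (dpLam a),
    residue_mul_cancel _ _ (dpLam_ne_zero a), residue_eq_zero _ hev, add_zero]

theorem dvd_toPoly_euler_mul (a Y : Vec ℓ) :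
    dpLam a ∣ toPoly (lgMul a (eulerField a) Y) - superpotential a * toPoly Y := by
  have h1 := dvd_lgMul a (eulerField a) Y
  rw [← dLam_eq, dLam_euler] at h1
  obtain ⟨k, hk⟩ := h1
  exact ⟨k - C (ℓ + 1 : ℂ)⁻¹ * X * toPoly Y, by linear_combination hk⟩

/-- The intersection form is the inverse metric composed with multiplication by `Λ`, and the residue
formula is the metric twisted by its inverse `u` modulo `Λ'`. -/
theorem lgIntersectionGram_mul (a : Vec ℓ) (h : IsCoprime (superpotential a) (dpLam a)) :
    lgIntersectionGram a * (lgData ℓ).intersectionForm a = 1 := by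
  obtain ⟨u, v, huv⟩ := h
  ext i k
  rw [Matrix.mul_apply]
  set m := lgMul a (eulerField a) ((hankel a).mulVec (Pi.single k 1)) with hm
  have h1 : ∀ j, (lgData ℓ).intersectionForm a j k = m j := by
    intro j
    rw [hm, ← intersectionForm_apply, ← Matrix.transpose_apply ((lgData ℓ).intersectionForm a),
      intersectionForm_symm]
  have h2 : toPoly m = ∑ j, m j • toPoly (Pi.single j 1 : Vec ℓ) := by
    conv_lhs => rw [pi_eq_sum_univ' m]
    simp only [map_sum, map_smul]
  have h3 : ∑ j, lgIntersectionGram a i j * (lgData ℓ).intersectionForm a j k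
      = resFun a (toPoly (Pi.single i 1) * u * toPoly m) := by
    rw [h2, Finset.mul_sum, map_sum]
    refine Finset.sum_congr rfl fun j _ => ?_
    rw [mul_smul_comm, map_smul, lgIntersectionGram_apply a huv, h1, smul_eq_mul, mul_comm]
  rw [h3, Matrix.one_apply, ← resFun_shift a i k, ← toPoly_single, ← toPoly_hankel_col]
  apply resFun_congr
  obtain ⟨w, hw⟩ := dvd_toPoly_euler_mul a ((hankel a).mulVec (Pi.single k 1))
  rw [← hm] at hw
  set x := toPoly (Pi.single i 1 : Vec ℓ)
  set y := toPoly ((hankel a).mulVec (Pi.single k 1))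
  exact ⟨x * u * w - x * v * y, by linear_combination x * u * hw + x * y * huv⟩

/-! ### The generators on the orbit space -/

theorem superpotential_injective : Function.Injective (superpotential : Vec ℓ → ℂ[X]) := by
  intro a b h
  have h1 : dLam a = dLam b := add_left_cancel h
  rw [dLam_eq, dLam_eq] at h1
  exact toPoly_injective (mul_left_cancel₀ X_ne_zero h1)

theorem prod_X_add_C_eq (u : Fin (ℓ + 1) → ℂ) :
    ∏ k, (X + C (u k)) = superpotential
      (fun j : Fin ℓ => Multiset.esymm (Finset.univ.val.map u) ((j : ℕ) + 1)) + C (∏ k, u k) := by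
  have h := Multiset.prod_X_add_C_eq_sum_esymm (Finset.univ.val.map u)
  have hcard : (Finset.univ.val.map u).card = ℓ + 1 := by simp
  rw [hcard, Multiset.map_map] at h
  have h1 : (Multiset.map ((fun r => X + C r) ∘ u) Finset.univ.val).prod
      = ∏ k, (X + C (u k)) := rfl
  rw [← h1, h, Finset.sum_range_succ, Finset.sum_range_succ']
  have h2 : (Finset.univ.val.map u).esymm (ℓ + 1) = ∏ k, u k := by
    rw [Finset.esymm_map_val]
    have : Finset.powersetCard (ℓ + 1) (Finset.univ : Finset (Fin (ℓ + 1))) = {Finset.univ} := by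
      have h := Finset.powersetCard_self (Finset.univ : Finset (Fin (ℓ + 1)))
      rwa [Finset.card_univ, Fintype.card_fin] at h
    rw [this, Finset.sum_singleton]
  have h3 : (Finset.univ.val.map u).esymm 0 = 1 := by
    rw [Finset.esymm_map_val]; simp
  rw [h2, h3, superpotential, dLam, Nat.sub_self, pow_zero, mul_one, C_1, one_mul, Nat.sub_zero,
    Fin.sum_univ_eq_sum_range (fun j => C ((Finset.univ.val.map u).esymm (j + 1)) * X ^ (ℓ - j)) ℓ,
    add_comm (X ^ (ℓ + 1))]
  congr 2
  refine Finset.sum_congr rfl fun j _ => ?_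
  rw [Nat.add_sub_add_right]

theorem sum_simpleRoot (r : Fin ℓ) : ∑ k, simpleRoot r k = 0 := by
  simp [simpleRoot]

theorem prod_orbitU (lam : ℂ) (x : Vec ℓ) : ∏ k, orbitU lam x k = lam := by
  simp only [orbitU, Finset.prod_mul_distrib, ← Complex.exp_sum, ← Finset.mul_sum]
  have : ∑ k, (∑ r : Fin ℓ, x r • simpleRoot r) k = 0 := by
    simp only [Finset.sum_apply, Pi.smul_apply]
    rw [Finset.sum_comm]
    simp [← Finset.mul_sum, sum_simpleRoot]
  rw [this]
  simp

/-- The bridge between the two sides: in terms of `y`, changing `λ` only shifts the superpotential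
by a constant and leaves `Λ'` alone. -/
theorem prod_X_add_C_orbitU (lam : ℂ) (x : Vec ℓ) :
    ∏ k, (X + C (orbitU lam x k)) = superpotential (generators lam x) + C lam := by
  rw [prod_X_add_C_eq, prod_orbitU]
  rfl

theorem superpotential_hMap_generators (ε : ℂ) (x : Vec ℓ) :
    superpotential (hMap ε (generators 0 x)) =
      X * ∏ k : Fin ℓ, (X + C (ε * orbitU 0 x k.castSucc)) := by
  have h := prod_X_add_C_eq (fun k => ε * orbitU 0 x k)
  have h0 : orbitU 0 x (Fin.last ℓ) = 0 := by simp [orbitU]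
  have h1 : ∏ k, (ε * orbitU 0 x k) = 0 :=
    Finset.prod_eq_zero (Finset.mem_univ (Fin.last ℓ)) (by rw [h0, mul_zero])
  rw [Fin.prod_univ_castSucc, h1, h0, mul_zero, C_0, add_zero, add_zero] at h
  rw [mul_comm, h]
  congr 1
  ext j
  rw [hMap, generators, Finset.esymm_map_val, Finset.esymm_map_val, Finset.mul_sum]
  refine Finset.sum_congr rfl fun t ht => ?_
  rw [Finset.prod_mul_distrib, Finset.prod_const, (Finset.mem_powersetCard.1 ht).2]

/-! ### Weyl orbit sums as elementary symmetric functions -/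

theorem sum_perm_map {α : Type*} [Fintype α] [DecidableEq α] (T : Finset α)
    (F : Finset α → ℂ) :
    ∑ w : Equiv.Perm α, F (T.map w.toEmbedding)
      = (Nat.card {w : Equiv.Perm α // T.map w.toEmbedding = T} : ℂ) *
        ∑ S ∈ Finset.powersetCard T.card Finset.univ, F S := by
  rw [← Finset.sum_fiberwise_of_maps_to (s := Finset.univ)
    (t := Finset.powersetCard T.card Finset.univ) (g := fun w : Equiv.Perm α => T.map w.toEmbedding)
    (fun w _ => by simp [Finset.mem_powersetCard]), Finset.mul_sum]
  refine Finset.sum_congr rfl fun S hS => ?_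
  have hcard : S.card = T.card := (Finset.mem_powersetCard.1 hS).2
  rw [Finset.sum_congr rfl (g := fun _ => F S) (fun w hw => by rw [(Finset.mem_filter.1 hw).2]),
    Finset.sum_const, nsmul_eq_mul]
  congr 2
  rw [Nat.card_eq_fintype_card, Fintype.card_subtype]
  -- The permutations sending `T` to `S` form a coset of the stabilizer of `T`; `σ` is a
  -- representative.
  let e : {x // x ∈ T} ≃ {x // x ∈ S} := Finset.equivOfCardEq hcard.symm
  let σ : Equiv.Perm α := e.extendSubtype
  have hσ : T.map σ.toEmbedding = S := by
    apply Finset.eq_of_subset_of_card_le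
    · intro y hy
      obtain ⟨x, hx, rfl⟩ := Finset.mem_map.1 hy
      exact e.extendSubtype_mem x hx
    · rw [Finset.card_map, hcard]
  symm
  refine Finset.card_bij (fun w _ => σ * w) ?_ ?_ ?_
  · intro w hw
    have h2 := (Finset.mem_filter.1 hw).2
    refine Finset.mem_filter.2 ⟨Finset.mem_univ _, ?_⟩
    rw [← hσ]
    conv_rhs => rw [← h2]
    rw [Finset.map_map]
    rfl
  · intro w _ w' _ h
    exact mul_left_cancel h
  · intro w hw
    have h2 := (Finset.mem_filter.1 hw).2
    refine ⟨σ⁻¹ * w, Finset.mem_filter.2 ⟨Finset.mem_univ _, ?_⟩, by simp⟩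
    apply Finset.map_injective σ.toEmbedding
    rw [hσ, Finset.map_map]
    rw [← h2]
    congr 1
    ext x
    simp

theorem sum_fundWeight_dotProduct (j : ℕ) (z : Fin (ℓ + 1) → ℂ) (hz : ∑ k, z k = 0) :
    fundWeight ℓ j ⬝ᵥ z = ∑ k ∈ Finset.univ.filter (fun k : Fin (ℓ + 1) => (k : ℕ) < j), z k := by
  simp only [dotProduct, fundWeight, sub_mul, Finset.sum_sub_distrib, ← Finset.mul_sum, hz,
    mul_zero, sub_zero, ite_mul, one_mul, zero_mul, Finset.sum_filter]

theorem card_filter_lt (j : ℕ) (hj : j ≤ ℓ + 1) :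
    (Finset.univ.filter (fun k : Fin (ℓ + 1) => (k : ℕ) < j)).card = j := by
  rw [Fin.card_filter_val_lt]
  omega

theorem sum_fundWeight_last : ∑ k, fundWeight ℓ ℓ k = 0 := by
  simp only [fundWeight, Finset.sum_sub_distrib, Finset.sum_boole]
  rw [card_filter_lt ℓ (by omega)]
  have := succ_ne_zero_complex ℓ
  simp
  field_simp
  ring

theorem fundWeight_comp_eq_iff (j : ℕ) (w : Equiv.Perm (Fin (ℓ + 1))) :
    fundWeight ℓ j ∘ w = fundWeight ℓ j ↔
      (Finset.univ.filter (fun k : Fin (ℓ + 1) => (k : ℕ) < j)).map w.toEmbedding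
        = Finset.univ.filter (fun k : Fin (ℓ + 1) => (k : ℕ) < j) := by
  constructor
  · intro h
    apply Finset.eq_of_subset_of_card_le
    · intro y hy
      obtain ⟨x, hx, rfl⟩ := Finset.mem_map.1 hy
      have hx' := (Finset.mem_filter.1 hx).2
      have := congrFun h x
      simp only [Function.comp, fundWeight, hx', if_true] at this
      refine Finset.mem_filter.2 ⟨Finset.mem_univ _, ?_⟩
      by_contra hc
      change ¬ ((w x : Fin (ℓ + 1)) : ℕ) < j at hc
      rw [if_neg hc] at this
      have h01 := sub_left_injective this
      simp at h01
    · rw [Finset.card_map]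
  · intro h
    ext k
    have h1 : ((w k : Fin (ℓ + 1)) : ℕ) < j ↔ (k : ℕ) < j := by
      have : w k ∈ (Finset.univ.filter (fun k : Fin (ℓ + 1) => (k : ℕ) < j)).map w.toEmbedding ↔
        (k : ℕ) < j := by simp
      rw [h] at this
      simpa using this
    simp [fundWeight, h1]

theorem generators_eq_weylGenerator (c : ℂ) (x : Vec ℓ) (j : Fin ℓ) :
    generators (Complex.exp (-(2 * Real.pi * Complex.I * c))) x j = weylGenerator c x j := by
  set lam := Complex.exp (-(2 * Real.pi * Complex.I * c)) with hlam
  set T := Finset.univ.filter (fun k : Fin (ℓ + 1) => (k : ℕ) < (j : ℕ) + 1) with hT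
  have hcardT : T.card = (j : ℕ) + 1 := card_filter_lt _ (by omega)
  set z : Fin (ℓ + 1) → ℂ := c • fundWeight ℓ ℓ + ∑ r : Fin ℓ, x r • simpleRoot r with hz
  have hsum : ∑ k, z k = 0 := by
    simp only [hz, Pi.add_apply, Pi.smul_apply, Finset.sum_add_distrib, smul_eq_mul,
      ← Finset.mul_sum, sum_fundWeight_last, Finset.sum_apply]
    rw [Finset.sum_comm]
    simp [← Finset.mul_sum, sum_simpleRoot]
  have hN := succ_ne_zero_complex ℓ
  -- The first `ℓ` coordinates of `c ω_ℓ` are `c/(ℓ+1)` and the last is `c/(ℓ+1) - c`. Thus all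
  -- exponentials share the factor `ζ`, and the extra `-c` is the `λ` in `u_{ℓ+1}`.
  set ζ := Complex.exp (2 * Real.pi * Complex.I * (c / (ℓ + 1))) with hζ
  have hu : ∀ k, Complex.exp (2 * Real.pi * Complex.I * z k) = ζ * orbitU lam x k := by
    intro k
    rw [orbitU, hζ, hlam]
    by_cases hk : k = Fin.last ℓ
    · subst hk
      rw [if_pos rfl, ← Complex.exp_add, ← Complex.exp_add, hz]
      congr 1
      simp only [Pi.add_apply, Pi.smul_apply, fundWeight, Fin.val_last, lt_irrefl, if_false,
        smul_eq_mul]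
      field_simp
      ring
    · have hk' : (k : ℕ) < ℓ := by
        have := k.2
        have : (k : ℕ) ≠ ℓ := fun h => hk (Fin.ext h)
        omega
      rw [if_neg hk, one_mul, ← Complex.exp_add, hz]
      congr 1
      simp only [Pi.add_apply, Pi.smul_apply, fundWeight, hk', if_true, smul_eq_mul]
      field_simp
      ring
  have hw : ∀ w : Equiv.Perm (Fin (ℓ + 1)), Complex.exp (2 * Real.pi * Complex.I *
      (fundWeight ℓ (j + 1) ⬝ᵥ (z ∘ w)))
        = ζ ^ ((j : ℕ) + 1) * ∏ k ∈ T.map w.toEmbedding, orbitU lam x k := by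
    intro w
    rw [sum_fundWeight_dotProduct _ _ (by rw [← hsum]; exact Equiv.sum_comp w z), Finset.mul_sum,
      Complex.exp_sum, Finset.prod_map, ← hT, ← hcardT, ← Finset.prod_const,
      ← Finset.prod_mul_distrib]
    exact Finset.prod_congr rfl fun k _ => hu (w k)
  have hθ : fundWeight ℓ (j + 1) ⬝ᵥ fundWeight ℓ ℓ = ((j : ℕ) + 1 : ℂ) / (ℓ + 1) := by
    rw [sum_fundWeight_dotProduct _ _ sum_fundWeight_last, ← hT,
      Finset.sum_congr rfl (g := fun _ => (1 : ℂ) / (ℓ + 1)), Finset.sum_const, hcardT]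
    · simp
      ring
    · intro k hk
      have hk' := (Finset.mem_filter.1 hk).2
      have hj := j.2
      rw [fundWeight, if_pos (by omega)]
      field_simp
      ring
  -- The normalizing exponential in `y^{j+1}` removes the `j + 1` factors `ζ`.
  have hpre : Complex.exp (-(2 * Real.pi * Complex.I *
      (fundWeight ℓ (j + 1) ⬝ᵥ fundWeight ℓ ℓ) * c)) * ζ ^ ((j : ℕ) + 1) = 1 := by
    rw [hθ, hζ, ← Complex.exp_nat_mul, ← Complex.exp_add, Complex.exp_eq_one_iff]
    refine ⟨0, ?_⟩
    push_cast
    field_simp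
    ring
  rw [weylGenerator, generators, Finset.esymm_map_val]
  simp only [← hz, hw, ← Finset.mul_sum]
  rw [sum_perm_map T (fun S => ∏ k ∈ S, orbitU lam x k), hcardT]
  have hcards : Nat.card {w : Equiv.Perm (Fin (ℓ + 1)) //
      fundWeight ℓ (j + 1) ∘ w = fundWeight ℓ (j + 1)}
      = Nat.card {w : Equiv.Perm (Fin (ℓ + 1)) // T.map w.toEmbedding = T} :=
    Nat.card_congr (Equiv.subtypeEquivRight fun w => fundWeight_comp_eq_iff _ w)
  rw [hcards]
  have hne : (Nat.card {w : Equiv.Perm (Fin (ℓ + 1)) // T.map w.toEmbedding = T} : ℂ) ≠ 0 := by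
    rw [Nat.cast_ne_zero]
    have : Nonempty {w : Equiv.Perm (Fin (ℓ + 1)) // T.map w.toEmbedding = T} :=
      ⟨⟨1, Finset.map_refl⟩⟩
    exact Nat.card_pos.ne'
  set n := (Nat.card {w : Equiv.Perm (Fin (ℓ + 1)) // T.map w.toEmbedding = T} : ℂ)
  set S := ∑ S ∈ Finset.powersetCard ((j : ℕ) + 1) Finset.univ, ∏ k ∈ S, orbitU lam x k
  calc S = (n⁻¹ * n) * 1 * S := by rw [inv_mul_cancel₀ hne]; ring
    _ = _ := by rw [← hpre]; ring

/-! ### Orthogonal projection onto the span of the roots -/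

/-- The matrix whose rows are the simple roots. -/
noncomputable def rootMatrix (ℓ : ℕ) : Matrix (Fin ℓ) (Fin (ℓ + 1)) ℂ := Matrix.of simpleRoot

theorem corootGram_eq : corootGram ℓ = rootMatrix ℓ * (rootMatrix ℓ).transpose := rfl

theorem rootMatrix_mulVec (v : Fin (ℓ + 1) → ℂ) (r : Fin ℓ) :
    (rootMatrix ℓ).mulVec v r = v r.castSucc - v r.succ := by
  change simpleRoot r ⬝ᵥ v = _
  rw [simpleRoot, sub_dotProduct, single_one_dotProduct, single_one_dotProduct]

theorem eq_zero_of_rootMatrix_mulVec {v : Fin (ℓ + 1) → ℂ} (h : (rootMatrix ℓ).mulVec v = 0)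
    (hs : ∑ k, v k = 0) : v = 0 := by
  have h1 : ∀ k, v k = v 0 := by
    intro k
    induction k using Fin.induction with
    | zero => rfl
    | succ i ih =>
      have := congrFun h i
      rw [rootMatrix_mulVec, Pi.zero_apply, sub_eq_zero] at this
      rw [← this, ih]
  have h2 : (ℓ + 1 : ℂ) * v 0 = 0 := by
    rw [← hs, Finset.sum_congr rfl fun k _ => h1 k]
    simp
  ext k
  rw [h1 k, (mul_eq_zero.1 h2).resolve_left (succ_ne_zero_complex ℓ)]
  rfl

theorem sum_transpose_rootMatrix_mulVec (w : Vec ℓ) :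
    ∑ k, (rootMatrix ℓ).transpose.mulVec w k = 0 := by
  simp only [Matrix.mulVec, dotProduct, Matrix.transpose_apply, rootMatrix, Matrix.of_apply]
  rw [Finset.sum_comm]
  simp [← Finset.sum_mul, sum_simpleRoot]

theorem transpose_rootMatrix_injective {w : Vec ℓ}
    (h : (rootMatrix ℓ).transpose.mulVec w = 0) : w = 0 := by
  ext r
  -- A fundamental weight up to a multiple of the all-ones vector, hence dual to the simple roots.
  let f : Fin (ℓ + 1) → ℂ := fun k => if (k : ℕ) ≤ r then 1 else 0
  have h1 : (rootMatrix ℓ).mulVec f = Pi.single r 1 := by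
    ext i
    rw [rootMatrix_mulVec]
    simp only [f, Fin.val_castSucc, Fin.val_succ]
    by_cases hi : i = r
    · subst hi; simp
    · have : (i : ℕ) ≠ r := fun h => hi (Fin.ext h)
      rw [Pi.single_eq_of_ne hi]
      split_ifs <;> first | omega | simp
  have h2 : w ⬝ᵥ (rootMatrix ℓ).mulVec f = 0 := by
    rw [Matrix.dotProduct_mulVec, ← Matrix.mulVec_transpose, h, zero_dotProduct]
  rw [h1] at h2
  simpa using h2

theorem isUnit_det_corootGram : IsUnit (corootGram ℓ).det := by
  rw [isUnit_iff_ne_zero]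
  intro h
  obtain ⟨w, hw, hw'⟩ := Matrix.exists_mulVec_eq_zero_iff.2 h
  rw [corootGram_eq, ← Matrix.mulVec_mulVec] at hw'
  exact hw (transpose_rootMatrix_injective
    (eq_zero_of_rootMatrix_mulVec hw' (sum_transpose_rootMatrix_mulVec w)))

/-- `Rᵀ (R Rᵀ)⁻¹ R` is the projection onto the hyperplane of coordinate sum zero. This makes the
inverse Cartan matrix explicit. -/
theorem rootMatrix_projection (v : Fin (ℓ + 1) → ℂ) :
    (rootMatrix ℓ).transpose.mulVec ((corootGram ℓ)⁻¹.mulVec ((rootMatrix ℓ).mulVec v))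
      = fun k => v k - (∑ l, v l) / (ℓ + 1) := by
  rw [← sub_eq_zero]
  apply eq_zero_of_rootMatrix_mulVec
  · rw [Matrix.mulVec_sub, Matrix.mulVec_mulVec, ← corootGram_eq, Matrix.mulVec_mulVec,
      Matrix.mul_nonsing_inv _ isUnit_det_corootGram, Matrix.one_mulVec, sub_eq_zero]
    ext r
    rw [rootMatrix_mulVec, rootMatrix_mulVec]
    ring
  · have := succ_ne_zero_complex ℓ
    simp only [Pi.sub_apply, Finset.sum_sub_distrib, sum_transpose_rootMatrix_mulVec]
    simp
    field_simp
    ring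

/-! ### The pencil of metrics -/

theorem hasFDerivAt_orbitU (lam : ℂ) (x : Vec ℓ) (k : Fin (ℓ + 1)) :
    HasFDerivAt (fun v => orbitU lam v k)
      ((2 * Real.pi * Complex.I * orbitU lam x k) •
        ∑ r : Fin ℓ, simpleRoot r k • (ContinuousLinearMap.proj r : Vec ℓ →L[ℂ] ℂ)) x := by
  have h1 : HasFDerivAt (fun v : Vec ℓ => ∑ r : Fin ℓ, v r * simpleRoot r k)
      (∑ r : Fin ℓ, simpleRoot r k • (ContinuousLinearMap.proj r : Vec ℓ →L[ℂ] ℂ)) x := by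
    apply HasFDerivAt.fun_sum
    intro r _
    exact (hasFDerivAt_apply r x).mul_const (simpleRoot r k)
  have h2 := ((h1.const_mul (2 * Real.pi * Complex.I)).cexp).const_mul
    (if k = Fin.last ℓ then lam else 1)
  have e : (fun v => orbitU lam v k) = fun v : Vec ℓ => (if k = Fin.last ℓ then lam else 1) *
      Complex.exp (2 * Real.pi * Complex.I * ∑ r : Fin ℓ, v r * simpleRoot r k) := by
    ext v
    simp [orbitU, Finset.sum_apply]
  rw [e]
  refine h2.congr_fderiv ?_
  rw [smul_smul, smul_smul]
  congr 1
  have := congrFun e x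
  rw [this]
  ring

theorem differentiable_generators (lam : ℂ) (i : Fin ℓ) :
    Differentiable ℂ fun v : Vec ℓ => generators lam v i := by
  have e : (fun v : Vec ℓ => generators lam v i) = fun v =>
      ∑ t ∈ Finset.powersetCard ((i : ℕ) + 1) Finset.univ, ∏ k ∈ t, orbitU lam v k := by
    ext v
    rw [generators, Finset.esymm_map_val]
  rw [e]
  apply Differentiable.fun_sum
  intro t _
  exact fun x => (HasFDerivAt.finsetProd fun k _ => hasFDerivAt_orbitU lam x k).differentiableAt

theorem eval_dLam_generators (lam : ℂ) (v : Vec ℓ) (p : ℂ) :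
    ∑ i : Fin ℓ, generators lam v i * p ^ (ℓ - (i : ℕ))
      = ∏ k, (p + orbitU lam v k) - (p ^ (ℓ + 1) + lam) := by
  have h := congrArg (eval p) (prod_X_add_C_orbitU lam v)
  rw [eval_prod] at h
  simp only [eval_add, eval_X, eval_C, superpotential, eval_pow] at h
  have h2 := dotProduct_evalCovector (generators lam v) p
  rw [h]
  simp only [dotProduct, evalCovector] at h2
  rw [h2]
  ring

/-- The logarithmic derivative `u_k ∂_{u_k} ∏ (p + u_l)`. -/
noncomputable def logPartial (u : Fin (ℓ + 1) → ℂ) (p : ℂ) (k : Fin (ℓ + 1)) : ℂ :=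
  u k * ∏ l ∈ Finset.univ.erase k, (p + u l)

theorem sum_pd_generators (lam : ℂ) (x : Vec ℓ) (p : ℂ) (r : Fin ℓ) :
    ∑ i : Fin ℓ, pd (fun v => generators lam v i) x r * p ^ (ℓ - (i : ℕ))
      = 2 * Real.pi * Complex.I * (rootMatrix ℓ).mulVec (logPartial (orbitU lam x) p) r := by
  have h1 : HasFDerivAt (fun v : Vec ℓ => ∑ i : Fin ℓ, generators lam v i * p ^ (ℓ - (i : ℕ)))
      (∑ i : Fin ℓ, p ^ (ℓ - (i : ℕ)) • fderiv ℂ (fun v => generators lam v i) x) x := by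
    apply HasFDerivAt.fun_sum
    intro i _
    exact ((differentiable_generators lam i) x).hasFDerivAt.mul_const _
  have h2 : HasFDerivAt (fun v : Vec ℓ => ∏ k, (p + orbitU lam v k) - (p ^ (ℓ + 1) + lam))
      (∑ k, (∏ l ∈ Finset.univ.erase k, (p + orbitU lam x l)) •
        ((2 * Real.pi * Complex.I * orbitU lam x k) •
        ∑ r : Fin ℓ, simpleRoot r k • (ContinuousLinearMap.proj r : Vec ℓ →L[ℂ] ℂ))) x := by
    apply HasFDerivAt.sub_const
    exact HasFDerivAt.finsetProd fun k _ => (hasFDerivAt_orbitU lam x k).const_add p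
  simp only [eval_dLam_generators] at h1
  have h3 := congrArg (fun L : Vec ℓ →L[ℂ] ℂ => L (Pi.single r 1)) (h1.unique h2)
  simp only [FunLike.coe_sum, Finset.sum_apply, smul_apply,
    ContinuousLinearMap.proj_apply, smul_eq_mul] at h3
  have h4 : ∀ k, ∑ i : Fin ℓ, simpleRoot i k * (Pi.single r 1 : Vec ℓ) i = simpleRoot r k := by
    intro k
    rw [Finset.sum_eq_single r]
    · simp
    · intro b _ hb; simp [Pi.single_eq_of_ne hb]
    · simp
  simp only [h4] at h3
  simp only [pd, mul_comm _ (p ^ _)]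
  rw [h3]
  simp only [Matrix.mulVec, dotProduct, Finset.mul_sum, logPartial, rootMatrix, Matrix.of_apply]
  refine Finset.sum_congr rfl fun k _ => ?_
  ring

/-- The factors `2πi` from the two derivatives against `1/4π²` leave the sign, and the projection
formula replaces `a^{rs}` by the standard form minus its trace part. -/
theorem gLambda_dotProduct (lam : ℂ) (x : Vec ℓ) (p s : ℂ) :
    evalCovector s ⬝ᵥ (Matrix.of (gLambda lam x)).mulVec (evalCovector p)
      = -(∑ k, logPartial (orbitU lam x) s k * logPartial (orbitU lam x) p k
        - (∑ k, logPartial (orbitU lam x) s k) * (∑ k, logPartial (orbitU lam x) p k) / (ℓ + 1)) := by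
  set u := orbitU lam x
  have h1 : evalCovector s ⬝ᵥ (Matrix.of (gLambda lam x)).mulVec (evalCovector p)
      = 1 / (4 * Real.pi ^ 2) * ∑ r : Fin ℓ, ∑ q : Fin ℓ,
        (∑ i : Fin ℓ, pd (fun v => generators lam v i) x r * s ^ (ℓ - (i : ℕ))) *
          (corootGram ℓ)⁻¹ r q *
        (∑ j : Fin ℓ, pd (fun v => generators lam v j) x q * p ^ (ℓ - (j : ℕ))) := by
    simp only [dotProduct, Matrix.mulVec, Matrix.of_apply, gLambda, evalCovector, Finset.mul_sum,
      Finset.sum_mul]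
    rw [Finset.sum_congr rfl fun i _ => Finset.sum_comm]
    rw [Finset.sum_comm]
    refine Finset.sum_congr rfl fun r _ => ?_
    rw [Finset.sum_congr rfl fun i _ => Finset.sum_comm]
    rw [Finset.sum_comm]
    refine Finset.sum_congr rfl fun q _ => ?_
    rw [Finset.sum_comm]
    refine Finset.sum_congr rfl fun j _ => ?_
    refine Finset.sum_congr rfl fun i _ => ?_
    ring
  have h2 : ∑ k, logPartial u s k * logPartial u p k
        - (∑ k, logPartial u s k) * (∑ k, logPartial u p k) / (ℓ + 1)
      = (rootMatrix ℓ).mulVec (logPartial u s) ⬝ᵥ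
        (corootGram ℓ)⁻¹.mulVec ((rootMatrix ℓ).mulVec (logPartial u p)) := by
    have h3 := congrArg (fun w => logPartial u s ⬝ᵥ w) (rootMatrix_projection (logPartial u p))
    rw [Matrix.dotProduct_mulVec, ← Matrix.mulVec_transpose, Matrix.transpose_transpose] at h3
    rw [h3]
    simp only [dotProduct, mul_sub, Finset.sum_sub_distrib, ← Finset.sum_mul]
    ring
  have hpi : (Real.pi : ℂ) ≠ 0 := by exact_mod_cast Real.pi_ne_zero
  rw [h1, h2]
  have h4 : ∀ v w : Vec ℓ, v ⬝ᵥ (corootGram ℓ)⁻¹.mulVec w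
      = ∑ r, ∑ q, v r * ((corootGram ℓ)⁻¹ r q * w q) := by
    intro v w
    simp [dotProduct, Matrix.mulVec, Finset.mul_sum]
  rw [h4]
  simp only [sum_pd_generators, Finset.mul_sum]
  rw [← Finset.sum_neg_distrib]
  refine Finset.sum_congr rfl fun r _ => ?_
  rw [← Finset.sum_neg_distrib]
  refine Finset.sum_congr rfl fun q _ => ?_
  have hI : Complex.I ^ 2 = -1 := Complex.I_sq
  field_simp
  rw [hI]
  ring

/-- With `P = ∏ (z + u_k)` and `Q_k = P/(z + u_k)` one has `u_k ∂_{u_k} P = P - z Q_k`. The factor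
`p - s` decouples the products of `Q_k(p)` and `Q_k(s)`, so only `P` and `P' = ∑ Q_k` remain. -/
theorem logPartial_identity (u : Fin (ℓ + 1) → ℂ) (p s : ℂ) :
    (p - s) * -(∑ k, logPartial u s k * logPartial u p k
        - (∑ k, logPartial u s k) * (∑ k, logPartial u p k) / (ℓ + 1))
      = p * s * ((derivative (∏ k, (X + C (u k)))).eval p * (∏ k, (X + C (u k))).eval s
        - (∏ k, (X + C (u k))).eval p * (derivative (∏ k, (X + C (u k)))).eval s
        + (p - s) * ((derivative (∏ k, (X + C (u k)))).eval p *
          (derivative (∏ k, (X + C (u k)))).eval s / (ℓ + 1))) := by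
  have hd : ∀ z, (derivative (∏ k, (X + C (u k)))).eval z
      = ∑ k, ∏ l ∈ Finset.univ.erase k, (z + u l) := by
    intro z
    rw [derivative_prod_finset]
    simp [eval_finsetSum, eval_prod]
  have he : ∀ z, (∏ k, (X + C (u k))).eval z = ∏ k, (z + u k) := by
    intro z
    simp [eval_prod]
  simp only [hd, he]
  set P : ℂ → ℂ := fun z => ∏ k, (z + u k) with hP
  set Q : ℂ → Fin (ℓ + 1) → ℂ := fun z k => ∏ l ∈ Finset.univ.erase k, (z + u l) with hQ
  have hPQ : ∀ z k, P z = (z + u k) * Q z k := fun z k =>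
    (Finset.mul_prod_erase Finset.univ (fun k => z + u k) (Finset.mem_univ k)).symm
  have hlog : ∀ z k, logPartial u z k = P z - z * Q z k := by
    intro z k
    rw [hPQ z k, logPartial]
    ring
  have hS : ∀ z, ∑ k, logPartial u z k = (ℓ + 1) * P z - z * ∑ k, Q z k := by
    intro z
    simp [hlog, Finset.sum_sub_distrib, Finset.mul_sum]
  have hprod : (p - s) * ∑ k, logPartial u s k * logPartial u p k
      = (p - s) * ((ℓ + 1) * (P p * P s)) + s ^ 2 * P p * ∑ k, Q s k
        - p ^ 2 * P s * ∑ k, Q p k := by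
    have : ∀ k, (p - s) * (logPartial u s k * logPartial u p k)
        = (p - s) * (P p * P s) + s ^ 2 * P p * Q s k - p ^ 2 * P s * Q p k := by
      intro k
      rw [hPQ p k, hPQ s k, logPartial, logPartial]
      ring
    rw [Finset.mul_sum, Finset.sum_congr rfl fun k _ => this k]
    simp [Finset.sum_sub_distrib, Finset.sum_add_distrib, Finset.mul_sum]
    ring
  have hN := succ_ne_zero_complex ℓ
  rw [hS, hS]
  change _ = p * s * ((∑ k, Q p k) * P s - P p * (∑ k, Q s k)
    + (p - s) * ((∑ k, Q p k) * (∑ k, Q s k) / (ℓ + 1)))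
  rw [mul_neg, mul_sub, hprod]
  field_simp
  ring

/-- For `P = Λ + λ` the expression in `P, P'` is that of the intersection form plus `λ p s (Λ'(p) -
Λ'(s))`, and the latter is the generating function of the Hankel matrix. -/
theorem gLambda_eq (lam : ℂ) (x : Vec ℓ) :
    Matrix.of (gLambda lam x) = (lgData ℓ).intersectionForm (generators lam x)
      + lam • hankel (generators lam x) := by
  apply matrix_eq_of_evalCovector
  intro p s hs
  apply mul_left_cancel₀ (sub_ne_zero.2 hs.symm)
  rw [gLambda_dotProduct, logPartial_identity, prod_X_add_C_orbitU, Matrix.add_mulVec,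
    dotProduct_add, mul_add (p - s) (_ ⬝ᵥ _), sub_mul_intersectionForm, Matrix.smul_mulVec, dotProduct_smul,
    smul_eq_mul]
  have h1 := sub_mul_hankel (generators lam x) s p
  simp only [derivative_add, derivative_C, add_zero, eval_add, eval_C]
  change _ * (eval p (dpLam _) * _ - _ * eval s (dpLam _)
    + _ * (eval p (dpLam _) * eval s (dpLam _) / _)) = _
  linear_combination lam * h1

theorem isPencil_lg : IsPencil (ℓ := ℓ) (lgData ℓ).intersectionForm hankel := by
  intro lam x i j
  exact congrFun (congrFun (gLambda_eq lam x) i) j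

/-- The roots of `Λ_y + λ` multiply to `±λ`, so none vanishes and logarithms exist. Surjectivity is
what makes the pencil unique as functions on all of `ℂ^ℓ`. -/
theorem generators_surjective {lam : ℂ} (hlam : lam ≠ 0) (y : Vec ℓ) :
    ∃ x, generators lam x = y := by
  set P := superpotential y + C lam with hP
  have hdeg : P.natDegree = ℓ + 1 := by
    apply natDegree_eq_of_le_of_coeff_ne_zero
    · rw [natDegree_le_iff_coeff_eq_zero]
      intro m hm
      rw [hP, coeff_add, degree_superpotential_le y hm, coeff_C, if_neg (by omega), add_zero]
    · rw [hP, coeff_add, coeff_superpotential, if_pos rfl, coeff_C, if_neg (by omega),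
        coeff_eq_zero_of_degree_lt (lt_of_le_of_lt (degree_dLam_le y)
          (by exact_mod_cast Nat.lt_succ_self ℓ))]
      simp
  have hlead : P.leadingCoeff = 1 := by
    rw [leadingCoeff, hdeg, hP, coeff_add, coeff_superpotential, if_pos rfl, coeff_C,
      if_neg (by omega), coeff_eq_zero_of_degree_lt (lt_of_le_of_lt (degree_dLam_le y)
          (by exact_mod_cast Nat.lt_succ_self ℓ))]
    simp
  have hsplit := IsAlgClosed.splits P
  have hfac := Splits.eq_prod_roots hsplit
  have hcard : P.roots.card = ℓ + 1 := by
    rw [← hdeg]; exact (Splits.natDegree_eq_card_roots hsplit).symm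
  obtain ⟨u, hu⟩ : ∃ u : Fin (ℓ + 1) → ℂ, P = ∏ k, (X + C (u k)) := by
    have hlen : P.roots.toList.length = ℓ + 1 := by simp [hcard]
    refine ⟨fun k => -P.roots.toList.get (k.cast hlen.symm), ?_⟩
    rw [hlead, C_1, one_mul] at hfac
    conv_lhs => rw [hfac, ← Multiset.coe_toList P.roots]
    rw [Multiset.map_coe, Multiset.prod_coe, ← List.prod_ofFn]
    congr 1
    apply List.ext_get
    · simp [hcard]
    · intro n h1 h2
      rw [List.get_ofFn]
      simp [sub_eq_add_neg]
  have hprod : ∏ k, u k = lam := by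
    have h := congrArg (eval 0) hu
    rw [eval_prod, hP, eval_add, superpotential, dLam_eq] at h
    simpa using h.symm
  have hne : ∀ k, u k ≠ 0 := by
    intro k hk
    apply hlam
    rw [← hprod]
    exact Finset.prod_eq_zero (Finset.mem_univ k) hk
  have h2pi : (2 * Real.pi * Complex.I : ℂ) ≠ 0 := Complex.two_pi_I_ne_zero
  -- Only the first `ℓ` logarithms are prescribed; the last coordinate makes the sum zero, so that
  -- the vector lies in the span of the coroots. The last `u` then agrees because both products
  -- equal `λ`.
  set L : Fin ℓ → ℂ := fun k => Complex.log (u k.castSucc) / (2 * Real.pi * Complex.I) with hL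
  set c : Fin (ℓ + 1) → ℂ := Fin.snoc L (-∑ k, L k) with hc
  have hcs : ∑ k, c k = 0 := by
    rw [Fin.sum_univ_castSucc]
    simp [hc]
  set x : Vec ℓ := (corootGram ℓ)⁻¹.mulVec ((rootMatrix ℓ).mulVec c) with hx
  have hxc : ∀ k, (∑ r : Fin ℓ, x r • simpleRoot r) k = c k := by
    intro k
    have := congrFun (rootMatrix_projection c) k
    rw [hcs, zero_div, sub_zero, ← hx] at this
    rw [← this]
    simp [Matrix.mulVec, dotProduct, rootMatrix, Finset.sum_apply, mul_comm]
  refine ⟨x, ?_⟩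
  have hcast : ∀ k : Fin ℓ, orbitU lam x k.castSucc = u k.castSucc := by
    intro k
    rw [orbitU, hxc, if_neg (Fin.castSucc_lt_last k).ne, one_mul, hc, Fin.snoc_castSucc, hL,
      mul_div_cancel₀ _ h2pi, Complex.exp_log (hne _)]
  have horb : orbitU lam x = u := by
    ext k
    induction k using Fin.lastCases with
    | cast k => exact hcast k
    | last =>
      have h1 := (prod_orbitU lam x).trans hprod.symm
      rw [Fin.prod_univ_castSucc, Fin.prod_univ_castSucc,
        Finset.prod_congr rfl fun k _ => hcast k] at h1
      exact mul_left_cancel₀ (Finset.prod_ne_zero_iff.2 fun k _ => hne _) h1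
  apply superpotential_injective
  have h := prod_X_add_C_orbitU lam x
  rw [horb, ← hu, hP] at h
  exact (add_right_cancel h).symm

/-- At a fixed `y`, two nonzero values of `λ` already determine both coefficients of an affine
function. -/
theorem IsPencil.eq_lg {g η : Vec ℓ → Matrix (Fin ℓ) (Fin ℓ) ℂ} (h : IsPencil g η) :
    g = (lgData ℓ).intersectionForm ∧ η = hankel := by
  have key : ∀ y i j, g y i j = (lgData ℓ).intersectionForm y i j ∧ η y i j = hankel y i j := by
    intro y i j
    have h1 : ∀ lam : ℂ, lam ≠ 0 → g y i j + lam * η y i j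
        = (lgData ℓ).intersectionForm y i j + lam * hankel y i j := by
      intro lam hlam
      obtain ⟨x, rfl⟩ := generators_surjective hlam y
      rw [← h lam x i j, ← isPencil_lg lam x i j]
    have e1 := h1 1 one_ne_zero
    have e2 := h1 2 two_ne_zero
    constructor
    · linear_combination 2 * e1 - e2
    · linear_combination e2 - e1
  exact ⟨funext fun y => Matrix.ext fun i j => (key y i j).1,
    funext fun y => Matrix.ext fun i j => (key y i j).2⟩

theorem existsUnique_pencil :
    ∃! p : (Vec ℓ → Matrix (Fin ℓ) (Fin ℓ) ℂ) × (Vec ℓ → Matrix (Fin ℓ) (Fin ℓ) ℂ),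
      IsPencil p.1 p.2 :=
  ⟨((lgData ℓ).intersectionForm, hankel), isPencil_lg, fun _ h =>
    Prod.ext h.eq_lg.1 h.eq_lg.2⟩

end GenFrob

namespace GenFrob

/-! ### Entire maps of several variables -/

open MeasureTheory Topology

section Osgood

variable {E F : Type*} [NormedAddCommGroup E] [NormedSpace ℂ E] [NormedAddCommGroup F]
  [NormedSpace ℂ F]

theorem hasDerivAt_line {f : E → F} (hf : Differentiable ℂ f) (z v : E) (ζ : ℂ) :
    HasDerivAt (fun ζ : ℂ => f (z + ζ • v)) (fderiv ℂ f (z + ζ • v) v) ζ := by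
  have h1 : HasDerivAt (fun ζ : ℂ => z + ζ • v) v ζ := by
    simpa using ((hasDerivAt_id ζ).smul_const v).const_add z
  exact (hf (z + ζ • v)).hasFDerivAt.comp_hasDerivAt ζ h1

/-- Cauchy's estimate for maps of several variables. -/
theorem norm_fderiv_le_of_closedBall {f : E → F} (hf : Differentiable ℂ f) {z : E} {M : ℝ}
    (hM : ∀ w ∈ Metric.closedBall z 1, ‖f w‖ ≤ M) : ‖fderiv ℂ f z‖ ≤ M := by
  have hM0 : 0 ≤ M := (norm_nonneg _).trans (hM z (by simp))
  refine ContinuousLinearMap.opNorm_le_bound _ hM0 fun u => ?_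
  by_cases hu : u = 0
  · simp [hu]
  have hun : 0 < ‖u‖ := norm_pos_iff.2 hu
  have hd : Differentiable ℂ (fun ζ : ℂ => f (z + ζ • u)) := fun ζ =>
    (hasDerivAt_line hf z u ζ).differentiableAt
  -- This radius keeps `z + ζ u` on the unit sphere around `z`.
  have h := Complex.norm_deriv_le_of_forall_mem_sphere_norm_le (c := 0) (R := ‖u‖⁻¹) (C := M)
    (f := fun ζ : ℂ => f (z + ζ • u)) (inv_pos.2 hun) hd.diffContOnCl (fun ζ hζ => by
      apply hM
      have : ‖ζ‖ = ‖u‖⁻¹ := by simpa using hζ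
      rw [mem_closedBall_iff_norm, add_sub_cancel_left, norm_smul, this, inv_mul_cancel₀ hun.ne'])
  rw [(hasDerivAt_line hf z u 0).deriv, zero_smul, add_zero, div_inv_eq_mul] at h
  exact h

/-- Uniform continuity makes `f(· + h) - f` small on a unit ball, and Cauchy's estimate passes this
on to its derivative. -/
theorem continuous_fderiv_of_differentiable [ProperSpace E] {f : E → F}
    (hf : Differentiable ℂ f) : Continuous (fderiv ℂ f) := by
  rw [continuous_iff_continuousAt]
  intro z
  rw [Metric.continuousAt_iff]
  intro ε hε
  have huc := (isCompact_closedBall z 2).uniformContinuousOn_of_continuous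
    hf.continuous.continuousOn
  rw [Metric.uniformContinuousOn_iff] at huc
  obtain ⟨δ, hδ, h⟩ := huc (ε / 2) (half_pos hε)
  refine ⟨min δ 1, lt_min hδ one_pos, fun w hw => ?_⟩
  have hw1 : dist w z < δ := lt_of_lt_of_le hw (min_le_left _ _)
  have hw2 : dist w z < 1 := lt_of_lt_of_le hw (min_le_right _ _)
  set g : E → F := fun x => f (x + (w - z)) - f x with hg
  have hs : Differentiable ℂ fun x => f (x + (w - z)) :=
    hf.comp (differentiable_id.add_const _)
  have hgd : Differentiable ℂ g := hs.sub hf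
  have hfd : fderiv ℂ g z = fderiv ℂ f w - fderiv ℂ f z := by
    rw [hg, fderiv_fun_sub (hs z) (hf z), fderiv_comp_add_right, add_sub_cancel]
  rw [dist_eq_norm, ← hfd]
  refine lt_of_le_of_lt (norm_fderiv_le_of_closedBall hgd (M := ε / 2) fun x hx => ?_)
    (half_lt_self hε)
  rw [hg, ← dist_eq_norm]
  have hx' : dist x z ≤ 1 := hx
  refine (h _ ?_ _ ?_ ?_).le
  · rw [Metric.mem_closedBall]
    calc dist (x + (w - z)) z ≤ dist (x + (w - z)) x + dist x z := dist_triangle _ _ _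
      _ = dist w z + dist x z := by rw [dist_eq_norm, add_sub_cancel_left, ← dist_eq_norm]
      _ ≤ 2 := by linarith
  · rw [Metric.mem_closedBall]; linarith
  · rwa [dist_eq_norm, add_sub_cancel_left, ← dist_eq_norm]

/-- Cauchy's formula on the line through `z` writes `∂_v f` as an integral of values of `f`, which
is differentiated under the integral sign; continuity of the derivative on a compact ball gives the
bound. The resulting smoothness is needed because flat coordinates are only assumed holomorphic. -/
theorem differentiable_fderiv_apply [ProperSpace E] [CompleteSpace F] {f : E → F}
    (hf : Differentiable ℂ f) (v : E) : Differentiable ℂ fun z => fderiv ℂ f z v := by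
  have hcont := continuous_fderiv_of_differentiable hf
  have hrep : (fun z => fderiv ℂ f z v) = fun z => (2 * Real.pi * Complex.I : ℂ)⁻¹ •
      ∫ θ in (0 : ℝ)..2 * Real.pi, deriv (circleMap 0 1) θ •
        ((circleMap 0 1 θ - 0) ^ 2)⁻¹ • f (z + circleMap 0 1 θ • v) := by
    ext z
    have hd : Differentiable ℂ (fun ζ : ℂ => f (z + ζ • v)) := fun ζ =>
      (hasDerivAt_line hf z v ζ).differentiableAt
    have h := Complex.two_pi_I_inv_smul_circleIntegral_sub_sq_inv_smul_of_differentiable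
      isOpen_univ (c := 0) (w₀ := 0) (R := 1) (Set.subset_univ _) hd.differentiableOn (by simp)
    rw [(hasDerivAt_line hf z v 0).deriv, zero_smul, add_zero] at h
    exact h.symm
  rw [hrep]
  intro z₀
  apply DifferentiableAt.const_smul
  set k : ℝ → ℂ := fun θ => deriv (circleMap 0 1) θ * ((circleMap 0 1 θ - 0) ^ 2)⁻¹ with hk
  have hkc : Continuous k := by
    apply Continuous.mul
    · rw [show deriv (circleMap 0 1) = fun θ => circleMap 0 1 θ * Complex.I from
        funext (deriv_circleMap 0 1)]
      fun_prop
    · apply Continuous.inv₀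
      · fun_prop
      · intro θ
        simp
  have hknorm : ∀ θ, ‖k θ‖ = 1 := by
    intro θ
    simp [hk, deriv_circleMap]
  have hline : ∀ z : E, Continuous fun θ : ℝ => z + circleMap 0 1 θ • v := by
    intro z; fun_prop
  obtain ⟨C, hC⟩ := (isCompact_closedBall z₀ (1 + ‖v‖)).exists_bound_of_continuousOn
    hcont.continuousOn
  have key := intervalIntegral.hasFDerivAt_integral_of_dominated_of_fderiv_le (𝕜 := ℂ)
    (μ := volume) (a := 0) (b := 2 * Real.pi)
    (F := fun z θ => k θ • f (z + circleMap 0 1 θ • v))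
    (F' := fun z θ => k θ • fderiv ℂ f (z + circleMap 0 1 θ • v)) (x₀ := z₀)
    (s := Metric.ball z₀ 1) (bound := fun _ => C) (Metric.ball_mem_nhds _ one_pos)
    (Filter.Eventually.of_forall fun z =>
      (hkc.smul (hf.continuous.comp (hline z))).aestronglyMeasurable)
    ((hkc.smul (hf.continuous.comp (hline z₀))).intervalIntegrable _ _)
    (hkc.smul (hcont.comp (hline z₀))).aestronglyMeasurable
    (Filter.Eventually.of_forall fun θ _ z hz => by
      rw [norm_smul, hknorm, one_mul]
      apply hC
      rw [Metric.mem_closedBall, dist_eq_norm]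
      have hz' : ‖z - z₀‖ < 1 := by rwa [← dist_eq_norm]
      calc ‖z + circleMap 0 1 θ • v - z₀‖ = ‖(z - z₀) + circleMap 0 1 θ • v‖ := by
            congr 1; abel
        _ ≤ ‖z - z₀‖ + ‖circleMap 0 1 θ • v‖ := norm_add_le _ _
        _ ≤ 1 + ‖v‖ := by rw [norm_smul]; simp; linarith)
    intervalIntegrable_const
    (Filter.Eventually.of_forall fun θ _ z _ => by
      have h1 : HasFDerivAt (fun z => f (z + circleMap 0 1 θ • v))
          (fderiv ℂ f (z + circleMap 0 1 θ • v)) z := by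
        have := (hf (z + circleMap 0 1 θ • v)).hasFDerivAt.comp z
          ((hasFDerivAt_id z).add_const (circleMap 0 1 θ • v))
        simpa [Function.comp_def] using this
      exact h1.const_smul (k θ))
  have := key.differentiableAt
  simpa only [hk, mul_smul] using this

/-- Holomorphic maps of several variables are smooth. -/
theorem contDiff_of_differentiable [FiniteDimensional ℂ E] [CompleteSpace F] {f : E → F}
    (hf : Differentiable ℂ f) (n : ℕ) : ContDiff ℂ n f := by
  have : ProperSpace E := FiniteDimensional.proper ℂ E
  induction n generalizing f with
  | zero => exact contDiff_zero.2 hf.continuous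
  | succ n ih =>
    push_cast
    rw [contDiff_succ_iff_fderiv_apply]
    exact ⟨hf, by simp, fun v => ih (differentiable_fderiv_apply hf v)⟩

end Osgood

end GenFrob

namespace GenFrob

open Polynomial

variable {ℓ : ℕ}

/-! ### Calculus of matrices and bilinear families -/

section Calculus

variable {E V : Type*} [NormedAddCommGroup E] [NormedSpace ℂ E] [NormedAddCommGroup V]
  [NormedSpace ℂ V] {n : ℕ}

theorem differentiableAt_det {ι : Type*} [Fintype ι] [DecidableEq ι] {M : E → Matrix ι ι ℂ} {z : E}
    (hM : ∀ i j, DifferentiableAt ℂ (fun w => M w i j) z) :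
    DifferentiableAt ℂ (fun w => (M w).det) z := by
  simp only [Matrix.det_apply]
  apply DifferentiableAt.fun_sum
  intro σ _
  apply DifferentiableAt.const_smul
  exact (HasFDerivAt.finsetProd fun i _ => (hM (σ i) i).hasFDerivAt).differentiableAt

theorem differentiableAt_inv {ι : Type*} [Fintype ι] [DecidableEq ι] {M : E → Matrix ι ι ℂ} {z : E}
    (hM : ∀ i j, DifferentiableAt ℂ (fun w => M w i j) z) (hdet : IsUnit (M z).det) (i j : ι) :
    DifferentiableAt ℂ (fun w => (M w)⁻¹ i j) z := by
  simp only [Matrix.inv_def, Matrix.smul_apply, Ring.inverse_eq_inv', smul_eq_mul]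
  apply DifferentiableAt.mul
  · exact (differentiableAt_det hM).inv hdet.ne_zero
  · simp only [Matrix.adjugate_apply]
    apply differentiableAt_det
    intro a b
    by_cases h : a = j
    · subst h
      simp only [Matrix.updateRow_self]
      exact differentiableAt_const _
    · simp only [Matrix.updateRow_ne h]
      exact hM a b

/-- The matrix of directional derivatives of the entries. -/
noncomputable def matDeriv {ι : Type*} (M : E → Matrix ι ι ℂ) (z X : E) : Matrix ι ι ℂ :=
  Matrix.of fun i j => fderiv ℂ (fun w => M w i j) z X

theorem matDeriv_inv {ι : Type*} [Fintype ι] [DecidableEq ι] {M : E → Matrix ι ι ℂ} {z : E}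
    (hM : ∀ i j, DifferentiableAt ℂ (fun w => M w i j) z) (hdet : IsUnit (M z).det) (X : E) :
    matDeriv (fun w => (M w)⁻¹) z X = -((M z)⁻¹ * matDeriv M z X * (M z)⁻¹) := by
  have hev : ∀ᶠ w in nhds z, (M w).det ≠ 0 :=
    (differentiableAt_det hM).continuousAt.eventually_ne hdet.ne_zero
  have h1 : M z * matDeriv (fun w => (M w)⁻¹) z X + matDeriv M z X * (M z)⁻¹ = 0 := by
    ext i j
    have h2 : HasFDerivAt (fun w => ∑ b, M w i b * (M w)⁻¹ b j)
        (∑ b, (M z i b • fderiv ℂ (fun w => (M w)⁻¹ b j) z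
          + (M z)⁻¹ b j • fderiv ℂ (fun w => M w i b) z)) z := by
      apply HasFDerivAt.fun_sum
      intro b _
      exact (hM i b).hasFDerivAt.mul (differentiableAt_inv hM hdet b j).hasFDerivAt
    have h3 : HasFDerivAt (fun w => ∑ b, M w i b * (M w)⁻¹ b j) (0 : E →L[ℂ] ℂ) z := by
      refine (hasFDerivAt_const ((1 : Matrix ι ι ℂ) i j) z).congr_of_eventuallyEq ?_
      filter_upwards [hev] with w hw
      rw [← Matrix.mul_apply, Matrix.mul_nonsing_inv _ (isUnit_iff_ne_zero.2 hw)]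
    have h4 := congrArg (fun L : E →L[ℂ] ℂ => L X) (h2.unique h3)
    simp only [FunLike.coe_sum, Finset.sum_apply, smul_apply, smul_eq_mul, add_apply,
      zero_apply, Finset.sum_add_distrib] at h4
    rw [Matrix.add_apply, Matrix.mul_apply, Matrix.mul_apply, Matrix.zero_apply, ← h4]
    simp only [matDeriv, Matrix.of_apply, mul_comm]
  have h5 : matDeriv (fun w => (M w)⁻¹) z X
      = (M z)⁻¹ * (M z * matDeriv (fun w => (M w)⁻¹) z X) := by
    rw [← Matrix.mul_assoc, Matrix.nonsing_inv_mul _ hdet, Matrix.one_mul]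
  rw [h5, eq_neg_of_add_eq_zero_left h1, Matrix.mul_neg, Matrix.mul_assoc]

theorem bilin_apply_eq_sum (B : Vec n →ₗ[ℂ] Vec n →ₗ[ℂ] V) (y z : Vec n) :
    B y z = ∑ i, ∑ j, (y i * z j) • B (Pi.single i 1) (Pi.single j 1) := by
  conv_lhs => rw [← Finset.univ_sum_single y, ← Finset.univ_sum_single z]
  simp only [map_sum, LinearMap.sum_apply]
  refine Finset.sum_comm.trans (Finset.sum_congr rfl fun i _ => Finset.sum_congr rfl fun j _ => ?_)
  rw [show (Pi.single i (y i) : Vec n) = y i • Pi.single i 1 by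
      rw [← Pi.single_smul, smul_eq_mul, mul_one],
    show (Pi.single j (z j) : Vec n) = z j • Pi.single j 1 by
      rw [← Pi.single_smul, smul_eq_mul, mul_one]]
  rw [map_smul, map_smul, LinearMap.smul_apply, smul_smul, mul_comm]

theorem hasFDerivAt_bilin {B : E → Vec n →ₗ[ℂ] Vec n →ₗ[ℂ] V} {z : E}
    (hB : ∀ i j, DifferentiableAt ℂ (fun w => B w (Pi.single i 1) (Pi.single j 1)) z)
    {Y Z : E → Vec n} (hY : DifferentiableAt ℂ Y z) (hZ : DifferentiableAt ℂ Z z) :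
    HasFDerivAt (fun w => B w (Y w) (Z w))
      (∑ i, ∑ j, ((Y z i * Z z j) • fderiv ℂ (fun w => B w (Pi.single i 1) (Pi.single j 1)) z
        + (Y z i • fderiv ℂ (fun w => Z w j) z + Z z j • fderiv ℂ (fun w => Y w i) z).smulRight
          (B z (Pi.single i 1) (Pi.single j 1)))) z := by
  have e : (fun w => B w (Y w) (Z w)) = fun w =>
      ∑ i, ∑ j, (Y w i * Z w j) • B w (Pi.single i 1) (Pi.single j 1) :=
    funext fun w => bilin_apply_eq_sum _ _ _
  rw [e]
  apply HasFDerivAt.fun_sum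
  intro i _
  apply HasFDerivAt.fun_sum
  intro j _
  exact ((differentiableAt_pi.1 hY i).hasFDerivAt.mul (differentiableAt_pi.1 hZ j).hasFDerivAt).smul
    (hB i j).hasFDerivAt

theorem fderiv_pi_apply {Y : E → Vec n} {z : E} (hY : DifferentiableAt ℂ Y z) (X : E) (i : Fin n) :
    fderiv ℂ (fun w => Y w i) z X = fderiv ℂ Y z X i := by
  rw [fderiv_apply hY]
  rfl

/-- The Leibniz rule for a family of bilinear maps. -/
theorem fderiv_bilin {B : E → Vec n →ₗ[ℂ] Vec n →ₗ[ℂ] V} {z : E}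
    (hB : ∀ i j, DifferentiableAt ℂ (fun w => B w (Pi.single i 1) (Pi.single j 1)) z)
    {Y Z : E → Vec n} (hY : DifferentiableAt ℂ Y z) (hZ : DifferentiableAt ℂ Z z) (X : E) :
    fderiv ℂ (fun w => B w (Y w) (Z w)) z X
      = fderiv ℂ (fun w => B w (Y z) (Z z)) z X + B z (fderiv ℂ Y z X) (Z z)
        + B z (Y z) (fderiv ℂ Z z X) := by
  have h1 := (hasFDerivAt_bilin hB hY hZ).fderiv
  have h2 := (hasFDerivAt_bilin hB (differentiableAt_const (Y z))
    (differentiableAt_const (Z z))).fderiv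
  rw [h1, h2, bilin_apply_eq_sum (B z) (fderiv ℂ Y z X) (Z z),
    bilin_apply_eq_sum (B z) (Y z) (fderiv ℂ Z z X)]
  simp only [FunLike.coe_sum, Finset.sum_apply, smul_apply, add_apply,
    ContinuousLinearMap.smulRight_apply, fderiv_fun_const, Pi.zero_apply,
    zero_apply, mul_zero, zero_smul, add_zero, smul_eq_mul, fderiv_pi_apply hY, fderiv_pi_apply hZ]
  rw [← Finset.sum_add_distrib, ← Finset.sum_add_distrib]
  refine Finset.sum_congr rfl fun i _ => ?_
  rw [← Finset.sum_add_distrib, ← Finset.sum_add_distrib]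
  refine Finset.sum_congr rfl fun j _ => ?_
  rw [add_smul, mul_comm (fderiv ℂ Y z X i)]
  abel

end Calculus

/-! ### Quotients along the coordinate covectors -/

theorem degree_mul_lt_add {P Q : ℂ[X]} {m n k : ℕ} (hP : P.degree < (m + 1 : ℕ))
    (hQ : Q.degree < (n : ℕ)) (h : m + n = k) : (P * Q).degree < (k : ℕ) := by
  by_cases hP0 : P = 0
  · rw [hP0, zero_mul, degree_zero]; exact WithBot.bot_lt_coe _
  by_cases hQ0 : Q = 0
  · rw [hQ0, mul_zero, degree_zero]; exact WithBot.bot_lt_coe _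
  rw [degree_mul, degree_eq_natDegree hP0, degree_eq_natDegree hQ0]
  have h1 := (natDegree_lt_iff_degree_lt hP0).2 hP
  have h2 := (natDegree_lt_iff_degree_lt hQ0).2 hQ
  exact_mod_cast (by omega : P.natDegree + Q.natDegree < k)

theorem degree_dLam_lt (v : Vec ℓ) : (dLam v).degree < (ℓ + 1 : ℕ) :=
  lt_of_le_of_lt (degree_dLam_le v) (by exact_mod_cast Nat.lt_succ_self ℓ)

theorem degree_dpLam_lt (a : Vec ℓ) : (dpLam a).degree < (ℓ + 1 : ℕ) :=
  lt_of_le_of_lt (degree_dpLam_le a) (by exact_mod_cast Nat.lt_succ_self ℓ)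

/-- In `b Y(Λ) - Λ' K` the high parts of `Y(Λ)` and `Λ'` cancel, leaving degree below `ℓ`. With one
index raised, the quotient thus does not depend on `a`, which makes its derivatives along `a`
computable. -/
theorem kQuot_hankel_col (a Y : Vec ℓ) (j : Fin ℓ) :
    kQuot a ((hankel a).mulVec (Pi.single j 1)) Y = shift (ℓ - j) (dLam Y) := by
  have hj := j.2
  set b := shift (ℓ - j) (dpLam a) with hb
  set K := shift (ℓ - j) (dLam Y) with hK
  have hbd : b.degree < ((j : ℕ) + 1 : ℕ) := degree_shift_lt (degree_dpLam_lt a) (by omega)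
  have hKd : K.degree < ((j : ℕ) + 1 : ℕ) := degree_shift_lt (degree_dLam_lt Y) (by omega)
  have h1 := degree_sub_shift_lt (ℓ - j) (dpLam a)
  have h2 := degree_sub_shift_lt (ℓ - j) (dLam Y)
  rw [← hb] at h1
  rw [← hK] at h2
  have hdeg : (b * dLam Y - dpLam a * K).degree < ℓ := by
    rw [show b * dLam Y - dpLam a * K
      = b * (dLam Y - X ^ (ℓ - (j : ℕ)) * K) - K * (dpLam a - X ^ (ℓ - (j : ℕ)) * b) by ring]
    exact lt_of_le_of_lt (degree_sub_le _ _) (max_lt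
      (degree_mul_lt_add hbd h2 (by omega)) (degree_mul_lt_add hKd h1 (by omega)))
  apply (lgMul_eq_of_eq a (Z := ofPoly ℓ (b * dLam Y - dpLam a * K)) _).2
  rw [toPoly_ofPoly hdeg, toPoly_hankel_col, dLam_eq]
  ring

theorem kQuot_eq_sum (a Y Z : Vec ℓ) :
    kQuot a Y Z = ∑ j : Fin ℓ, (lgGram a).mulVec Y j • shift (ℓ - j) (dLam Z) := by
  set w := (lgGram a).mulVec Y with hw
  have hY : Y = (hankel a).mulVec w := by
    rw [hw, Matrix.mulVec_mulVec, hankel_mul_lgGram, Matrix.one_mulVec]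
  apply (lgMul_eq_of_eq a
    (Z := ∑ j, w j • lgMul a ((hankel a).mulVec (Pi.single j 1)) Z) _).2
  rw [map_sum, Finset.mul_sum, ← Finset.sum_add_distrib]
  conv_rhs => rw [hY, mulVec_eq_sum_single, map_sum, Finset.mul_sum, Finset.sum_mul]
  refine Finset.sum_congr rfl fun j _ => ?_
  rw [map_smul, map_smul, ← kQuot_hankel_col a, mul_smul_comm, mul_smul_comm, smul_mul_assoc,
    ← smul_add, toPoly_lgMul_add]

/-! ### The Levi-Civita connection of the residue metric -/

/-- The connection coefficients of the residue metric with one index raised. -/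
noncomputable def gammaMat (Z : Vec ℓ) : Matrix (Fin ℓ) (Fin ℓ) ℂ :=
  Matrix.of fun i j => (derivative (shift (ℓ - j) (dLam Z))).coeff (ℓ - 1 - (i : ℕ))

/-- Minus the Christoffel tensor of the residue metric. -/
noncomputable def kappa (a Y Z : Vec ℓ) : Vec ℓ := (gammaMat Z).mulVec ((lgGram a).mulVec Y)

theorem degree_derivative_kQuot (a Y Z : Vec ℓ) : (derivative (kQuot a Y Z)).degree < ℓ := by
  rw [kQuot_eq_sum, degree_lt_iff_coeff_zero]
  intro m hm
  rw [coeff_derivative, finsetSum_coeff]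
  rw [Finset.sum_eq_zero, zero_mul]
  intro j _
  rw [coeff_smul, coeff_shift, coeff_eq_zero_of_degree_lt, smul_zero]
  exact lt_of_le_of_lt (degree_dLam_le Z) (by exact_mod_cast (by omega))

/-- In flat coordinates this becomes `∂_α ∂_β Λ = p ∂_p K_{αβ}`. Since `K` is symmetric, the
connection `∂ - κ` has no torsion. -/
theorem toPoly_kappa (a Y Z : Vec ℓ) : toPoly (kappa a Y Z) = derivative (kQuot a Y Z) := by
  rw [← toPoly_ofPoly (degree_derivative_kQuot a Y Z)]
  congr 1
  ext i
  rw [ofPoly_apply, kQuot_eq_sum, derivative_sum, finsetSum_coeff]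
  have h : kappa a Y Z i = ∑ j : Fin ℓ, (derivative (shift (ℓ - j) (dLam Z))).coeff (ℓ - 1 - (i : ℕ))
      * (lgGram a).mulVec Y j := rfl
  simp only [h, derivative_smul, coeff_smul, smul_eq_mul]
  exact Finset.sum_congr rfl fun j _ => mul_comm _ _

theorem kappa_comm (a Y Z : Vec ℓ) : kappa a Y Z = kappa a Z Y := by
  apply toPoly_injective
  rw [toPoly_kappa, toPoly_kappa, kQuot_comm]

/-! ### Derivatives of the metric and of the product -/

theorem dLam_add (v w : Vec ℓ) : dLam (v + w) = dLam v + dLam w := by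
  rw [dLam_eq, dLam_eq, dLam_eq, map_add, mul_add]

theorem dLam_smul (c : ℂ) (v : Vec ℓ) : dLam (c • v) = c • dLam v := by
  rw [dLam_eq, dLam_eq, map_smul, mul_smul_comm]

/-- The linear functional `v ↦ [pⁿ] (v(Λ)' S)`. -/
noncomputable def coeffDeriv (S : ℂ[X]) (n : ℕ) : Vec ℓ →L[ℂ] ℂ :=
  LinearMap.toContinuousLinearMap
    { toFun := fun v => (derivative (dLam v) * S).coeff n
      map_add' := fun v w => by rw [dLam_add, derivative_add, add_mul, coeff_add]
      map_smul' := fun c v => by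
        rw [dLam_smul, derivative_smul, smul_mul_assoc, coeff_smul]; rfl }

theorem coeffDeriv_apply (S : ℂ[X]) (n : ℕ) (v : Vec ℓ) :
    coeffDeriv S n v = (derivative (dLam v) * S).coeff n := rfl

theorem hasFDerivAt_coeff_dpLam_mul (S : ℂ[X]) (n : ℕ) (a : Vec ℓ) :
    HasFDerivAt (fun a : Vec ℓ => (dpLam a * S).coeff n) (coeffDeriv S n) a := by
  have e : (fun a : Vec ℓ => (dpLam a * S).coeff n)
      = fun a => (derivative (X ^ (ℓ + 1)) * S).coeff n + coeffDeriv S n a := by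
    ext a
    rw [dpLam, superpotential, derivative_add, add_mul, coeff_add]
    rfl
  rw [e]
  exact (coeffDeriv S n).hasFDerivAt.const_add _

theorem hasFDerivAt_hankel (i j : Fin ℓ) (a : Vec ℓ) :
    HasFDerivAt (fun a : Vec ℓ => hankel a i j) (coeffDeriv 1 (ℓ - 1 - (i : ℕ) + (ℓ - (j : ℕ)))) a := by
  have := hasFDerivAt_coeff_dpLam_mul 1 (ℓ - 1 - (i : ℕ) + (ℓ - (j : ℕ))) a
  simp only [mul_one] at this
  exact this

theorem matDeriv_hankel (a X' : Vec ℓ) :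
    matDeriv hankel a X' = gammaMat X' + (gammaMat X').transpose := by
  ext i j
  have hi := i.2
  have hj := j.2
  rw [matDeriv, Matrix.of_apply, (hasFDerivAt_hankel i j a).fderiv, coeffDeriv_apply, mul_one,
    Matrix.add_apply, Matrix.transpose_apply, gammaMat, Matrix.of_apply, Matrix.of_apply,
    coeff_derivative, coeff_derivative, coeff_derivative, coeff_shift, coeff_shift,
    show ℓ - 1 - (i : ℕ) + (ℓ - j) + 1 = 2 * ℓ - i - j by omega,
    show ℓ - 1 - (i : ℕ) + 1 + (ℓ - j) = 2 * ℓ - i - j by omega,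
    show ℓ - 1 - (j : ℕ) + 1 + (ℓ - i) = 2 * ℓ - i - j by omega, ← mul_add]
  congr 1
  -- The three entries involve the same coefficient of `X'(Λ)`; differentiation in `p` gives it the
  -- factor `2ℓ - i - j` on the left, which splits as `(ℓ - i) + (ℓ - j)`.
  have : ℓ - 1 - (i : ℕ) + (ℓ - j) + 1 = (ℓ - 1 - i + 1) + (ℓ - 1 - j + 1) := by omega
  exact_mod_cast this

theorem differentiableAt_lgGram (i j : Fin ℓ) (a : Vec ℓ) :
    DifferentiableAt ℂ (fun a : Vec ℓ => lgGram a i j) a := by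
  simp only [← hankel_inv]
  exact differentiableAt_inv (fun i j => (hasFDerivAt_hankel i j a).differentiableAt)
    (isUnit_det_hankel a) i j

theorem matDeriv_lgGram (a X' : Vec ℓ) :
    matDeriv lgGram a X' = -(lgGram a * (gammaMat X' + (gammaMat X').transpose) * lgGram a) := by
  have h := matDeriv_inv (M := (hankel : Vec ℓ → _)) (z := a)
    (fun i j => (hasFDerivAt_hankel i j a).differentiableAt) (isUnit_det_hankel a) X'
  rw [matDeriv_hankel] at h
  simpa only [hankel_inv] using h

theorem lgBilin_single (a : Vec ℓ) (i j : Fin ℓ) :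
    lgBilin a (Pi.single i 1) (Pi.single j 1) = lgGram a i j := by
  rw [lgBilin_apply]; rfl

theorem differentiableAt_lgBilin (a : Vec ℓ) (i j : Fin ℓ) :
    DifferentiableAt ℂ (fun w : Vec ℓ => lgBilin w (Pi.single i 1) (Pi.single j 1)) a := by
  simp only [lgBilin_single]
  exact differentiableAt_lgGram i j a

/-- The connection `∂ - κ` is compatible with the metric. -/
theorem fderiv_lgMetric (a X' Y Z : Vec ℓ) :
    fderiv ℂ (fun a => lgMetric a Y Z) a X'
      = -lgMetric a (kappa a X' Y) Z - lgMetric a Y (kappa a X' Z) := by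
  have h1 : fderiv ℂ (fun a => lgMetric a Y Z) a X' = Y ⬝ᵥ (matDeriv lgGram a X').mulVec Z := by
    have e : (fun a : Vec ℓ => lgMetric a Y Z) = fun a => ∑ i, ∑ j, (Y i * Z j) * lgGram a i j := by
      ext a
      rw [← lgBilin_apply, bilin_apply_eq_sum]
      simp only [lgBilin_single, smul_eq_mul]
    have h2 : HasFDerivAt (fun a : Vec ℓ => ∑ i, ∑ j, (Y i * Z j) * lgGram a i j)
        (∑ i, ∑ j, (Y i * Z j) • fderiv ℂ (fun a : Vec ℓ => lgGram a i j) a) a := by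
      apply HasFDerivAt.fun_sum
      intro i _
      apply HasFDerivAt.fun_sum
      intro j _
      exact (differentiableAt_lgGram i j a).hasFDerivAt.const_mul _
    rw [e, h2.fderiv]
    simp only [FunLike.coe_sum, Finset.sum_apply, smul_apply, smul_eq_mul, dotProduct,
      Matrix.mulVec, matDeriv, Matrix.of_apply, Finset.mul_sum]
    exact Finset.sum_congr rfl fun i _ => Finset.sum_congr rfl fun j _ => by ring
  rw [h1, matDeriv_lgGram, kappa_comm a X' Y, kappa_comm a X' Z, kappa, kappa]
  set y := (lgGram a).mulVec Y with hy
  set z := (lgGram a).mulVec Z with hz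
  rw [lgMetric_comm a _ Z, lgMetric_eq_dotProduct, lgMetric_eq_dotProduct]
  have h3 : ∀ U V : Vec ℓ, U ⬝ᵥ (lgGram a).mulVec V = (lgGram a).mulVec U ⬝ᵥ V := by
    intro U V
    rw [Matrix.dotProduct_mulVec, ← Matrix.mulVec_transpose, lgGram_transpose]
  rw [h3, h3, ← hy, ← hz, Matrix.neg_mulVec, dotProduct_neg, ← Matrix.mulVec_mulVec,
    ← Matrix.mulVec_mulVec, h3, ← hy, ← hz, Matrix.add_mulVec, dotProduct_add]
  have h4 : y ⬝ᵥ (gammaMat X').transpose.mulVec z = z ⬝ᵥ (gammaMat X').mulVec y := by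
    rw [Matrix.dotProduct_mulVec, Matrix.vecMul_transpose, dotProduct_comm]
  rw [h4]
  ring

/-- The coefficient functional of `toPoly`. -/
noncomputable def coeffCLM (n : ℕ) : Vec ℓ →L[ℂ] ℂ :=
  LinearMap.toContinuousLinearMap ((lcoeff ℂ n).comp toPoly)

theorem coeffCLM_apply (n : ℕ) (v : Vec ℓ) : coeffCLM n v = (toPoly v).coeff n := rfl

/-- The derivative of the quotient `K(Y, Z)` in the direction `X'`. -/
noncomputable def kQuotDeriv (a X' Y Z : Vec ℓ) : ℂ[X] :=
  ∑ j : Fin ℓ, (matDeriv lgGram a X').mulVec Y j • shift (ℓ - j) (dLam Z)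

theorem hasFDerivAt_lgGram_mulVec (a Y : Vec ℓ) (j : Fin ℓ) :
    HasFDerivAt (fun a : Vec ℓ => (lgGram a).mulVec Y j)
      (∑ k, Y k • fderiv ℂ (fun a : Vec ℓ => lgGram a j k) a) a := by
  have : (fun a : Vec ℓ => (lgGram a).mulVec Y j) = fun a => ∑ k, lgGram a j k * Y k := rfl
  rw [this]
  apply HasFDerivAt.fun_sum
  intro k _
  exact (differentiableAt_lgGram j k a).hasFDerivAt.mul_const _

theorem hasFDerivAt_coeff_lgMul (a Y Z : Vec ℓ) (n : ℕ) :
    HasFDerivAt (fun a : Vec ℓ => (toPoly (lgMul a Y Z)).coeff n)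
      (-∑ j : Fin ℓ, ((lgGram a).mulVec Y j • coeffDeriv (shift (ℓ - j) (dLam Z)) n
        + (dpLam a * shift (ℓ - j) (dLam Z)).coeff n •
          ∑ k, Y k • fderiv ℂ (fun a : Vec ℓ => lgGram a j k) a)) a := by
  have e : (fun a : Vec ℓ => (toPoly (lgMul a Y Z)).coeff n) = fun a =>
      (X * toPoly Y * toPoly Z).coeff n
        - ∑ j : Fin ℓ, (lgGram a).mulVec Y j * (dpLam a * shift (ℓ - j) (dLam Z)).coeff n := by
    ext a
    rw [eq_sub_of_add_eq (toPoly_lgMul_add a Y Z), coeff_sub, kQuot_eq_sum, Finset.mul_sum,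
      finsetSum_coeff]
    simp only [mul_smul_comm, coeff_smul, smul_eq_mul]
  rw [e]
  apply HasFDerivAt.const_sub
  apply HasFDerivAt.fun_sum
  intro j _
  exact (hasFDerivAt_lgGram_mulVec a Y j).mul (hasFDerivAt_coeff_dpLam_mul _ n a)

theorem differentiableAt_lgMul (a Y Z : Vec ℓ) :
    DifferentiableAt ℂ (fun a => lgMul a Y Z) a := by
  rw [differentiableAt_pi]
  intro i
  have := (hasFDerivAt_coeff_lgMul a Y Z (ℓ - 1 - (i : ℕ))).differentiableAt
  simpa only [coeff_toPoly] using this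

theorem toPoly_fderiv_lgMul (a X' Y Z : Vec ℓ) :
    toPoly (fderiv ℂ (fun a => lgMul a Y Z) a X')
      = -(derivative (dLam X') * kQuot a Y Z + dpLam a * kQuotDeriv a X' Y Z) := by
  ext n
  have h1 : HasFDerivAt (fun a : Vec ℓ => (toPoly (lgMul a Y Z)).coeff n)
      ((coeffCLM n).comp (fderiv ℂ (fun a => lgMul a Y Z) a)) a :=
    (coeffCLM n).hasFDerivAt.comp a (differentiableAt_lgMul a Y Z).hasFDerivAt
  have h2 := congrArg (fun L : Vec ℓ →L[ℂ] ℂ => L X') (h1.unique (hasFDerivAt_coeff_lgMul a Y Z n))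
  simp only [ContinuousLinearMap.comp_apply, coeffCLM_apply] at h2
  rw [h2, coeff_neg, coeff_add, kQuot_eq_sum, kQuotDeriv, Finset.mul_sum, Finset.mul_sum,
    finsetSum_coeff, finsetSum_coeff, ← Finset.sum_add_distrib]
  simp only [neg_apply, FunLike.coe_sum, Finset.sum_apply, add_apply, smul_apply, smul_eq_mul,
    coeffDeriv_apply, mul_smul_comm, coeff_smul]
  congr 1
  refine Finset.sum_congr rfl fun j _ => ?_
  congr 1
  rw [mul_comm]
  congr 1
  simp only [Matrix.mulVec, dotProduct, matDeriv, Matrix.of_apply]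
  exact Finset.sum_congr rfl fun k _ => mul_comm _ _

/-- The covariant derivative of the product. -/
noncomputable def nablaMul (a X' Y Z : Vec ℓ) : Vec ℓ :=
  fderiv ℂ (fun a => lgMul a Y Z) a X' - kappa a X' (lgMul a Y Z)
    + lgMul a (kappa a X' Y) Z + lgMul a Y (kappa a X' Z)

/-- Both sides are the total quotient obtained when `p² x y z` is reduced by `Λ'` in two orders; the
remainders agree by associativity. -/
theorem kQuot_assoc (a X' Y Z : Vec ℓ) :
    kQuot a X' (lgMul a Y Z) + dLam X' * kQuot a Y Z
      = kQuot a Y (lgMul a X' Z) + dLam Y * kQuot a X' Z := by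
  apply mul_left_cancel₀ (dpLam_ne_zero a)
  have h1 := toPoly_lgMul_add a X' (lgMul a Y Z)
  have h2 := toPoly_lgMul_add a Y (lgMul a X' Z)
  have h3 := toPoly_lgMul_add a Y Z
  have h4 := toPoly_lgMul_add a X' Z
  have h5 : lgMul a X' (lgMul a Y Z) = lgMul a Y (lgMul a X' Z) := by
    rw [← lgMul_assoc, lgMul_comm a X' Y, lgMul_assoc]
  rw [h5] at h1
  rw [dLam_eq, dLam_eq]
  linear_combination h1 - h2 + X * toPoly X' * h3 - X * toPoly Y * h4

/-- Modulo `Λ'`, the `p`-derivative of the associativity relation turns the left side into `X(Λ) ∂_p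
K(Y,Z) + Y(Λ) ∂_p K(X,Z) + Z(Λ) ∂_p K(X,Y)` minus a term symmetric in `X` and `Y`. -/
theorem nablaMul_symm (a X' Y Z : Vec ℓ) : nablaMul a X' Y Z = nablaMul a Y X' Z := by
  apply vec_eq_of_dvd_sub a
  have hd := congrArg derivative (kQuot_assoc a X' Y Z)
  simp only [derivative_add, derivative_mul] at hd
  obtain ⟨u1, h1⟩ := dvd_lgMul a (kappa a X' Y) Z
  obtain ⟨u2, h2⟩ := dvd_lgMul a Y (kappa a X' Z)
  obtain ⟨u4, h4⟩ := dvd_lgMul a X' (kappa a Y Z)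
  rw [toPoly_kappa] at h1 h2 h4
  simp only [nablaMul, map_add, map_sub, toPoly_fderiv_lgMul, toPoly_kappa]
  rw [kappa_comm a Y X']
  rw [dLam_eq X', dLam_eq Y] at hd ⊢
  simp only [derivative_mul, derivative_X] at hd ⊢
  refine ⟨-kQuotDeriv a X' Y Z + kQuotDeriv a Y X' Z + u2 - u4, ?_⟩
  linear_combination h2 - h4 - hd

/-! ### Scaling -/

theorem toPoly_hMap_comp (c : ℂ) (v : Vec ℓ) :
    (toPoly (hMap c v)).comp (C c * X) = C (c ^ ℓ) * toPoly v := by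
  rw [toPoly_apply, toPoly_apply, Polynomial.sum_comp, Finset.mul_sum]
  refine Finset.sum_congr rfl fun i _ => ?_
  have hi := i.2
  rw [mul_comp, C_comp, X_pow_comp, hMap, mul_pow, ← C_pow, ← mul_assoc, ← C_mul, ← mul_assoc,
    ← C_mul]
  congr 2
  rw [mul_right_comm, ← pow_add]
  congr 2
  omega

/-- Weighted homogeneity `Λ_{c·a}(c p) = c^{ℓ+1} Λ_a(p)`, differentiated in `p`. It yields the
scaling of metric and product, used infinitesimally for the Euler field and at `c = ±1` for the
comparison maps. -/
theorem dpLam_hMap_comp {c : ℂ} (hc : c ≠ 0) (a : Vec ℓ) :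
    (dpLam (hMap c a)).comp (C c * X) = C (c ^ ℓ) * dpLam a := by
  have h1 : (superpotential (hMap c a)).comp (C c * X) = C (c ^ (ℓ + 1)) * superpotential a := by
    rw [superpotential, add_comp, X_pow_comp, dLam_eq, mul_comp, X_comp, toPoly_hMap_comp,
      superpotential, dLam_eq, mul_pow]
    simp only [C_pow, pow_succ, C_mul]
    ring
  have h2 := congrArg derivative h1
  rw [derivative_comp, derivative_C_mul, derivative_C_mul, derivative_X, mul_one] at h2
  apply mul_left_cancel₀ (C_ne_zero.2 hc)
  rw [dpLam, h2, dpLam, pow_succ, C_mul]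
  ring

theorem comp_C_mul_X_injective {c : ℂ} (hc : c ≠ 0) :
    Function.Injective fun P : ℂ[X] => P.comp (C c * X) := by
  intro P Q h
  have h1 := congrArg (fun R : ℂ[X] => R.comp (C c⁻¹ * X)) h
  simp only [comp_assoc, mul_comp, C_comp, X_comp] at h1
  rw [← mul_assoc, ← C_mul, mul_inv_cancel₀ hc, C_1, one_mul, comp_X, comp_X] at h1
  exact h1

theorem hMap_smul (c r : ℂ) (v : Vec ℓ) : hMap c (r • v) = r • hMap c v := by
  ext i
  simp [hMap]
  ring

theorem hMap_add (c : ℂ) (v w : Vec ℓ) : hMap c (v + w) = hMap c v + hMap c w := by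
  ext i
  simp [hMap]
  ring

theorem lgMul_hMap {c : ℂ} (hc : c ≠ 0) (a X' Y : Vec ℓ) :
    lgMul (hMap c a) (hMap c X') (hMap c Y) = c ^ (ℓ + 1) • hMap c (lgMul a X' Y) := by
  apply (lgMul_eq_of_eq (hMap c a)
    (K := C (c ^ (ℓ + 1)) * (kQuot a X' Y).comp (C c⁻¹ * X)) _).1
  apply comp_C_mul_X_injective hc
  have hK : ((kQuot a X' Y).comp (C c⁻¹ * X)).comp (C c * X) = kQuot a X' Y := by
    rw [comp_assoc, mul_comp, C_comp, X_comp, ← mul_assoc, ← C_mul, inv_mul_cancel₀ hc, C_1,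
      one_mul, comp_X]
  simp only [add_comp, mul_comp, C_comp, X_comp, hK, map_smul, toPoly_hMap_comp,
    dpLam_hMap_comp hc, smul_eq_C_mul]
  have h := toPoly_lgMul_add a X' Y
  simp only [C_pow, pow_succ, C_mul] at h ⊢
  linear_combination C c * (C c ^ ℓ) ^ 2 * h

theorem hankel_hMap {c : ℂ} (hc : c ≠ 0) (a w : Vec ℓ) :
    c ^ (ℓ + 1) • (hankel (hMap c a)).mulVec w = hMap c ((hankel a).mulVec (hMap c w)) := by
  have h : ∀ m, (dpLam (hMap c a)).coeff m * c ^ m = c ^ ℓ * (dpLam a).coeff m := by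
    intro m
    have := congrArg (fun P => coeff P m) (dpLam_hMap_comp hc a)
    simpa only [comp_C_mul_X_coeff, coeff_C_mul] using this
  ext i
  have e1 : (c ^ (ℓ + 1) • (hankel (hMap c a)).mulVec w) i
      = ∑ j, c ^ (ℓ + 1) * (hankel (hMap c a) i j * w j) := by
    rw [← Finset.mul_sum]; rfl
  have e2 : hMap c ((hankel a).mulVec (hMap c w)) i
      = ∑ j, c ^ ((i : ℕ) + 1) * (hankel a i j * (c ^ ((j : ℕ) + 1) * w j)) := by
    rw [← Finset.mul_sum]; rfl
  rw [e1, e2]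
  refine Finset.sum_congr rfl fun j _ => ?_
  have hi := i.2
  have hj := j.2
  simp only [hankel, Matrix.of_apply]
  set m := ℓ - 1 - (i : ℕ) + (ℓ - j) with hm
  apply mul_left_cancel₀ (pow_ne_zero m hc)
  have h1 : c ^ m * (c ^ ((i : ℕ) + 1) * c ^ ((j : ℕ) + 1)) = c ^ (ℓ + 1) * c ^ ℓ := by
    rw [← pow_add, ← pow_add, ← pow_add]
    congr 1
    omega
  linear_combination c ^ (ℓ + 1) * w j * h m - (dpLam a).coeff m * w j * h1

theorem hMap_dotProduct (c : ℂ) (v w : Vec ℓ) : hMap c v ⬝ᵥ w = v ⬝ᵥ hMap c w := by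
  simp only [dotProduct, hMap]
  exact Finset.sum_congr rfl fun i _ => by ring

theorem hMap_hMap_inv {c : ℂ} (hc : c ≠ 0) (v : Vec ℓ) : hMap c (hMap c⁻¹ v) = v := by
  ext i
  simp only [hMap]
  rw [← mul_assoc, ← mul_pow, mul_inv_cancel₀ hc, one_pow, one_mul]

theorem lgMetric_hMap {c : ℂ} (hc : c ≠ 0) (a X' Y : Vec ℓ) :
    lgMetric (hMap c a) (hMap c X') (hMap c Y) = c ^ (ℓ + 1) * lgMetric a X' Y := by
  set w := (lgGram a).mulVec Y with hw
  have hY : Y = (hankel a).mulVec w := by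
    rw [hw, Matrix.mulVec_mulVec, hankel_mul_lgGram, Matrix.one_mulVec]
  have h1 := hankel_hMap hc a (hMap c⁻¹ w)
  rw [hMap_hMap_inv hc, ← hY] at h1
  rw [← h1, ← Matrix.mulVec_smul, lgMetric_hankel, dotProduct_smul, hMap_dotProduct,
    hMap_hMap_inv hc, hY, lgMetric_hankel, smul_eq_mul]

/-! ### Lie derivatives along the Euler field -/

/-- The Euler field as a linear map. -/
noncomputable def eulerCLM : Vec ℓ →L[ℂ] Vec ℓ :=
  LinearMap.toContinuousLinearMap
    { toFun := eulerField
      map_add' := fun v w => by ext i; simp [eulerField]; ring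
      map_smul' := fun c v => by ext i; simp [eulerField]; ring }

theorem eulerCLM_apply (v : Vec ℓ) : eulerCLM v = eulerField v := rfl

theorem hasFDerivAt_eulerField (z : Vec ℓ) : HasFDerivAt eulerField eulerCLM z :=
  (eulerCLM (ℓ := ℓ)).hasFDerivAt

theorem hasDerivAt_hMap (v : Vec ℓ) :
    HasDerivAt (fun c : ℂ => hMap c v) ((ℓ + 1 : ℂ) • eulerField v) 1 := by
  rw [hasDerivAt_pi]
  intro i
  have h := (hasDerivAt_pow ((i : ℕ) + 1) (1 : ℂ)).mul_const (v i)
  refine h.congr_deriv ?_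
  have := succ_ne_zero_complex ℓ
  simp [eulerField]
  field_simp

theorem hMap_one (v : Vec ℓ) : hMap 1 v = v := by
  ext i; simp [hMap]

/-- A bilinear family that scales along `hMap` is homogeneous along the Euler field. -/
theorem fderiv_euler_of_hMap {V : Type*} [NormedAddCommGroup V] [NormedSpace ℂ V]
    {B : Vec ℓ → Vec ℓ →ₗ[ℂ] Vec ℓ →ₗ[ℂ] V}
    (hB : ∀ X' Y z, DifferentiableAt ℂ (fun w => B w X' Y) z) (a X' Y : Vec ℓ) {f : ℂ → V} {f' : V}
    (hf : HasDerivAt f ((ℓ + 1 : ℂ) • f') 1)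
    (h : ∀ c : ℂ, c ≠ 0 → B (hMap c a) (hMap c X') (hMap c Y) = f c) :
    fderiv ℂ (fun w => B w X' Y) a (eulerField a)
      = f' - B a (eulerField X') Y - B a X' (eulerField Y) := by
  have hN := succ_ne_zero_complex ℓ
  have hev : (fun c : ℂ => B (hMap c a) (hMap c X') (hMap c Y)) =ᶠ[nhds 1] f := by
    filter_upwards [isOpen_ne.mem_nhds (one_ne_zero : (1 : ℂ) ≠ 0)] with c hc
    exact h c hc
  have h1 : ∀ X' Y, HasFDerivAt (fun c : ℂ => B (hMap c a) X' Y)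
      ((fderiv ℂ (fun w => B w X' Y) a).comp
        (ContinuousLinearMap.toSpanSingleton ℂ ((ℓ + 1 : ℂ) • eulerField a))) 1 := by
    intro X' Y
    have h2 := (hasDerivAt_hMap a).hasFDerivAt
    have h3 : HasFDerivAt (fun w => B w X' Y) (fderiv ℂ (fun w => B w X' Y) a) (hMap 1 a) := by
      rw [hMap_one]; exact (hB X' Y a).hasFDerivAt
    exact h3.comp 1 h2
  have h4 := fderiv_bilin (B := fun c : ℂ => B (hMap c a)) (z := 1)
    (fun i j => (h1 _ _).differentiableAt) (hasDerivAt_hMap X').differentiableAt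
    (hasDerivAt_hMap Y).differentiableAt 1
  rw [hev.fderiv_eq, hf.hasFDerivAt.fderiv, (h1 _ _).fderiv,
    (hasDerivAt_hMap X').hasFDerivAt.fderiv, (hasDerivAt_hMap Y).hasFDerivAt.fderiv] at h4
  simp only [ContinuousLinearMap.toSpanSingleton_apply, ContinuousLinearMap.comp_apply, one_smul,
    hMap_one, map_smul, LinearMap.smul_apply, ← smul_add] at h4
  have h5 := smul_right_injective V hN h4
  rw [h5]
  abel

theorem differentiableAt_lgMetric (X' Y z : Vec ℓ) :
    DifferentiableAt ℂ (fun w => lgBilin w X' Y) z :=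
  (hasFDerivAt_bilin (differentiableAt_lgBilin z) (differentiableAt_const X')
    (differentiableAt_const Y)).differentiableAt

theorem fderiv_lgMetric_euler (a X' Y : Vec ℓ) :
    fderiv ℂ (fun w => lgMetric w X' Y) a (eulerField a)
      = lgMetric a X' Y - lgMetric a (eulerField X') Y - lgMetric a X' (eulerField Y) := by
  have h := fderiv_euler_of_hMap (B := lgBilin) differentiableAt_lgMetric a X' Y
    (f := fun c => c ^ (ℓ + 1) * lgMetric a X' Y) (f' := lgMetric a X' Y) (by
      have := (hasDerivAt_pow (ℓ + 1) (1 : ℂ)).mul_const (lgMetric a X' Y)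
      refine this.congr_deriv ?_
      simp) (fun c hc => by rw [lgBilin_apply, lgMetric_hMap hc])
  simpa only [lgBilin_apply] using h

theorem fderiv_lgMul_euler (a X' Y : Vec ℓ) :
    fderiv ℂ (fun w => lgMul w X' Y) a (eulerField a)
      = lgMul a X' Y + eulerField (lgMul a X' Y) - lgMul a (eulerField X') Y
        - lgMul a X' (eulerField Y) := by
  have h := fderiv_euler_of_hMap (B := lgMulBilin) (fun X' Y z => differentiableAt_lgMul z X' Y)
    a X' Y (f := fun c => c ^ (ℓ + 1) • hMap c (lgMul a X' Y))
    (f' := lgMul a X' Y + eulerField (lgMul a X' Y)) (by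
      have := (hasDerivAt_pow (ℓ + 1) (1 : ℂ)).smul (hasDerivAt_hMap (lgMul a X' Y))
      refine this.congr_deriv ?_
      simp [hMap_one, smul_add, add_comm]) (fun c hc => lgMul_hMap hc a X' Y)
  exact h

theorem fderiv_lgMetric_fields {Y Z : Vec ℓ → Vec ℓ} {z : Vec ℓ} (hY : DifferentiableAt ℂ Y z)
    (hZ : DifferentiableAt ℂ Z z) (X' : Vec ℓ) :
    fderiv ℂ (fun w => lgMetric w (Y w) (Z w)) z X'
      = fderiv ℂ (fun w => lgMetric w (Y z) (Z z)) z X' + lgMetric z (fderiv ℂ Y z X') (Z z)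
        + lgMetric z (Y z) (fderiv ℂ Z z X') := by
  have h := fderiv_bilin (B := lgBilin) (differentiableAt_lgBilin z) hY hZ X'
  simpa only [lgBilin_apply] using h

theorem differentiableAt_lgMetric_fields {Y Z : Vec ℓ → Vec ℓ} {z : Vec ℓ}
    (hY : DifferentiableAt ℂ Y z) (hZ : DifferentiableAt ℂ Z z) :
    DifferentiableAt ℂ (fun w => lgMetric w (Y w) (Z w)) z := by
  have h := (hasFDerivAt_bilin (B := lgBilin) (differentiableAt_lgBilin z) hY hZ).differentiableAt
  simpa only [lgBilin_apply] using h

theorem differentiableAt_lgMul_fields {Y Z : Vec ℓ → Vec ℓ} {z : Vec ℓ}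
    (hY : DifferentiableAt ℂ Y z) (hZ : DifferentiableAt ℂ Z z) :
    DifferentiableAt ℂ (fun w => lgMul w (Y w) (Z w)) z :=
  (hasFDerivAt_bilin (B := lgMulBilin) (fun _ _ => differentiableAt_lgMul z _ _)
    hY hZ).differentiableAt

theorem fderiv_lgMul_fields {Y Z : Vec ℓ → Vec ℓ} {z : Vec ℓ} (hY : DifferentiableAt ℂ Y z)
    (hZ : DifferentiableAt ℂ Z z) (X' : Vec ℓ) :
    fderiv ℂ (fun w => lgMul w (Y w) (Z w)) z X'
      = fderiv ℂ (fun w => lgMul w (Y z) (Z z)) z X' + lgMul z (fderiv ℂ Y z X') (Z z)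
        + lgMul z (Y z) (fderiv ℂ Z z X') :=
  fderiv_bilin (B := lgMulBilin) (fun _ _ => differentiableAt_lgMul z _ _) hY hZ X'

theorem lieBracket_euler (Y : Vec ℓ → Vec ℓ) (z : Vec ℓ) :
    VectorField.lieBracket ℂ eulerField Y z
      = fderiv ℂ Y z (eulerField z) - eulerField (Y z) := by
  rw [VectorField.lieBracket, (hasFDerivAt_eulerField z).fderiv]
  rfl

theorem lgMetric_sub_left (a X' Y Z : Vec ℓ) :
    lgMetric a (X' - Y) Z = lgMetric a X' Z - lgMetric a Y Z := by
  simp [← lgBilin_apply]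

theorem lgMetric_sub_right (a X' Y Z : Vec ℓ) :
    lgMetric a X' (Y - Z) = lgMetric a X' Y - lgMetric a X' Z := by
  simp [← lgBilin_apply]

theorem lgMul_sub_left (a X' Y Z : Vec ℓ) :
    lgMul a (X' - Y) Z = lgMul a X' Z - lgMul a Y Z := by
  simp [← lgMulBilin_apply]

theorem lgMul_sub_right (a X' Y Z : Vec ℓ) :
    lgMul a X' (Y - Z) = lgMul a X' Y - lgMul a X' Z := by
  simp [← lgMulBilin_apply]

theorem euler_metric_fields {Y Z : Vec ℓ → Vec ℓ} {z : Vec ℓ} (hY : DifferentiableAt ℂ Y z)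
    (hZ : DifferentiableAt ℂ Z z) :
    fderiv ℂ (fun w => lgMetric w (Y w) (Z w)) z (eulerField z) =
      lgMetric z (VectorField.lieBracket ℂ eulerField Y z) (Z z) +
        lgMetric z (Y z) (VectorField.lieBracket ℂ eulerField Z z) + lgMetric z (Y z) (Z z) := by
  rw [fderiv_lgMetric_fields hY hZ, fderiv_lgMetric_euler, lieBracket_euler, lieBracket_euler,
    lgMetric_sub_left, lgMetric_sub_right]
  ring

theorem euler_mul_fields {Y Z : Vec ℓ → Vec ℓ} {z : Vec ℓ} (hY : DifferentiableAt ℂ Y z)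
    (hZ : DifferentiableAt ℂ Z z) :
    VectorField.lieBracket ℂ eulerField (fun w => lgMul w (Y w) (Z w)) z =
      lgMul z (VectorField.lieBracket ℂ eulerField Y z) (Z z) +
        lgMul z (Y z) (VectorField.lieBracket ℂ eulerField Z z) + lgMul z (Y z) (Z z) := by
  rw [lieBracket_euler, fderiv_lgMul_fields hY hZ, fderiv_lgMul_euler, lieBracket_euler,
    lieBracket_euler, lgMul_sub_left, lgMul_sub_right]
  abel

/-! ### Flat coordinate systems -/

theorem jac_mulVec {n : ℕ} (f : Vec n → Vec n) (z X' : Vec n) :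
    (jac f z).mulVec X' = fderiv ℂ f z X' := by
  conv_rhs => rw [← Finset.univ_sum_single X']
  ext α
  rw [map_sum, Finset.sum_apply]
  simp only [Matrix.mulVec, dotProduct, jac, Matrix.of_apply]
  refine Finset.sum_congr rfl fun i _ => ?_
  rw [show (Pi.single i (X' i) : Vec n) = X' i • Pi.single i 1 by
      rw [← Pi.single_smul, smul_eq_mul, mul_one], map_smul, Pi.smul_apply, smul_eq_mul, mul_comm]

theorem matrix_eq_one_of_mulVec {n : ℕ} {M : Matrix (Fin n) (Fin n) ℂ}
    (h : ∀ v, M.mulVec v = v) : M = 1 :=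
  Matrix.ext_of_mulVec_single fun i => by rw [h, Matrix.one_mulVec]

theorem euler_injective : Function.Injective (eulerField : Vec ℓ → Vec ℓ) := by
  intro v w h
  ext i
  have h1 := congrFun h i
  simp only [eulerField] at h1
  have h2 : ((i : ℕ) + 1 : ℂ) ≠ 0 := by exact_mod_cast Nat.succ_ne_zero i
  exact mul_left_cancel₀ (div_ne_zero h2 (succ_ne_zero_complex ℓ)) h1

theorem kappa_zero_right (a Y : Vec ℓ) : kappa a Y 0 = 0 := by
  rw [kappa_comm, kappa, Matrix.mulVec_zero, Matrix.mulVec_zero]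

namespace IsFlatDiagonal

variable {t s : Vec ℓ → Vec ℓ} {d : Fin ℓ → ℝ}

theorem fderiv_s_t (h : IsFlatDiagonal hankel t s d) (z X' : Vec ℓ) :
    fderiv ℂ s (t z) (fderiv ℂ t z X') = X' := by
  have h1 : HasFDerivAt (s ∘ t) ((fderiv ℂ s (t z)).comp (fderiv ℂ t z)) z :=
    (h.holo_inv (t z)).hasFDerivAt.comp z (h.holo z).hasFDerivAt
  rw [show s ∘ t = id from funext h.left_inv] at h1
  exact congrArg (fun L : Vec ℓ →L[ℂ] Vec ℓ => L X') (h1.unique (hasFDerivAt_id z))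

theorem fderiv_t_s (h : IsFlatDiagonal hankel t s d) (z X' : Vec ℓ) :
    fderiv ℂ t z (fderiv ℂ s (t z) X') = X' := by
  have h1 : HasFDerivAt (t ∘ s) ((fderiv ℂ t (s (t z))).comp (fderiv ℂ s (t z))) (t z) :=
    (h.holo (s (t z))).hasFDerivAt.comp (t z) (h.holo_inv (t z)).hasFDerivAt
  rw [show t ∘ s = id from funext h.right_inv, h.left_inv] at h1
  exact congrArg (fun L : Vec ℓ →L[ℂ] Vec ℓ => L X') (h1.unique (hasFDerivAt_id (t z)))

theorem jac_mul_jac (h : IsFlatDiagonal hankel t s d) (z : Vec ℓ) :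
    jac t z * jac s (t z) = 1 :=
  matrix_eq_one_of_mulVec fun v => by
    rw [← Matrix.mulVec_mulVec, jac_mulVec, jac_mulVec, h.fderiv_t_s]

theorem isUnit_det_jac (h : IsFlatDiagonal hankel t s d) (z : Vec ℓ) : IsUnit (jac t z).det :=
  Matrix.isUnit_det_of_right_inverse (h.jac_mul_jac z)

theorem chartVec_eq (h : IsFlatDiagonal hankel t s d) (z : Vec ℓ) (α : Fin ℓ) :
    chartVec t z α = fderiv ℂ s (t z) (Pi.single α 1) := by
  rw [chartVec, Matrix.inv_eq_right_inv (h.jac_mul_jac z), jac_mulVec]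

theorem fderiv_t_chartVec (h : IsFlatDiagonal hankel t s d) (z : Vec ℓ) (α : Fin ℓ) :
    fderiv ℂ t z (chartVec t z α) = Pi.single α 1 := by
  rw [h.chartVec_eq, h.fderiv_t_s]

theorem fderiv_t_injective (h : IsFlatDiagonal hankel t s d) (z : Vec ℓ) {X' Y : Vec ℓ}
    (hXY : fderiv ℂ t z X' = fderiv ℂ t z Y) : X' = Y := by
  rw [← h.fderiv_s_t z X', hXY, h.fderiv_s_t]

theorem eq_sum_chartVec (h : IsFlatDiagonal hankel t s d) (z X' : Vec ℓ) :
    X' = ∑ α, fderiv ℂ t z X' α • chartVec t z α := by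
  apply h.fderiv_t_injective z
  simp only [map_sum, map_smul, h.fderiv_t_chartVec]
  ext β
  simp [Finset.sum_apply, Pi.single_apply]

variable (t s) in
/-- The constant contravariant Gram matrix in flat coordinates. -/
noncomputable def flatGram : Matrix (Fin ℓ) (Fin ℓ) ℂ := inCoords t s hankel 0

theorem inCoords_eq (h : IsFlatDiagonal hankel t s d) (τ : Vec ℓ) :
    inCoords t s hankel τ = flatGram t s := h.flat τ 0

theorem flatGram_eq (h : IsFlatDiagonal hankel t s d) (z : Vec ℓ) :
    flatGram t s = jac t z * hankel z * (jac t z).transpose := by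
  rw [← h.inCoords_eq (t z), inCoords, h.left_inv]

theorem isUnit_det_flatGram (h : IsFlatDiagonal hankel t s d) : IsUnit (flatGram t s).det := by
  rw [h.flatGram_eq 0, Matrix.det_mul, Matrix.det_mul, Matrix.det_transpose]
  exact ((h.isUnit_det_jac 0).mul (isUnit_det_hankel 0)).mul (h.isUnit_det_jac 0)

theorem flatGram_transpose (h : IsFlatDiagonal hankel t s d) :
    (flatGram t s).transpose = flatGram t s := by
  rw [h.flatGram_eq 0, Matrix.transpose_mul, Matrix.transpose_mul, Matrix.transpose_transpose,
    hankel_transpose, Matrix.mul_assoc]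

theorem lgMetric_eq_flat (h : IsFlatDiagonal hankel t s d) (z X' Y : Vec ℓ) :
    lgMetric z X' Y = fderiv ℂ t z X' ⬝ᵥ (flatGram t s)⁻¹.mulVec (fderiv ℂ t z Y) := by
  have hJ := h.isUnit_det_jac z
  have hJt : IsUnit (jac t z).transpose.det := by rwa [Matrix.det_transpose]
  rw [← jac_mulVec, ← jac_mulVec, h.flatGram_eq z, Matrix.mul_inv_rev, Matrix.mul_inv_rev,
    hankel_inv, Matrix.mulVec_mulVec, Matrix.mul_assoc, Matrix.mul_assoc,
    Matrix.nonsing_inv_mul _ hJ, Matrix.mul_one, Matrix.dotProduct_mulVec,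
    ← Matrix.vecMul_transpose, Matrix.vecMul_vecMul, ← Matrix.mul_assoc,
    Matrix.mul_nonsing_inv _ hJt, Matrix.one_mul, ← Matrix.dotProduct_mulVec,
    lgMetric_eq_dotProduct]

end IsFlatDiagonal

/-! ### The flat connection in flat coordinates -/

theorem differentiable_fderiv {n : ℕ} {f : Vec n → Vec n} (hf : Differentiable ℂ f) :
    Differentiable ℂ (fderiv ℂ f) :=
  ((contDiff_of_differentiable hf 2).fderiv_right (m := 1) (by norm_num)).differentiable
    (by norm_num)

theorem hasFDerivAt_fderiv_apply {n : ℕ} {f : Vec n → Vec n} (hf : Differentiable ℂ f)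
    (z Y : Vec n) :
    HasFDerivAt (fun w => fderiv ℂ f w Y) ((fderiv ℂ (fderiv ℂ f) z).flip Y) z := by
  have h := (differentiable_fderiv hf z).hasFDerivAt.clm_apply (hasFDerivAt_const Y z)
  simpa using h

theorem fderiv_fderiv_comm {n : ℕ} {f : Vec n → Vec n} (hf : Differentiable ℂ f)
    (z X' Y : Vec n) :
    fderiv ℂ (fderiv ℂ f) z X' Y = fderiv ℂ (fderiv ℂ f) z Y X' :=
  second_derivative_symmetric (fun y => (hf y).hasFDerivAt)
    (differentiable_fderiv hf z).hasFDerivAt X' Y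

theorem fderiv_dotProduct_mulVec {n : ℕ} {f g : Vec n → Vec n} {z : Vec n}
    (hf : DifferentiableAt ℂ f z) (hg : DifferentiableAt ℂ g z) (M : Matrix (Fin n) (Fin n) ℂ)
    (X' : Vec n) :
    fderiv ℂ (fun w => f w ⬝ᵥ M.mulVec (g w)) z X'
      = fderiv ℂ f z X' ⬝ᵥ M.mulVec (g z) + f z ⬝ᵥ M.mulVec (fderiv ℂ g z X') := by
  have h := fderiv_bilin (B := fun _ : Vec n => Matrix.toLinearMap₂' ℂ M) (z := z)
    (fun i j => differentiableAt_const _) hf hg X'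
  simpa [Matrix.toLinearMap₂'_apply'] using h

namespace IsFlatDiagonal

variable {t s : Vec ℓ → Vec ℓ} {d : Fin ℓ → ℝ}

/-- Uniqueness of the Levi-Civita connection: pulling back the trivial connection along `t` and
taking `∂ - κ` give two metric, torsion-free connections, and `S` is their difference. -/
theorem fderiv_fderiv_t (h : IsFlatDiagonal hankel t s d) (z X' Y : Vec ℓ) :
    fderiv ℂ (fderiv ℂ t) z X' Y = -fderiv ℂ t z (kappa z X' Y) := by
  set S : Vec ℓ → Vec ℓ → Vec ℓ := fun X' Y =>
    fderiv ℂ s (t z) (fderiv ℂ (fderiv ℂ t) z X' Y) + kappa z X' Y with hS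
  have hsymm : ∀ X' Y, S X' Y = S Y X' := fun X' Y => by
    simp only [hS, fderiv_fderiv_comm h.holo z X' Y, kappa_comm z X' Y]
  have hanti : ∀ X' Y Z, lgMetric z (S X' Y) Z = -lgMetric z (S X' Z) Y := by
    intro X' Y Z
    have h1 := fderiv_lgMetric z X' Y Z
    simp only [h.lgMetric_eq_flat] at h1
    rw [fderiv_dotProduct_mulVec (hasFDerivAt_fderiv_apply h.holo z Y).differentiableAt
      (hasFDerivAt_fderiv_apply h.holo z Z).differentiableAt,
      (hasFDerivAt_fderiv_apply h.holo z Y).fderiv,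
      (hasFDerivAt_fderiv_apply h.holo z Z).fderiv] at h1
    simp only [ContinuousLinearMap.flip_apply] at h1
    rw [← h.fderiv_t_s z (fderiv ℂ (fderiv ℂ t) z X' Y),
      ← h.fderiv_t_s z (fderiv ℂ (fderiv ℂ t) z X' Z), ← h.lgMetric_eq_flat,
      ← h.lgMetric_eq_flat, ← h.lgMetric_eq_flat, ← h.lgMetric_eq_flat] at h1
    simp only [hS, lgMetric_add_left]
    rw [lgMetric_comm z _ Y, lgMetric_comm z (kappa z X' Z) Y]
    linear_combination h1
  have hzero : ∀ X' Y Z, lgMetric z (S X' Y) Z = 0 := by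
    intro X' Y Z
    have e1 := hanti X' Y Z
    have e2 := hanti Z X' Y
    have e3 := hanti Y Z X'
    rw [hsymm X' Z] at e1
    rw [hsymm Z Y] at e2
    rw [hsymm Y X'] at e3
    linear_combination (e1 - e2 + e3) / 2
  have h0 : S X' Y = 0 := by
    apply eq_of_lgMetric z
    intro Z
    rw [hzero, ← lgBilin_apply, map_zero, LinearMap.zero_apply]
  have h2 := congrArg (fderiv ℂ t z) h0
  simp only [hS, map_add, map_zero, h.fderiv_t_s] at h2
  exact eq_neg_of_add_eq_zero_left h2

theorem differentiable_chartVec (h : IsFlatDiagonal hankel t s d) (α : Fin ℓ) :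
    Differentiable ℂ fun w => chartVec t w α := by
  simp only [h.chartVec_eq]
  intro z
  exact (hasFDerivAt_fderiv_apply h.holo_inv (t z) (Pi.single α 1)).differentiableAt.comp z
    (h.holo z)

theorem fderiv_chartVec (h : IsFlatDiagonal hankel t s d) (z X' : Vec ℓ) (α : Fin ℓ) :
    fderiv ℂ (fun w => chartVec t w α) z X' = kappa z X' (chartVec t z α) := by
  have h1 := (differentiable_fderiv h.holo z).hasFDerivAt.clm_apply
    (h.differentiable_chartVec α z).hasFDerivAt
  simp only [h.fderiv_t_chartVec] at h1
  have h2 := congrArg (fun L : Vec ℓ →L[ℂ] Vec ℓ => L X') (h1.unique (hasFDerivAt_const _ z))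
  simp only [add_apply, ContinuousLinearMap.comp_apply, ContinuousLinearMap.flip_apply,
    zero_apply, h.fderiv_fderiv_t] at h2
  exact h.fderiv_t_injective z (eq_of_sub_eq_zero (by rw [sub_eq_add_neg]; exact h2))

variable (t) in
/-- The components `c_{αβγ}` in the coordinates `t`. -/
noncomputable def cubic (z : Vec ℓ) (α β γ : Fin ℓ) : ℂ :=
  lgMetric z (lgMul z (chartVec t z α) (chartVec t z β)) (chartVec t z γ)

theorem cubic_comm (z : Vec ℓ) (α β γ : Fin ℓ) : cubic t z α β γ = cubic t z β α γ := by
  rw [cubic, lgMul_comm]; rfl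

theorem cubic_rotate (z : Vec ℓ) (α β γ : Fin ℓ) : cubic t z α β γ = cubic t z β γ α := by
  rw [cubic, lgMetric_lgMul_assoc, lgMetric_comm]; rfl

theorem cubic_swap (z : Vec ℓ) (α β γ : Fin ℓ) : cubic t z α β γ = cubic t z γ β α := by
  rw [cubic_comm, cubic_rotate z γ β α]

theorem differentiable_cubic (h : IsFlatDiagonal hankel t s d) (α β γ : Fin ℓ) :
    Differentiable ℂ fun z => cubic t z α β γ := fun z =>
  differentiableAt_lgMetric_fields
    (differentiableAt_lgMul_fields (h.differentiable_chartVec α z) (h.differentiable_chartVec β z))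
    (h.differentiable_chartVec γ z)

theorem fderiv_cubic (h : IsFlatDiagonal hankel t s d) (z X' : Vec ℓ) (α β γ : Fin ℓ) :
    fderiv ℂ (fun w => cubic t w α β γ) z X'
      = lgMetric z (nablaMul z X' (chartVec t z α) (chartVec t z β)) (chartVec t z γ) := by
  have hα := h.differentiable_chartVec α z
  have hβ := h.differentiable_chartVec β z
  have hγ := h.differentiable_chartVec γ z
  simp only [cubic]
  rw [fderiv_lgMetric_fields (differentiableAt_lgMul_fields hα hβ) hγ, fderiv_lgMetric,
    fderiv_lgMul_fields hα hβ, h.fderiv_chartVec, h.fderiv_chartVec, h.fderiv_chartVec, nablaMul]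
  simp only [lgMetric_add_left, lgMetric_sub_left]
  ring

/-- As `c` is symmetric, the index `γ` can be moved into the product, where `nablaMul_symm`
exchanges it with the direction of differentiation. -/
theorem fderiv_cubic_symm (h : IsFlatDiagonal hankel t s d) (z : Vec ℓ) (α β γ ξ : Fin ℓ) :
    fderiv ℂ (fun w => cubic t w α β γ) z (chartVec t z ξ)
      = fderiv ℂ (fun w => cubic t w α β ξ) z (chartVec t z γ) := by
  have e : ∀ γ ξ : Fin ℓ, fderiv ℂ (fun w => cubic t w α β γ) z (chartVec t z ξ)
      = lgMetric z (nablaMul z (chartVec t z ξ) (chartVec t z γ) (chartVec t z β))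
        (chartVec t z α) := by
    intro γ ξ
    simp only [fun w => cubic_swap (t := t) w α β γ]
    rw [h.fderiv_cubic]
  rw [e, e, nablaMul_symm]

/-! ### The spectrum of the Euler field -/

/-- This is `∇_α E = d_α ∂_α`, obtained by differentiating `dt(E) = d t` along `∂_α`. -/
theorem euler_chartVec (h : IsFlatDiagonal hankel t s d) (z : Vec ℓ) (α : Fin ℓ) :
    eulerField (chartVec t z α) - kappa z (chartVec t z α) (eulerField z)
      = (d α : ℂ) • chartVec t z α := by
  apply h.fderiv_t_injective z
  have h1 := (differentiable_fderiv h.holo z).hasFDerivAt.clm_apply (hasFDerivAt_eulerField z)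
  have h2 : HasFDerivAt (fun z => (fun α => (d α : ℂ) * t z α : Vec ℓ))
      (ContinuousLinearMap.pi fun α => (d α : ℂ) • (ContinuousLinearMap.proj α).comp
        (fderiv ℂ t z)) z := by
    rw [hasFDerivAt_pi]
    intro β
    exact (hasFDerivAt_pi'.1 (h.holo z).hasFDerivAt β).const_mul _
  simp only [h.euler] at h1
  have h3 := congrArg (fun L : Vec ℓ →L[ℂ] Vec ℓ => L (chartVec t z α)) (h1.unique h2)
  simp only [add_apply, ContinuousLinearMap.comp_apply, ContinuousLinearMap.flip_apply,
    h.fderiv_fderiv_t, eulerCLM_apply] at h3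
  rw [map_sub, sub_eq_add_neg, h3, map_smul, h.fderiv_t_chartVec]
  ext β
  simp only [ContinuousLinearMap.pi_apply, smul_apply, ContinuousLinearMap.comp_apply,
    h.fderiv_t_chartVec, ContinuousLinearMap.proj_apply, Pi.smul_apply, smul_eq_mul]
  by_cases hαβ : β = α
  · subst hαβ; simp
  · simp [hαβ]

theorem lieBracket_chartVec (h : IsFlatDiagonal hankel t s d) (z : Vec ℓ) (α : Fin ℓ) :
    VectorField.lieBracket ℂ eulerField (fun w => chartVec t w α) z
      = -(d α : ℂ) • chartVec t z α := by
  rw [lieBracket_euler, h.fderiv_chartVec, kappa_comm, neg_smul, ← h.euler_chartVec]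
  abel

/-- At the origin `E` vanishes, so `∂_α` is an eigenvector of its linear part with eigenvalue `d_α`,
and that linear part is invertible. This legitimates the factor `1/d_ρ` in the structure constants.
-/
theorem charge_ne_zero (h : IsFlatDiagonal hankel t s d) (α : Fin ℓ) : (d α : ℂ) ≠ 0 := by
  intro hd
  have h1 := h.euler_chartVec 0 α
  have h0 : eulerField (0 : Vec ℓ) = 0 := by ext i; simp [eulerField]
  rw [h0, kappa_zero_right, sub_zero, hd, zero_smul] at h1
  have h2 := h.fderiv_t_chartVec 0 α
  rw [euler_injective (h1.trans h0.symm), map_zero] at h2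
  have := congrFun h2 α
  simp at this

theorem flatGram_inv_apply (h : IsFlatDiagonal hankel t s d) (z : Vec ℓ) (α β : Fin ℓ) :
    lgMetric z (chartVec t z α) (chartVec t z β) = (flatGram t s)⁻¹ α β := by
  rw [h.lgMetric_eq_flat, h.fderiv_t_chartVec, h.fderiv_t_chartVec]
  simp

theorem charge_add (h : IsFlatDiagonal hankel t s d) (α β : Fin ℓ) :
    ((d α : ℂ) + d β - 1) * (flatGram t s)⁻¹ α β = 0 := by
  have h1 := euler_metric_fields (h.differentiable_chartVec α 0) (h.differentiable_chartVec β 0)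
  simp only [h.flatGram_inv_apply, h.lieBracket_chartVec, lgMetric_smul_left] at h1
  rw [lgMetric_comm, lgMetric_smul_left, lgMetric_comm, h.flatGram_inv_apply] at h1
  simp at h1
  linear_combination h1

/-- The relation `D H⁻¹ + H⁻¹ D = H⁻¹`, which is `L_E η = η`, is multiplied by `H` on both sides. -/
theorem charge_flatGram (h : IsFlatDiagonal hankel t s d) (α β : Fin ℓ) :
    ((d α : ℂ) + d β - 1) * flatGram t s α β = 0 := by
  set D : Matrix (Fin ℓ) (Fin ℓ) ℂ := Matrix.diagonal fun α => (d α : ℂ)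
  set H := flatGram t s
  have hH := h.isUnit_det_flatGram
  have h1 : D * H⁻¹ + H⁻¹ * D - H⁻¹ = 0 := by
    ext α β
    simp only [D, Matrix.sub_apply, Matrix.add_apply, Matrix.diagonal_mul, Matrix.mul_diagonal,
      Matrix.zero_apply]
    linear_combination h.charge_add α β
  have h2 : H * (D * H⁻¹ + H⁻¹ * D - H⁻¹) * H = H * D + D * H - H := by
    rw [Matrix.mul_sub, Matrix.mul_add, Matrix.sub_mul, Matrix.add_mul, ← Matrix.mul_assoc,
      ← Matrix.mul_assoc, Matrix.mul_nonsing_inv _ hH, Matrix.one_mul, Matrix.one_mul,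
      Matrix.mul_assoc (H * D), Matrix.nonsing_inv_mul _ hH, Matrix.mul_one]
  rw [h1, Matrix.mul_zero, Matrix.zero_mul] at h2
  have h3 := congrFun (congrFun h2 α) β
  simp only [D, Matrix.sub_apply, Matrix.add_apply, Matrix.diagonal_mul, Matrix.mul_diagonal,
      Matrix.zero_apply] at h3
  linear_combination -h3

theorem fderiv_cubic_euler (h : IsFlatDiagonal hankel t s d) (z : Vec ℓ) (α β γ : Fin ℓ) :
    fderiv ℂ (fun w => cubic t w α β γ) z (eulerField z)
      = (2 - d α - d β - d γ) * cubic t z α β γ := by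
  have hα := h.differentiable_chartVec α z
  have hβ := h.differentiable_chartVec β z
  have hγ := h.differentiable_chartVec γ z
  simp only [cubic]
  rw [euler_metric_fields (differentiableAt_lgMul_fields hα hβ) hγ, euler_mul_fields hα hβ,
    h.lieBracket_chartVec, h.lieBracket_chartVec, h.lieBracket_chartVec]
  simp only [← lgBilin_apply, ← lgMulBilin_apply, map_add, LinearMap.add_apply, map_smul,
    LinearMap.smul_apply, smul_eq_mul]
  ring

end IsFlatDiagonal

/-! ### The Frobenius manifold of superpotentials -/

theorem mem_carrier_lgData (n : Fin ℓ) (hn : (n : ℕ) + 1 = ℓ) (a : Vec ℓ) :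
    a ∈ (lgData ℓ).carrier ↔ a n ≠ 0 := by
  refine ⟨fun h => h n hn, fun h i hi => ?_⟩
  rwa [show i = n from Fin.ext (by omega)]

theorem isOpen_carrier_lgData (n : Fin ℓ) (hn : (n : ℕ) + 1 = ℓ) :
    IsOpen (lgData ℓ).carrier := by
  rw [show (lgData ℓ).carrier = {a | a n ≠ 0} from Set.ext (mem_carrier_lgData n hn)]
  exact isOpen_ne_fun (continuous_apply n) continuous_const

theorem lgData_unit (a : Vec ℓ) : (lgData ℓ).unit a = (hankel a).mulVec (unitForm a) := by
  rw [← lgGram_inv]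
  rfl

theorem differentiableOn_unit (n : Fin ℓ) (hn : (n : ℕ) + 1 = ℓ) :
    DifferentiableOn ℂ (lgData ℓ).unit (lgData ℓ).carrier := by
  intro a ha
  apply DifferentiableAt.differentiableWithinAt
  have e : (lgData ℓ).unit = fun a => fun i => -(a n)⁻¹ * hankel a i n := by
    ext a i
    rw [lgData_unit, unitForm_eq a n hn, Matrix.mulVec_smul, Matrix.mulVec_single_one]
    rfl
  rw [e, differentiableAt_pi]
  intro i
  have h1 : DifferentiableAt ℂ (fun a : Vec ℓ => a n) a := differentiableAt_apply n a
  exact (h1.fun_inv ((mem_carrier_lgData n hn a).1 ha)).neg.mul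
    (hasFDerivAt_hankel i n a).differentiableAt

theorem lgMul_unit (n : Fin ℓ) (hn : (n : ℕ) + 1 = ℓ) (a : Vec ℓ) (ha : a n ≠ 0) (Y : Vec ℓ) :
    lgMul a ((lgData ℓ).unit a) Y = Y := by
  apply (lgMul_eq_of_eq a (K := -C (a n)⁻¹ * toPoly Y) _).1
  rw [← dLam_eq, lgData_unit, dLam_unit a n hn ha]
  ring

theorem IsFlatDiagonal.isGenFrobenius_lgData {t s : Vec ℓ → Vec ℓ} {d : Fin ℓ → ℝ}
    (h : IsFlatDiagonal hankel t s d) (n : Fin ℓ) (hn : (n : ℕ) + 1 = ℓ) :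
    IsGenFrobenius (lgData ℓ) 1 where
  isOpen := isOpen_carrier_lgData n hn
  metric_holo X' Y := fun z _ => (by
    have := differentiableAt_lgMetric X' Y z
    simp only [lgBilin_apply] at this
    exact this.differentiableWithinAt)
  metric_form z _ := ⟨lgBilin z, ⟨fun X' Y => by
      simp only [lgBilin_apply]; exact lgMetric_comm z X' Y⟩,
    (LinearMap.IsRefl.nondegenerate_iff_separatingLeft (B := lgBilin z) (fun X' Y hXY => by
      rw [lgBilin_apply] at hXY ⊢; rw [lgMetric_comm, hXY])).2 fun X' hX => by
        apply eq_of_lgMetric z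
        intro Z
        rw [← lgBilin_apply, hX, ← lgBilin_apply, map_zero, LinearMap.zero_apply],
    fun X' Y => (lgBilin_apply z X' Y).symm⟩
  mul_holo X' Y := fun z _ => (differentiableAt_lgMul z X' Y).differentiableWithinAt
  mul_bilin z _ := ⟨lgMulBilin z, fun _ _ => (lgMulBilin_apply z _ _).symm⟩
  mul_comm z _ := lgMul_comm z
  mul_assoc z _ := lgMul_assoc z
  metric_mul z _ := lgMetric_lgMul_assoc z
  unit_holo := differentiableOn_unit n hn
  unit_mul z hz := lgMul_unit n hn z ((mem_carrier_lgData n hn z).1 hz)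
  euler_holo := fun z _ => (hasFDerivAt_eulerField z).differentiableAt.differentiableWithinAt
  flat z hz := ⟨(lgData ℓ).carrier, t, hz, subset_rfl,
    { isOpen := isOpen_carrier_lgData n hn
      holo := h.holo.differentiableOn
      inj := h.left_inv.injective.injOn
      nondeg := fun z _ => h.isUnit_det_jac z
      const := ⟨(IsFlatDiagonal.flatGram t s)⁻¹, fun z _ => h.flatGram_inv_apply z⟩ },
    fun w _ => h.fderiv_cubic_symm w, Matrix.diagonal fun α => (d α : ℂ), 0, fun w _ => by
      rw [jac_mulVec, add_zero]
      refine (h.euler w).trans (funext fun α => ?_)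
      rw [Matrix.mulVec_diagonal]⟩
  euler_mul Y Z hY hZ z hz := by
    have ho := (isOpen_carrier_lgData n hn).mem_nhds hz
    exact euler_mul_fields (hY.differentiableAt ho) (hZ.differentiableAt ho)
  euler_metric Y Z hY hZ z hz := by
    have ho := (isOpen_carrier_lgData n hn).mem_nhds hz
    rw [show (2 - 1 : ℂ) = 1 by norm_num, one_mul]
    exact euler_metric_fields (hY.differentiableAt ho) (hZ.differentiableAt ho)

theorem eval_dLam_unit (n : Fin ℓ) (hn : (n : ℕ) + 1 = ℓ) (a : Vec ℓ) (ha : a n ≠ 0) {q : ℂ}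
    (hq : (dpLam a).IsRoot q) : (dLam ((lgData ℓ).unit a)).eval q = 1 := by
  rw [lgData_unit, dLam_unit a n hn ha, eval_sub, eval_mul, hq.eq_zero, mul_zero, sub_zero, eval_one]

theorem eval_dLam_euler (a : Vec ℓ) {q : ℂ} (hq : (dpLam a).IsRoot q) :
    (dLam ((lgData ℓ).euler a)).eval q = (superpotential a).eval q := by
  rw [show (lgData ℓ).euler a = eulerField a from rfl, dLam_euler, eval_sub, eval_mul, eval_mul,
    hq.eq_zero, mul_zero, mul_zero, sub_zero]

/-! ### The contravariant Levi-Civita connection -/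

/-- A metric-compatible and torsion-free contravariant connection is the Levi-Civita one. -/
theorem eq_neg_sum_christoffel {n : ℕ} {g : Vec n → Matrix (Fin n) (Fin n) ℂ} {z : Vec n}
    (hg : ∀ i j, DifferentiableAt ℂ (fun w => g w i j) z) (hsymm : (g z).transpose = g z)
    (hu : IsUnit (g z).det)
    {Γ : Fin n → Fin n → Fin n → ℂ}
    (hcompat : ∀ i j k, pd (fun w => g w i j) z k = Γ i j k + Γ j i k)
    (htors : ∀ i j k, ∑ r, g z i r * Γ j k r = ∑ r, g z j r * Γ i k r) (i j k : Fin n) :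
    Γ i j k = -∑ r, g z i r * christoffel (fun w => (g w)⁻¹) z j r k := by
  set G := (g z)⁻¹ with hG
  have hGs : G.transpose = G := by rw [hG, Matrix.transpose_nonsing_inv, hsymm]
  set M : Fin n → Matrix (Fin n) (Fin n) ℂ := fun k => Matrix.of fun i j => Γ i j k with hM
  set L : Fin n → Matrix (Fin n) (Fin n) ℂ := fun k => G * M k * G with hL
  have hgG : g z * G = 1 := Matrix.mul_nonsing_inv _ hu
  have hGg : G * g z = 1 := Matrix.nonsing_inv_mul _ hu
  have hpd : ∀ a b k, pd (fun w => (g w)⁻¹ a b) z k = -(L k a b + L k b a) := by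
    intro a b k
    have h1 := matDeriv_inv hg hu (Pi.single k 1)
    have h2 : matDeriv g z (Pi.single k 1) = M k + (M k).transpose := by
      ext i j
      exact hcompat i j k
    have h3 : (L k).transpose = G * (M k).transpose * G := by
      simp only [hL, Matrix.transpose_mul, hGs, Matrix.mul_assoc]
    rw [h2, Matrix.mul_add, Matrix.add_mul, ← hG, ← h3] at h1
    exact congrFun (congrFun h1 a) b
  -- The torsion condition, with indices lowered, makes `L` symmetric in the direction of
  -- differentiation and the first index. Hence four of the six terms in the Christoffel symbol
  -- cancel.
  have hLs : ∀ a b c, L b a c = L a b c := by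
    have h1 : ∀ k a b, ∑ j, G a j * Γ j k b = ∑ j, G b j * Γ j k a := by
      intro k a b
      set N : Matrix (Fin n) (Fin n) ℂ := Matrix.of fun j r => Γ j k r with hN
      have h2 : (N * g z).transpose = N * g z := by
        ext i j
        rw [Matrix.transpose_apply, Matrix.mul_apply, Matrix.mul_apply]
        have e := htors i j k
        have hs : ∀ p q, g z p q = g z q p := fun p q => congrFun (congrFun hsymm.symm p) q
        simp only [hN, Matrix.of_apply]
        rw [Finset.sum_congr rfl fun r _ => by rw [hs r i, mul_comm], e]
        exact Finset.sum_congr rfl fun r _ => by rw [hs j r, mul_comm]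
      have h3 : (G * N).transpose = G * N := by
        have h4 : G * N = G * (N * g z) * G := by
          rw [Matrix.mul_assoc G, Matrix.mul_assoc N, hgG, Matrix.mul_one]
        rw [h4, Matrix.transpose_mul, Matrix.transpose_mul, h2, hGs, Matrix.mul_assoc G (N * g z)]
      exact congrFun (congrFun h3.symm a) b
    intro a b c
    simp only [hL, Matrix.mul_apply, hM, Matrix.of_apply]
    exact Finset.sum_congr rfl fun k _ => by rw [h1 k a b]
  have hchr : ∀ r, christoffel (fun w => (g w)⁻¹) z j r k = -∑ m, g z j m * L k r m := by
    intro r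
    rw [christoffel, Finset.mul_sum, ← Finset.sum_neg_distrib]
    refine Finset.sum_congr rfl fun m _ => ?_
    rw [Matrix.nonsing_inv_nonsing_inv _ hu, hpd, hpd, hpd, hLs m r k, hLs m k r, hLs k r m]
    ring
  have hfin : M k = g z * L k * g z := by
    simp only [hL, ← Matrix.mul_assoc, hgG, Matrix.one_mul]
    rw [Matrix.mul_assoc, hGg, Matrix.mul_one]
  have h5 := congrFun (congrFun hfin i) j
  rw [Matrix.mul_assoc, Matrix.mul_apply] at h5
  change Γ i j k = _ at h5
  rw [h5, ← Finset.sum_neg_distrib]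
  refine Finset.sum_congr rfl fun r _ => ?_
  rw [hchr, mul_neg, neg_neg, Matrix.mul_apply]
  congr 1
  refine Finset.sum_congr rfl fun m _ => ?_
  rw [mul_comm, show g z m j = g z j m from congrFun (congrFun hsymm.symm m) j]

/-- An entire function that vanishes wherever another one does not is zero, unless the latter is
zero. -/
theorem eq_zero_of_mul_eq_zero_of_differentiable {n : ℕ} {f D : Vec n → ℂ}
    (hf : Differentiable ℂ f) (hD : Differentiable ℂ D) (h : ∀ z, D z ≠ 0 → f z = 0) {z₀ : Vec n}
    (h₀ : D z₀ ≠ 0) (z : Vec n) : f z = 0 := by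
  have hline : Differentiable ℂ fun ζ : ℂ => z₀ + ζ • (z - z₀) := by fun_prop
  have hfl : Differentiable ℂ fun ζ : ℂ => f (z₀ + ζ • (z - z₀)) := hf.comp hline
  have hDl : Continuous fun ζ : ℂ => D (z₀ + ζ • (z - z₀)) := (hD.comp hline).continuous
  have hev : (fun ζ : ℂ => f (z₀ + ζ • (z - z₀))) =ᶠ[nhds 0] fun _ => 0 := by
    have h1 : ∀ᶠ ζ in nhds (0 : ℂ), D (z₀ + ζ • (z - z₀)) ≠ 0 :=
      hDl.continuousAt.eventually_ne (by simpa using h₀)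
    filter_upwards [h1] with ζ hζ
    exact h _ hζ
  have h2 := AnalyticOnNhd.eq_of_eventuallyEq
    (f := fun ζ : ℂ => f (z₀ + ζ • (z - z₀))) (g := fun _ => 0)
    (fun ζ _ => hfl.analyticAt ζ) (fun ζ _ => analyticAt_const) hev
  have h3 := congrFun h2 1
  simpa using h3

/-- The extension is unique by the identity theorem on complex lines through one point where `det g`
does not vanish. -/
theorem IsContraLeviCivita.unique {n : ℕ} {g : Vec n → Matrix (Fin n) (Fin n) ℂ}
    {Γ Γ' : Vec n → Fin n → Fin n → Fin n → ℂ} (h : IsContraLeviCivita g Γ)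
    (h' : IsContraLeviCivita g Γ') (hg : ∀ i j, Differentiable ℂ fun z => g z i j) {z₀ : Vec n}
    (h₀ : IsUnit (g z₀).det) : Γ = Γ' := by
  funext z i j k
  have := eq_zero_of_mul_eq_zero_of_differentiable (f := fun z => Γ z i j k - Γ' z i j k)
    (D := fun z => (g z).det) ((h.1 i j k).sub (h'.1 i j k))
    (fun z => differentiableAt_det fun i j => hg i j z) (fun z hz => by
      have hu := isUnit_iff_ne_zero.2 hz
      rw [h.2 z hu, h'.2 z hu, sub_self]) h₀.ne_zero z
  exact sub_eq_zero.1 this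

/-- A point where the intersection form is nondegenerate: `Λ = p^{ℓ+1} + p`, with explicit Bézout
coefficients. -/
theorem isCoprime_superpotential_single (n : Fin ℓ) (hn : (n : ℕ) + 1 = ℓ) :
    IsCoprime (superpotential (Pi.single n 1 : Vec ℓ)) (dpLam (Pi.single n 1 : Vec ℓ)) := by
  have hN := succ_ne_zero_complex ℓ
  have hl : (ℓ : ℂ) ≠ 0 := by exact_mod_cast (by omega : ℓ ≠ 0)
  have h1 : superpotential (Pi.single n 1 : Vec ℓ) = X ^ (ℓ + 1) + X := by
    rw [superpotential, dLam_eq, toPoly_single, show ℓ - 1 - (n : ℕ) = 0 by omega, pow_zero, mul_one]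
  have h2 : dpLam (Pi.single n 1 : Vec ℓ) = C (ℓ + 1 : ℂ) * X ^ ℓ + 1 := by
    rw [dpLam, h1, derivative_add, derivative_X, derivative_X_pow]
    simp
  rw [h1, h2]
  obtain ⟨m, rfl⟩ : ∃ m, ℓ = m + 1 := ⟨n, hn.symm⟩
  refine ⟨-C (((m + 1 : ℕ) : ℂ) + 1) ^ 2 * C (((m + 1 : ℕ) : ℂ)⁻¹) * X ^ m,
    1 + C (((m + 1 : ℕ) : ℂ) + 1) * C (((m + 1 : ℕ) : ℂ)⁻¹) * X ^ (m + 1), ?_⟩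
  have h3 : C ((m + 1 : ℕ) : ℂ) * C (((m + 1 : ℕ) : ℂ)⁻¹) = 1 := by
    rw [← C_mul, mul_inv_cancel₀ hl, C_1]
  rw [C_add, C_1]
  linear_combination (-(C ((m + 1 : ℕ) : ℂ) + 1) * X ^ (m + 1)) * h3

/-! ### The connection of the intersection form in flat coordinates -/

namespace IsFlatDiagonal

variable {t s : Vec ℓ → Vec ℓ} {d : Fin ℓ → ℝ}

variable (t) in
/-- The gradient of the flat coordinate `t^α`. -/
noncomputable def gradVec (z : Vec ℓ) (α : Fin ℓ) : Vec ℓ := (hankel z).mulVec (jac t z α)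

theorem lgMetric_gradVec (z X' : Vec ℓ) (α : Fin ℓ) :
    lgMetric z X' (gradVec t z α) = fderiv ℂ t z X' α := by
  rw [gradVec, lgMetric_hankel, ← jac_mulVec, dotProduct_comm]
  rfl

theorem gradVec_eq_sum (h : IsFlatDiagonal hankel t s d) (z : Vec ℓ) (α : Fin ℓ) :
    gradVec t z α = ∑ ν, flatGram t s α ν • chartVec t z ν := by
  conv_lhs => rw [h.eq_sum_chartVec z (gradVec t z α)]
  refine Finset.sum_congr rfl fun ν _ => ?_
  congr 1
  rw [← jac_mulVec, gradVec, Matrix.mulVec_mulVec]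
  have h1 := congrFun (congrFun (h.flatGram_eq z) ν) α
  rw [← h.flatGram_transpose, Matrix.transpose_apply, h1, Matrix.mul_apply]
  rfl

theorem chartVec_eq_sum (h : IsFlatDiagonal hankel t s d) (z : Vec ℓ) (α : Fin ℓ) :
    chartVec t z α = ∑ ν, (flatGram t s)⁻¹ α ν • gradVec t z ν := by
  simp only [h.gradVec_eq_sum, Finset.smul_sum, smul_smul]
  rw [Finset.sum_comm]
  simp only [← Finset.sum_smul, ← Matrix.mul_apply,
    Matrix.nonsing_inv_mul _ h.isUnit_det_flatGram, Matrix.one_apply]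
  simp

theorem sum_lgMetric_gradVec (h : IsFlatDiagonal hankel t s d) (z X' Y : Vec ℓ) :
    ∑ ε, lgMetric z X' (gradVec t z ε) * lgMetric z Y (chartVec t z ε) = lgMetric z X' Y := by
  simp only [lgMetric_gradVec]
  conv_rhs => rw [h.eq_sum_chartVec z X', ← lgBilin_apply, map_sum, LinearMap.sum_apply]
  refine Finset.sum_congr rfl fun ε _ => ?_
  rw [map_smul, LinearMap.smul_apply, lgBilin_apply, smul_eq_mul, lgMetric_comm]

variable (t) in
/-- The components `c^{αβ}_γ` in the coordinates `t`. -/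
noncomputable def cubicUp (z : Vec ℓ) (α β γ : Fin ℓ) : ℂ :=
  lgMetric z (lgMul z (gradVec t z α) (gradVec t z β)) (chartVec t z γ)

theorem cubicUp_comm (z : Vec ℓ) (α β γ : Fin ℓ) : cubicUp t z α β γ = cubicUp t z β α γ := by
  rw [cubicUp, lgMul_comm]; rfl

theorem cubicUp_eq (h : IsFlatDiagonal hankel t s d) (z : Vec ℓ) (α β γ : Fin ℓ) :
    cubicUp t z α β γ
      = ∑ ν, ∑ ρ, flatGram t s α ν * flatGram t s β ρ * cubic t z ν ρ γ := by
  rw [cubicUp, h.gradVec_eq_sum, h.gradVec_eq_sum]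
  simp only [cubic, ← lgBilin_apply, ← lgMulBilin_apply, map_sum, map_smul, LinearMap.sum_apply,
    LinearMap.smul_apply, smul_eq_mul, Finset.mul_sum]
  rw [Finset.sum_comm]
  exact Finset.sum_congr rfl fun ν _ => Finset.sum_congr rfl fun ρ _ => by ring

theorem cubic_eq (h : IsFlatDiagonal hankel t s d) (z : Vec ℓ) (α β γ : Fin ℓ) :
    cubic t z α β γ
      = ∑ ν, ∑ ρ, (flatGram t s)⁻¹ α ν * (flatGram t s)⁻¹ β ρ * cubicUp t z ν ρ γ := by
  rw [cubic, h.chartVec_eq_sum z α, h.chartVec_eq_sum z β]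
  simp only [cubicUp, ← lgBilin_apply, ← lgMulBilin_apply, map_sum, map_smul, LinearMap.sum_apply,
    LinearMap.smul_apply, smul_eq_mul, Finset.mul_sum]
  rw [Finset.sum_comm]
  exact Finset.sum_congr rfl fun ν _ => Finset.sum_congr rfl fun ρ _ => by ring

variable (t s d) in
/-- The contravariant Christoffel symbols of the intersection form in flat coordinates. -/
noncomputable def contraGamma (τ : Vec ℓ) (α β γ : Fin ℓ) : ℂ := d β * cubicUp t (s τ) α β γ

theorem inCoords_intersectionForm (z : Vec ℓ) (h : IsFlatDiagonal hankel t s d) (α β : Fin ℓ) :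
    inCoords t s (lgData ℓ).intersectionForm (t z) α β
      = lgMetric z (lgMul z (eulerField z) (gradVec t z α)) (gradVec t z β) := by
  have e : inCoords t s (lgData ℓ).intersectionForm (t z) α β
      = jac t z α ⬝ᵥ ((lgData ℓ).intersectionForm z).mulVec (jac t z β) := by
    rw [inCoords, h.left_inv, Matrix.mul_assoc]
    rfl
  rw [e, intersectionForm_dotProduct, lgMetric_gradVec, ← jac_mulVec, dotProduct_comm]
  rfl

theorem eulerField_eq_sum (h : IsFlatDiagonal hankel t s d) (z : Vec ℓ) :
    eulerField z = ∑ ε, ((d ε : ℂ) * t z ε) • chartVec t z ε := by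
  conv_lhs => rw [h.eq_sum_chartVec z (eulerField z), h.euler]

theorem inCoords_intersectionForm_eq_sum (h : IsFlatDiagonal hankel t s d) (τ : Vec ℓ)
    (α β : Fin ℓ) :
    inCoords t s (lgData ℓ).intersectionForm τ α β
      = ∑ ε, (d ε : ℂ) * τ ε * cubicUp t (s τ) α β ε := by
  obtain ⟨z, rfl⟩ : ∃ z, τ = t z := ⟨s τ, (h.right_inv τ).symm⟩
  rw [h.inCoords_intersectionForm, h.eulerField_eq_sum, h.left_inv]
  simp only [cubicUp]
  simp only [← lgMulBilin_apply, ← lgBilin_apply, map_sum, map_smul, LinearMap.sum_apply,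
    LinearMap.smul_apply, smul_eq_mul]
  refine Finset.sum_congr rfl fun ε _ => ?_
  simp only [lgMulBilin_apply, lgBilin_apply]
  rw [lgMetric_lgMul_assoc, lgMetric_comm]

theorem inCoords_intersectionForm_symm (τ : Vec ℓ) :
    (inCoords t s (lgData ℓ).intersectionForm τ).transpose
      = inCoords t s (lgData ℓ).intersectionForm τ := by
  rw [inCoords, Matrix.transpose_mul, Matrix.transpose_mul, Matrix.transpose_transpose,
    intersectionForm_symm, Matrix.mul_assoc]

theorem hasFDerivAt_cubic_comp (h : IsFlatDiagonal hankel t s d) (τ : Vec ℓ) (α β γ : Fin ℓ) :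
    HasFDerivAt (fun τ => cubic t (s τ) α β γ)
      ((fderiv ℂ (fun w => cubic t w α β γ) (s τ)).comp (fderiv ℂ s τ)) τ :=
  (h.differentiable_cubic α β γ (s τ)).hasFDerivAt.comp τ (h.holo_inv τ).hasFDerivAt

theorem differentiable_cubicUp_comp (h : IsFlatDiagonal hankel t s d) (α β γ : Fin ℓ) :
    Differentiable ℂ fun τ => cubicUp t (s τ) α β γ := by
  simp only [h.cubicUp_eq]
  intro τ
  apply DifferentiableAt.fun_sum
  intro ν _
  apply DifferentiableAt.fun_sum
  intro ρ _
  exact (h.hasFDerivAt_cubic_comp τ ν ρ γ).differentiableAt.const_mul _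

theorem differentiable_inCoords (h : IsFlatDiagonal hankel t s d) (α β : Fin ℓ) :
    Differentiable ℂ fun τ => inCoords t s (lgData ℓ).intersectionForm τ α β := by
  simp only [h.inCoords_intersectionForm_eq_sum]
  intro τ
  apply DifferentiableAt.fun_sum
  intro ε _
  exact ((differentiableAt_apply ε τ).const_mul _).mul (h.differentiable_cubicUp_comp α β ε τ)

theorem one_sub_charge_mul (h : IsFlatDiagonal hankel t s d) (α β : Fin ℓ) :
    flatGram t s α β * (1 - d β) = d α * flatGram t s α β := by
  linear_combination -h.charge_flatGram α β

/-- Metric compatibility. In `g^{αβ} = E^ε c^{αβ}_ε` the derivative of `E` gives `d_γ c^{αβ}_γ`, and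
the symmetry of `∂c` turns the rest into `E(c^{αβ}_γ)`. Homogeneity makes the total weight `(1 -
d_ν) + (1 - d_ρ)` on the lowered indices, and raising them changes this to `d_α + d_β`. -/
theorem pd_inCoords (h : IsFlatDiagonal hankel t s d) (τ : Vec ℓ) (α β γ : Fin ℓ) :
    pd (fun τ => inCoords t s (lgData ℓ).intersectionForm τ α β) τ γ
      = contraGamma t s d τ α β γ + contraGamma t s d τ β α γ := by
  obtain ⟨z, rfl⟩ : ∃ z, τ = t z := ⟨s τ, (h.right_inv τ).symm⟩
  have hcub : ∀ ν ρ ε, fderiv ℂ (fun τ => cubic t (s τ) ν ρ ε) (t z) (Pi.single γ 1)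
      = fderiv ℂ (fun w => cubic t w ν ρ γ) z (chartVec t z ε) := by
    intro ν ρ ε
    rw [(h.hasFDerivAt_cubic_comp _ ν ρ ε).fderiv, ContinuousLinearMap.comp_apply,
      ← h.chartVec_eq, h.left_inv, h.fderiv_cubic_symm]
  have hup : ∀ ε, fderiv ℂ (fun τ => cubicUp t (s τ) α β ε) (t z) (Pi.single γ 1)
      = ∑ ν, ∑ ρ, flatGram t s α ν * flatGram t s β ρ
        * fderiv ℂ (fun w => cubic t w ν ρ γ) z (chartVec t z ε) := by
    intro ε
    have h1 : HasFDerivAt (fun τ => cubicUp t (s τ) α β ε)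
        (∑ ν, ∑ ρ, (flatGram t s α ν * flatGram t s β ρ) •
          fderiv ℂ (fun τ => cubic t (s τ) ν ρ ε) (t z)) (t z) := by
      simp only [h.cubicUp_eq]
      apply HasFDerivAt.fun_sum
      intro ν _
      apply HasFDerivAt.fun_sum
      intro ρ _
      exact (h.hasFDerivAt_cubic_comp _ ν ρ ε).differentiableAt.hasFDerivAt.const_mul _
    rw [h1.fderiv]
    simp only [FunLike.coe_sum, Finset.sum_apply, smul_apply, smul_eq_mul, hcub]
  have h2 : HasFDerivAt (fun τ => inCoords t s (lgData ℓ).intersectionForm τ α β)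
      (∑ ε, (((d ε : ℂ) * t z ε) • fderiv ℂ (fun τ => cubicUp t (s τ) α β ε) (t z)
        + cubicUp t (s (t z)) α β ε • ((d ε : ℂ) • ContinuousLinearMap.proj ε))) (t z) := by
    simp only [h.inCoords_intersectionForm_eq_sum]
    apply HasFDerivAt.fun_sum
    intro ε _
    exact ((hasFDerivAt_apply ε (t z)).const_mul _).mul
      (h.differentiable_cubicUp_comp α β ε (t z)).hasFDerivAt
  rw [pd, h2.fderiv]
  simp only [FunLike.coe_sum, Finset.sum_apply, smul_apply, smul_eq_mul, add_apply, hup,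
    ContinuousLinearMap.proj_apply, h.left_inv z, Finset.sum_add_distrib, contraGamma]
  have h3 : ∑ ε, (d ε : ℂ) * t z ε * ∑ ν, ∑ ρ, flatGram t s α ν * flatGram t s β ρ
        * fderiv ℂ (fun w => cubic t w ν ρ γ) z (chartVec t z ε)
      = ∑ ν, ∑ ρ, flatGram t s α ν * flatGram t s β ρ
        * fderiv ℂ (fun w => cubic t w ν ρ γ) z (eulerField z) := by
    rw [h.eulerField_eq_sum]
    simp only [map_sum, map_smul, smul_eq_mul, Finset.mul_sum]
    rw [Finset.sum_comm]
    refine Finset.sum_congr rfl fun ν _ => ?_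
    rw [Finset.sum_comm]
    exact Finset.sum_congr rfl fun ρ _ => Finset.sum_congr rfl fun ε _ => by ring
  have h4 : ∑ ε, cubicUp t z α β ε * ((d ε : ℂ) * (Pi.single γ 1 : Vec ℓ) ε)
      = d γ * cubicUp t z α β γ := by
    rw [Finset.sum_eq_single γ]
    · simp [mul_comm]
    · intro ε _ hε; simp [Pi.single_eq_of_ne hε]
    · simp
  rw [h3, h4, cubicUp_comm z β α, ← add_mul, h.cubicUp_eq, Finset.mul_sum, Finset.mul_sum,
    ← Finset.sum_add_distrib]
  refine Finset.sum_congr rfl fun ν _ => ?_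
  rw [Finset.mul_sum, Finset.mul_sum, ← Finset.sum_add_distrib]
  refine Finset.sum_congr rfl fun ρ _ => ?_
  rw [h.fderiv_cubic_euler]
  linear_combination cubic t z ν ρ γ * (flatGram t s β ρ * h.one_sub_charge_mul α ν
    + flatGram t s α ν * h.one_sub_charge_mul β ρ)

/-- Both sides equal `d_γ η(E, dt^α · dt^β · dt^γ)`, by associativity and commutativity. -/
theorem contraGamma_torsion (h : IsFlatDiagonal hankel t s d) (τ : Vec ℓ) (α β γ : Fin ℓ) :
    ∑ ε, inCoords t s (lgData ℓ).intersectionForm τ α ε * contraGamma t s d τ β γ ε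
      = ∑ ε, inCoords t s (lgData ℓ).intersectionForm τ β ε * contraGamma t s d τ α γ ε := by
  obtain ⟨z, rfl⟩ : ∃ z, τ = t z := ⟨s τ, (h.right_inv τ).symm⟩
  have e : ∀ α β, ∑ ε, inCoords t s (lgData ℓ).intersectionForm (t z) α ε
      * contraGamma t s d (t z) β γ ε = d γ * lgMetric z (eulerField z)
        (lgMul z (lgMul z (gradVec t z α) (gradVec t z β)) (gradVec t z γ)) := by
    intro α β
    rw [lgMul_assoc, ← lgMetric_lgMul_assoc, ← h.sum_lgMetric_gradVec z _ (lgMul z _ _),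
      Finset.mul_sum]
    refine Finset.sum_congr rfl fun ε _ => ?_
    rw [h.inCoords_intersectionForm, contraGamma, cubicUp, h.left_inv]
    ring
  rw [e, e, lgMul_comm z (gradVec t z α)]

theorem isContraLeviCivita (h : IsFlatDiagonal hankel t s d) :
    IsContraLeviCivita (inCoords t s (lgData ℓ).intersectionForm) (contraGamma t s d) :=
  ⟨fun i j k => (h.differentiable_cubicUp_comp i j k).const_mul _, fun τ hτ =>
    eq_neg_sum_christoffel (fun i j => h.differentiable_inCoords i j τ)
      (inCoords_intersectionForm_symm τ) hτ (h.pd_inCoords τ) (h.contraGamma_torsion τ)⟩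

theorem isUnit_det_inCoords (h : IsFlatDiagonal hankel t s d) (n : Fin ℓ) (hn : (n : ℕ) + 1 = ℓ) :
    IsUnit (inCoords t s (lgData ℓ).intersectionForm (t (Pi.single n 1))).det := by
  rw [inCoords, h.left_inv, Matrix.det_mul, Matrix.det_mul, Matrix.det_transpose]
  exact ((h.isUnit_det_jac _).mul (Matrix.isUnit_det_of_left_inverse
    (lgIntersectionGram_mul _ (isCoprime_superpotential_single n hn)))).mul (h.isUnit_det_jac _)

theorem eq_contraGamma (h : IsFlatDiagonal hankel t s d) (n : Fin ℓ) (hn : (n : ℕ) + 1 = ℓ)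
    {Γ : Vec ℓ → Fin ℓ → Fin ℓ → Fin ℓ → ℂ}
    (hΓ : IsContraLeviCivita (inCoords t s (lgData ℓ).intersectionForm) Γ) :
    Γ = contraGamma t s d :=
  hΓ.unique h.isContraLeviCivita h.differentiable_inCoords (h.isUnit_det_inCoords n hn)

theorem structureConst_eq (h : IsFlatDiagonal hankel t s d) (z : Vec ℓ) (α β γ : Fin ℓ) :
    structureConst (inCoords t s hankel (t z)) d (contraGamma t s d (t z)) α β γ
      = fderiv ℂ t z (lgMul z (chartVec t z α) (chartVec t z β)) γ := by
  have h1 : ∀ ν ρ ζ, 1 / (d ρ : ℂ) * (flatGram t s)⁻¹ α ν * (flatGram t s)⁻¹ β ρ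
      * flatGram t s γ ζ * contraGamma t s d (t z) ν ρ ζ = flatGram t s γ ζ *
        ((flatGram t s)⁻¹ α ν * (flatGram t s)⁻¹ β ρ * cubicUp t z ν ρ ζ) := by
    intro ν ρ ζ
    have := h.charge_ne_zero ρ
    rw [contraGamma, h.left_inv]
    field_simp
  rw [structureConst, h.inCoords_eq]
  simp only [h1]
  rw [← lgMetric_gradVec, h.gradVec_eq_sum]
  simp only [← lgBilin_apply, map_sum, map_smul, smul_eq_mul]
  simp only [lgBilin_apply]
  have h2 : ∀ ν, ∑ ρ, ∑ ζ, flatGram t s γ ζ *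
        ((flatGram t s)⁻¹ α ν * (flatGram t s)⁻¹ β ρ * cubicUp t z ν ρ ζ)
      = ∑ ζ, ∑ ρ, flatGram t s γ ζ *
        ((flatGram t s)⁻¹ α ν * (flatGram t s)⁻¹ β ρ * cubicUp t z ν ρ ζ) :=
    fun ν => Finset.sum_comm
  simp only [h2]
  rw [Finset.sum_comm]
  refine Finset.sum_congr rfl fun ζ _ => ?_
  rw [← cubic, h.cubic_eq]
  simp only [Finset.mul_sum]

/-- The Hankel determinant never vanishes, so the first condition on the carrier is automatic; and
`Γ = d_β c^{αβ}_γ` divided by `d_β`, with indices moved, is the product itself. All claims about the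
orbit space thereby become claims about superpotentials, for every choice of flat coordinates. -/
theorem orbitData_eq (h : IsFlatDiagonal hankel t s d) :
    orbitData hankel t s d (contraGamma t s d) = lgData ℓ := by
  have hcar : {z : Vec ℓ | (hankel z).det ≠ 0 ∧ ∀ i : Fin ℓ, (i : ℕ) + 1 = ℓ → z i ≠ 0}
      = {z | ∀ i : Fin ℓ, (i : ℕ) + 1 = ℓ → z i ≠ 0} :=
    Set.ext fun z => and_iff_right (isUnit_det_hankel z).ne_zero
  have hmet : (fun z X' Y : Vec ℓ => X' ⬝ᵥ (hankel z)⁻¹.mulVec Y) = lgMetric := by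
    funext z X' Y
    rw [hankel_inv, lgMetric_eq_dotProduct]
  have hmul : (fun z X' Y : Vec ℓ => fderiv ℂ s (t z) fun γ => ∑ α, ∑ β,
      structureConst (inCoords t s hankel (t z)) d (contraGamma t s d (t z)) α β γ *
        fderiv ℂ t z X' α * fderiv ℂ t z Y β) = lgMul := by
    funext z X' Y
    rw [← h.fderiv_s_t z (lgMul z X' Y)]
    congr 1
    funext γ
    conv_rhs => rw [h.eq_sum_chartVec z X', h.eq_sum_chartVec z Y]
    simp only [← lgMulBilin_apply, map_sum, map_smul, LinearMap.sum_apply, LinearMap.smul_apply,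
      Finset.sum_apply, Pi.smul_apply, smul_eq_mul, Finset.mul_sum]
    rw [Finset.sum_comm]
    refine Finset.sum_congr rfl fun β _ => Finset.sum_congr rfl fun α _ => ?_
    rw [h.structureConst_eq, lgMulBilin_apply]
    ring
  have hunit : (fun z : Vec ℓ => (hankel z).mulVec (unitForm z))
      = fun a => (lgGram a)⁻¹.mulVec (unitForm a) := by
    funext z
    rw [lgGram_inv]
  rw [orbitData, hcar, hmet, hmul, hunit]
  rfl

end IsFlatDiagonal

/-! ### The comparison maps -/

/-- The linear map `y ↦ a`. -/
noncomputable def hMapCLM (ε : ℂ) : Vec ℓ →L[ℂ] Vec ℓ :=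
  LinearMap.toContinuousLinearMap
    { toFun := hMap ε, map_add' := hMap_add ε, map_smul' := fun c v => hMap_smul ε c v }

theorem hasFDerivAt_hMap (ε : ℂ) (z : Vec ℓ) : HasFDerivAt (hMap ε) (hMapCLM ε) z :=
  (hMapCLM ε).hasFDerivAt

theorem fderiv_hMap (ε : ℂ) (z X' : Vec ℓ) : fderiv ℂ (hMap ε) z X' = hMap ε X' := by
  rw [(hasFDerivAt_hMap ε z).fderiv]
  rfl

/-- The scaling laws at `c = ε`. As `ε² = 1`, the map is an involution and the factor `ε^{ℓ+1}` is
its own inverse, so it may appear on either side. -/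
theorem isIsoUpTo_hMap {ε : ℂ} (hε : ε ^ 2 = 1) :
    IsIsoUpTo (ε ^ (ℓ + 1)) (lgData ℓ) (lgData ℓ) (hMap ε) := by
  have hε0 : ε ≠ 0 := by rintro rfl; norm_num at hε
  have hinv : ε⁻¹ = ε := by field_simp; exact hε.symm
  have hh : ∀ v : Vec ℓ, hMap ε (hMap ε v) = v := fun v => by
    have := hMap_hMap_inv hε0 v
    rwa [hinv] at this
  have hmaps : Set.MapsTo (hMap ε) (lgData ℓ).carrier (lgData ℓ).carrier := fun a ha i hi =>
    mul_ne_zero (pow_ne_zero _ hε0) (ha i hi)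
  have hdiff : DifferentiableOn ℂ (hMap ε) (lgData ℓ).carrier := fun z _ =>
    (hasFDerivAt_hMap ε z).differentiableAt.differentiableWithinAt
  have hinvOn : Set.InvOn (hMap ε) (hMap ε) (lgData ℓ).carrier (lgData ℓ).carrier :=
    ⟨fun v _ => hh v, fun v _ => hh v⟩
  have heuler : ∀ v : Vec ℓ, hMap ε (eulerField v) = eulerField (hMap ε v) := fun v => by
    ext i; simp [hMap, eulerField]; ring
  have hσ : ε ^ (ℓ + 1) * ε ^ (ℓ + 1) = 1 := by
    rw [← pow_add, ← two_mul, pow_mul, hε, one_pow]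
  have hhank : ∀ a w : Vec ℓ, (hankel (hMap ε a)).mulVec w
      = ε ^ (ℓ + 1) • hMap ε ((hankel a).mulVec (hMap ε w)) := fun a w => by
    rw [← hankel_hMap hε0, smul_smul, hσ, one_smul]
  have hjac : ∀ z v : Vec ℓ, (jac (hMap ε) z).mulVec v = hMap ε v := fun z v => by
    rw [jac_mulVec, fderiv_hMap]
  have hjacT : ∀ z : Vec ℓ, (jac (hMap ε) z).transpose = jac (hMap ε) z := fun z => by
    ext i j
    simp only [jac, Matrix.transpose_apply, Matrix.of_apply, fderiv_hMap, hMap, Pi.single_apply]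
    by_cases hij : i = j
    · subst hij; simp
    · simp [hij, Ne.symm hij]
  refine ⟨hinvOn.bijOn hmaps hmaps, hdiff, ⟨hMap ε, hdiff, hinvOn⟩, ?_, ?_, ?_, ?_, ?_⟩
  · intro z _ X' Y
    rw [fderiv_hMap, fderiv_hMap]
    exact lgMetric_hMap hε0 z X' Y
  · intro z _ X' Y
    rw [fderiv_hMap, fderiv_hMap, fderiv_hMap]
    exact lgMul_hMap hε0 z X' Y
  · intro z _
    have hu : hMap ε (unitForm (hMap ε z)) = unitForm z := by
      ext i
      simp only [hMap, unitForm]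
      split_ifs with hi
      · have : ε ^ ((i : ℕ) + 1) ≠ 0 := pow_ne_zero _ hε0
        rw [mul_inv]
        field_simp
      · simp
    rw [fderiv_hMap, lgData_unit, lgData_unit, hhank, smul_smul, hσ, one_smul, hu]
  · intro z _
    rw [fderiv_hMap]
    exact heuler z
  · intro z _
    apply Matrix.ext_of_mulVec_single
    intro i
    apply dotProduct_eq
    intro w
    rw [hjacT, dotProduct_comm, dotProduct_comm _ w, intersectionForm_dotProduct,
      ← Matrix.mulVec_mulVec, ← Matrix.mulVec_mulVec, hjac, hjac, ← hMap_dotProduct,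
      intersectionForm_dotProduct, hhank, ← heuler, ← lgMulBilin_apply (hMap ε z), map_smul,
      lgMulBilin_apply, lgMul_hMap hε0, smul_smul, hσ, one_smul, hMap_dotProduct]

end GenFrob

namespace GenFrob

variable {ℓ : ℕ}

/-! ### Complex powers of `1 + a₁ v + ⋯ + a_ℓ v^ℓ` -/

/-- `a₁ v + ⋯ + a_ℓ v^ℓ` as a power series. -/
noncomputable def tailSeries : Vec ℓ →ₗ[ℂ] PowerSeries ℂ where
  toFun a := ∑ i : Fin ℓ, a i • PowerSeries.X ^ ((i : ℕ) + 1)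
  map_add' a b := by simp [add_smul, Finset.sum_add_distrib]
  map_smul' c a := by simp [mul_smul, Finset.smul_sum]

theorem coeff_tailSeries (a : Vec ℓ) (n : ℕ) :
    PowerSeries.coeff n (tailSeries a) = ∑ i : Fin ℓ, if n = (i : ℕ) + 1 then a i else 0 := by
  simp [tailSeries, PowerSeries.coeff_X_pow]

theorem coeff_tailSeries_succ (a : Vec ℓ) (i : Fin ℓ) :
    PowerSeries.coeff ((i : ℕ) + 1) (tailSeries a) = a i := by
  rw [coeff_tailSeries, Finset.sum_eq_single i]
  · simp
  · intro j _ hj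
    rw [if_neg]
    intro h
    exact hj (Fin.ext (by omega))
  · simp

theorem coeff_tailSeries_zero (a : Vec ℓ) : PowerSeries.coeff 0 (tailSeries a) = 0 := by
  simp [coeff_tailSeries]

theorem coeff_tailSeries_of_lt (a : Vec ℓ) {n : ℕ} (hn : ℓ < n) :
    PowerSeries.coeff n (tailSeries a) = 0 := by
  rw [coeff_tailSeries]
  refine Finset.sum_eq_zero fun i _ => if_neg ?_
  have := i.2
  omega

theorem tailSeries_single (i : Fin ℓ) :
    tailSeries (Pi.single i 1 : Vec ℓ) = PowerSeries.X ^ ((i : ℕ) + 1) := by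
  change ∑ j : Fin ℓ, _ = _
  rw [Finset.sum_eq_single i]
  · simp
  · intro j _ hj; simp [Pi.single_eq_of_ne hj]
  · simp

theorem hasSubst_tailSeries (a : Vec ℓ) : PowerSeries.HasSubst (tailSeries a) :=
  PowerSeries.HasSubst.of_constantCoeff_zero' (by
    rw [← PowerSeries.coeff_zero_eq_constantCoeff_apply, coeff_tailSeries_zero])

/-- `(1 + a₁ v + ⋯ + a_ℓ v^ℓ) ^ r`. -/
noncomputable def powSeries (r : ℂ) (a : Vec ℓ) : PowerSeries ℂ :=
  (PowerSeries.binomialSeries ℂ r).subst (tailSeries a)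

theorem powSeries_add (r r' : ℂ) (a : Vec ℓ) :
    powSeries (r + r') a = powSeries r a * powSeries r' a := by
  rw [powSeries, PowerSeries.binomialSeries_add, PowerSeries.subst_mul (hasSubst_tailSeries a)]
  rfl

theorem powSeries_one (a : Vec ℓ) : powSeries 1 a = 1 + tailSeries a := by
  have h := PowerSeries.binomialSeries_nat (R := ℂ) (A := ℂ) 1
  rw [Nat.cast_one, pow_one] at h
  rw [powSeries, h, PowerSeries.subst_add (hasSubst_tailSeries a),
    PowerSeries.subst_X (hasSubst_tailSeries a), ← PowerSeries.coe_substAlgHom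
      (hasSubst_tailSeries a), map_one]

theorem succ_mul_choose (r : ℂ) (n : ℕ) :
    ((n : ℂ) + 1) * Ring.choose r (n + 1) = r * Ring.choose (r - 1) n := by
  have h := Ring.choose_smul_choose r (n := n + 1) (k := 1) (by omega)
  simpa [Ring.choose_one_right] using h

theorem derivative_powSeries (r : ℂ) (a : Vec ℓ) :
    PowerSeries.derivative ℂ (powSeries r a)
      = r • (powSeries (r - 1) a * PowerSeries.derivative ℂ (tailSeries a)) := by
  have h : PowerSeries.derivative ℂ (PowerSeries.binomialSeries ℂ r)
      = r • PowerSeries.binomialSeries ℂ (r - 1) := by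
    ext n
    rw [PowerSeries.coeff_derivative, PowerSeries.coeff_smul, PowerSeries.binomialSeries_coeff,
      PowerSeries.binomialSeries_coeff]
    simp only [smul_eq_mul, mul_one]
    rw [mul_comm, succ_mul_choose]
  rw [powSeries, PowerSeries.derivative_subst (hasSubst_tailSeries a), h,
    PowerSeries.subst_smul (hasSubst_tailSeries a), smul_mul_assoc]
  rfl

theorem coeff_tailSeries_pow (a : Vec ℓ) {n k : ℕ} (h : k < n) :
    PowerSeries.coeff k (tailSeries a ^ n) = 0 := by
  have h1 : (PowerSeries.X : PowerSeries ℂ) ∣ tailSeries a := by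
    rw [PowerSeries.X_dvd_iff, ← PowerSeries.coeff_zero_eq_constantCoeff_apply,
      coeff_tailSeries_zero]
  exact PowerSeries.X_pow_dvd_iff.1 (pow_dvd_pow_of_dvd h1 n) k h

/-- The tail is divisible by `v`, so only finitely many of its powers reach a given coefficient;
coefficients of complex powers are thus polynomials in `a`. -/
theorem coeff_powSeries (r : ℂ) (a : Vec ℓ) {k m : ℕ} (h : k < m) :
    PowerSeries.coeff k (powSeries r a)
      = ∑ n ∈ Finset.range m, Ring.choose r n * PowerSeries.coeff k (tailSeries a ^ n) := by
  rw [powSeries, PowerSeries.coeff_subst' (hasSubst_tailSeries a),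
    finsum_eq_sum_of_support_subset (s := Finset.range m)]
  · simp
  · intro n hn
    rw [Finset.coe_range, Set.mem_Iio]
    by_contra hlt
    exact hn (by dsimp only; rw [coeff_tailSeries_pow a (by omega), smul_zero])

theorem coeff_zero_powSeries (r : ℂ) (a : Vec ℓ) : PowerSeries.coeff 0 (powSeries r a) = 1 := by
  rw [coeff_powSeries r a zero_lt_one]
  simp

theorem coeff_powSeries_mul (r : ℂ) (a : Vec ℓ) (S : PowerSeries ℂ) {k m : ℕ} (h : k < m) :
    PowerSeries.coeff k (powSeries r a * S)
      = ∑ n ∈ Finset.range m, Ring.choose r n * PowerSeries.coeff k (tailSeries a ^ n * S) := by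
  simp only [PowerSeries.coeff_mul, Finset.mul_sum]
  rw [Finset.sum_comm]
  refine Finset.sum_congr rfl fun p hp => ?_
  have := Finset.HasAntidiagonal.mem_antidiagonal.1 hp
  rw [coeff_powSeries r a (show p.1 < m by omega), Finset.sum_mul]
  exact Finset.sum_congr rfl fun n _ => by ring

/-- The linear functional `v ↦ [v^k] S v(A)`. -/
noncomputable def coeffTail (S : PowerSeries ℂ) (k : ℕ) : Vec ℓ →L[ℂ] ℂ :=
  LinearMap.toContinuousLinearMap
    ((PowerSeries.coeff k).comp ((LinearMap.mulLeft ℂ S).comp tailSeries))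

theorem coeffTail_apply (S : PowerSeries ℂ) (k : ℕ) (v : Vec ℓ) :
    coeffTail S k v = PowerSeries.coeff k (S * tailSeries v) := rfl

theorem hasFDerivAt_coeff_tailSeries_pow (n k : ℕ) (a : Vec ℓ) :
    HasFDerivAt (fun a : Vec ℓ => PowerSeries.coeff k (tailSeries a ^ n))
      ((n : ℂ) • coeffTail (tailSeries a ^ (n - 1)) k) a := by
  induction n generalizing k with
  | zero =>
    refine (hasFDerivAt_const (PowerSeries.coeff k (1 : PowerSeries ℂ)) a).congr_fderiv ?_
    ext1 v
    simp
  | succ n ih =>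
    have h1 : HasFDerivAt (fun a : Vec ℓ => PowerSeries.coeff k (tailSeries a ^ (n + 1)))
        (∑ p ∈ Finset.HasAntidiagonal.antidiagonal k, (PowerSeries.coeff p.1 (tailSeries a ^ n) • coeffTail 1 p.2
          + PowerSeries.coeff p.2 (tailSeries a) •
            ((n : ℂ) • coeffTail (tailSeries a ^ (n - 1)) p.1))) a := by
      simp only [pow_succ, PowerSeries.coeff_mul]
      apply HasFDerivAt.fun_sum
      intro p _
      refine (ih p.1).mul ?_
      refine (coeffTail (ℓ := ℓ) 1 p.2).hasFDerivAt.congr_of_eventuallyEq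
        (Filter.Eventually.of_forall fun b => ?_)
      rw [coeffTail_apply, one_mul]
    refine h1.congr_fderiv ?_
    ext1 v
    simp only [FunLike.coe_sum, Finset.sum_apply, smul_apply, smul_eq_mul, add_apply,
      coeffTail_apply, one_mul, Finset.sum_add_distrib]
    rw [← PowerSeries.coeff_mul, Finset.sum_congr rfl fun p _ => mul_left_comm _ (n : ℂ) _,
      ← Finset.mul_sum, Finset.sum_congr rfl fun p _ => mul_comm _ _, ← PowerSeries.coeff_mul]
    rcases n with _ | n
    · simp
    · simp only [Nat.add_sub_cancel]
      rw [show tailSeries a ^ n * tailSeries v * tailSeries a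
        = tailSeries a ^ (n + 1) * tailSeries v by ring]
      push_cast
      ring

/-- Termwise form of `δ(A^r) = r A^{r-1} δA`, through `n·choose(r, n) = r·choose(r-1, n-1)`. -/
theorem hasFDerivAt_coeff_powSeries (r : ℂ) (k : ℕ) (a : Vec ℓ) :
    HasFDerivAt (fun a : Vec ℓ => PowerSeries.coeff k (powSeries r a))
      (r • coeffTail (powSeries (r - 1) a) k) a := by
  have h1 : HasFDerivAt (fun a : Vec ℓ => PowerSeries.coeff k (powSeries r a))
      (∑ n ∈ Finset.range (k + 2),
        Ring.choose r n • ((n : ℂ) • coeffTail (tailSeries a ^ (n - 1)) k)) a := by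
    simp only [coeff_powSeries r _ (show k < k + 2 by omega)]
    apply HasFDerivAt.fun_sum
    intro n _
    exact (hasFDerivAt_coeff_tailSeries_pow n k a).const_mul _
  refine h1.congr_fderiv ?_
  ext1 v
  simp only [FunLike.coe_sum, Finset.sum_apply, smul_apply, smul_eq_mul, coeffTail_apply]
  rw [coeff_powSeries_mul _ _ _ (show k < k + 1 by omega), Finset.sum_range_succ', Finset.mul_sum]
  simp only [Nat.cast_zero, zero_mul, mul_zero, add_zero, Nat.add_sub_cancel]
  refine Finset.sum_congr rfl fun n _ => ?_
  rw [← mul_assoc, ← mul_assoc, ← succ_mul_choose]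
  push_cast
  ring

/-! ### Flat coordinates -/

/-- The flat coordinates `t^k = (ℓ+1)/k [v^k] (1 + a₁ v + ⋯ + a_ℓ v^ℓ)^(k/(ℓ+1))`. -/
noncomputable def flatCoord (a : Vec ℓ) : Vec ℓ := fun k =>
  (((k : ℕ) + 1 : ℂ) / (ℓ + 1))⁻¹ *
    PowerSeries.coeff ((k : ℕ) + 1) (powSeries (((k : ℕ) + 1 : ℂ) / (ℓ + 1)) a)

theorem weight_ne_zero (k : Fin ℓ) : ((k : ℕ) + 1 : ℂ) / (ℓ + 1) ≠ 0 :=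
  div_ne_zero (by exact_mod_cast Nat.succ_ne_zero k) (succ_ne_zero_complex ℓ)

theorem hasFDerivAt_flatCoord (a : Vec ℓ) :
    HasFDerivAt flatCoord (ContinuousLinearMap.pi fun k : Fin ℓ =>
      coeffTail (powSeries (((k : ℕ) + 1 : ℂ) / (ℓ + 1) - 1) a) ((k : ℕ) + 1)) a := by
  rw [hasFDerivAt_pi]
  intro k
  have h := (hasFDerivAt_coeff_powSeries (((k : ℕ) + 1 : ℂ) / (ℓ + 1)) ((k : ℕ) + 1) a).const_mul
    (((k : ℕ) + 1 : ℂ) / (ℓ + 1))⁻¹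
  rwa [smul_smul, inv_mul_cancel₀ (weight_ne_zero k), one_smul] at h

theorem differentiable_flatCoord : Differentiable ℂ (flatCoord : Vec ℓ → Vec ℓ) := fun a =>
  (hasFDerivAt_flatCoord a).differentiableAt

theorem fderiv_flatCoord (a v : Vec ℓ) (k : Fin ℓ) :
    fderiv ℂ flatCoord a v k = PowerSeries.coeff ((k : ℕ) + 1)
      (powSeries (((k : ℕ) + 1 : ℂ) / (ℓ + 1) - 1) a * tailSeries v) := by
  rw [(hasFDerivAt_flatCoord a).fderiv]
  rfl

theorem tailSeries_euler (a : Vec ℓ) :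
    tailSeries (eulerField a) = (ℓ + 1 : ℂ)⁻¹ •
      (PowerSeries.X * PowerSeries.derivative ℂ (tailSeries a)) := by
  ext n
  rcases n with _ | n
  · simp [coeff_tailSeries_zero]
  · rw [PowerSeries.coeff_smul, PowerSeries.coeff_succ_X_mul, PowerSeries.coeff_derivative]
    by_cases hn : n < ℓ
    · have h1 := coeff_tailSeries_succ (eulerField a) ⟨n, hn⟩
      have h2 := coeff_tailSeries_succ a ⟨n, hn⟩
      simp only at h1 h2
      rw [h1, h2, eulerField]
      simp only [smul_eq_mul]
      ring
    · rw [coeff_tailSeries_of_lt _ (by omega), coeff_tailSeries_of_lt _ (by omega)]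
      simp

theorem fderiv_flatCoord_euler (a : Vec ℓ) (k : Fin ℓ) :
    fderiv ℂ flatCoord a (eulerField a) k = ((k : ℕ) + 1 : ℂ) / (ℓ + 1) * flatCoord a k := by
  set r : ℂ := ((k : ℕ) + 1 : ℂ) / (ℓ + 1) with hr
  have hr0 : r ≠ 0 := weight_ne_zero k
  rw [fderiv_flatCoord, tailSeries_euler, mul_smul_comm, PowerSeries.coeff_smul,
    mul_left_comm, PowerSeries.coeff_succ_X_mul]
  have h := congrArg (PowerSeries.coeff (k : ℕ)) (derivative_powSeries r a)
  rw [PowerSeries.coeff_smul, PowerSeries.coeff_derivative] at h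
  rw [← hr, flatCoord, ← hr, ← mul_assoc, mul_inv_cancel₀ hr0, one_mul]
  apply mul_left_cancel₀ hr0
  simp only [smul_eq_mul] at h ⊢
  rw [mul_left_comm, ← h, hr]
  ring

/-! ### Flatness -/

theorem jac_flatCoord (a : Vec ℓ) (k i : Fin ℓ) :
    jac flatCoord a k i = if (i : ℕ) ≤ k then PowerSeries.coeff ((k : ℕ) - i)
      (powSeries (((k : ℕ) + 1 : ℂ) / (ℓ + 1) - 1) a) else 0 := by
  rw [jac, Matrix.of_apply, fderiv_flatCoord, tailSeries_single, PowerSeries.coeff_mul_X_pow']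
  simp only [Nat.add_le_add_iff_right, Nat.add_sub_add_right]

/-- A lower triangular Toeplitz matrix times a Hankel matrix of this shape is again Hankel, with the
power series multiplied. -/
theorem sum_coeff_mul_coeff (P F : PowerSeries ℂ) (k m : Fin ℓ) :
    ∑ j : Fin ℓ, (if (j : ℕ) ≤ k then PowerSeries.coeff ((k : ℕ) - j) P else 0) *
        (if ℓ ≤ (j : ℕ) + m + 1 then PowerSeries.coeff ((j : ℕ) + m + 1 - ℓ) F else 0)
      = if ℓ ≤ (k : ℕ) + m + 1 then PowerSeries.coeff ((k : ℕ) + m + 1 - ℓ) (P * F) else 0 := by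
  have hk := k.2
  have hm := m.2
  split_ifs with h
  · rw [PowerSeries.coeff_mul, Finset.Nat.sum_antidiagonal_eq_sum_range_succ_mk]
    symm
    apply Finset.sum_of_injOn fun x : ℕ => (⟨(k : ℕ) - x, by omega⟩ : Fin ℓ)
    · intro x hx y hy hxy
      simp only [Finset.coe_range, Set.mem_Iio] at hx hy
      have := congrArg Fin.val hxy
      simp only at this
      omega
    · intro x _
      exact Finset.mem_coe.2 (Finset.mem_univ _)
    · intro j _ hj
      by_cases h1 : (j : ℕ) ≤ k
      · by_cases h2 : ℓ ≤ (j : ℕ) + m + 1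
        · exfalso
          apply hj
          refine ⟨(k : ℕ) - j, ?_, Fin.ext ?_⟩
          · simp only [Finset.coe_range, Set.mem_Iio]; omega
          · simp only; omega
        · rw [if_neg h2, mul_zero]
      · rw [if_neg h1, zero_mul]
    · intro x hx
      rw [Finset.mem_range] at hx
      simp only
      rw [if_pos (by omega), if_pos (by omega), show (k : ℕ) - (k - x) = x by omega,
        show (k : ℕ) - x + m + 1 - ℓ = k + m + 1 - ℓ - x by omega]
  · refine Finset.sum_eq_zero fun j _ => ?_
    by_cases h1 : (j : ℕ) ≤ k
    · rw [if_neg (show ¬ ℓ ≤ (j : ℕ) + m + 1 by omega), mul_zero]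
    · rw [if_neg h1, zero_mul]

/-- `(ℓ+1) A - v A'` for `A = 1 + a₁ v + ⋯ + a_ℓ v^ℓ`. -/
noncomputable def hankelSeries (a : Vec ℓ) : PowerSeries ℂ :=
  (ℓ + 1 : ℂ) • powSeries 1 a - PowerSeries.X * PowerSeries.derivative ℂ (tailSeries a)

theorem coeff_zero_hankelSeries (a : Vec ℓ) : PowerSeries.coeff 0 (hankelSeries a) = ℓ + 1 := by
  rw [hankelSeries, map_sub, PowerSeries.coeff_smul, coeff_zero_powSeries]
  simp

theorem coeff_succ_hankelSeries (a : Vec ℓ) (r : Fin ℓ) :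
    PowerSeries.coeff ((r : ℕ) + 1) (hankelSeries a) = (ℓ - r : ℂ) * a r := by
  rw [hankelSeries, map_sub, PowerSeries.coeff_smul, powSeries_one, map_add, coeff_tailSeries_succ,
    PowerSeries.coeff_succ_X_mul, PowerSeries.coeff_derivative, coeff_tailSeries_succ,
    PowerSeries.coeff_one, if_neg (Nat.succ_ne_zero _), smul_eq_mul]
  ring

theorem hankel_apply_eq_coeff (a : Vec ℓ) (i j : Fin ℓ) :
    hankel a i j = if ℓ ≤ (i : ℕ) + j + 1 then
      PowerSeries.coeff ((i : ℕ) + j + 1 - ℓ) (hankelSeries a) else 0 := by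
  have hi := i.2
  have hj := j.2
  have e : ∀ m, (dpLam a).coeff m = ((if m = ℓ then 1 else 0) + (toPoly a).coeff m) * (m + 1) := by
    intro m
    rw [dpLam, Polynomial.coeff_derivative, coeff_superpotential, dLam_eq, Polynomial.coeff_X_mul]
    simp only [Nat.add_right_cancel_iff]
  have hdeg : ∀ m, ℓ ≤ m → (toPoly a).coeff m = 0 := fun m hm =>
    Polynomial.coeff_eq_zero_of_degree_lt ((degree_toPoly_lt a).trans_le (by exact_mod_cast hm))
  rw [hankel, Matrix.of_apply, e]
  split_ifs with h1 h2 h2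
  · rw [show (i : ℕ) + j + 1 - ℓ = 0 by omega, coeff_zero_hankelSeries, hdeg _ h1.ge, h1]
    ring
  · exfalso; omega
  · have h3 : (i : ℕ) + j + 1 - ℓ = ((⟨(i : ℕ) + j - ℓ, by omega⟩ : Fin ℓ) : ℕ) + 1 := by
      simp only; omega
    rw [h3, coeff_succ_hankelSeries, ← coeff_toPoly a]
    simp only
    have h4 : ℓ - 1 - (i : ℕ) + (ℓ - j) = ℓ - 1 - ((i : ℕ) + j - ℓ) := by omega
    rw [h4, zero_add, mul_comm]
    congr 1
    have h5 : ℓ - 1 - ((i : ℕ) + j - ℓ) + 1 + ((i : ℕ) + j - ℓ) = ℓ := by omega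
    have h6 : ((ℓ - 1 - ((i : ℕ) + j - ℓ) : ℕ) : ℂ) + 1 + (((i : ℕ) + j - ℓ : ℕ) : ℂ) = ℓ := by
      exact_mod_cast h5
    linear_combination h6
  · rw [hdeg _ (by omega)]; ring

/-- With `r = n/(ℓ+1)` nonzero, `A^{r-1} v A' = r⁻¹ v (A^r)'` has `v^n`-coefficient `(n/r) [v^n] A^r
= (ℓ+1) [v^n] A^r`, which cancels the other term. -/
theorem coeff_powSeries_mul_hankelSeries (a : Vec ℓ) (n : ℕ) :
    PowerSeries.coeff n (powSeries ((n : ℂ) / (ℓ + 1) - 1) a * hankelSeries a)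
      = if n = 0 then (ℓ + 1 : ℂ) else 0 := by
  have hN := succ_ne_zero_complex ℓ
  set r : ℂ := (n : ℂ) / (ℓ + 1) with hr
  rw [hankelSeries, mul_sub, mul_smul_comm, ← powSeries_add, sub_add_cancel, map_sub,
    PowerSeries.coeff_smul, mul_left_comm]
  rcases n with _ | n
  · rw [coeff_zero_powSeries]
    simp
  · rw [PowerSeries.coeff_succ_X_mul, if_neg (Nat.succ_ne_zero n)]
    have h := congrArg (PowerSeries.coeff n) (derivative_powSeries r a)
    rw [PowerSeries.coeff_smul, PowerSeries.coeff_derivative] at h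
    have hr0 : r ≠ 0 := div_ne_zero (by exact_mod_cast Nat.succ_ne_zero n) hN
    apply mul_left_cancel₀ hr0
    simp only [smul_eq_mul] at h ⊢
    rw [mul_sub, ← h, hr]
    push_cast
    field_simp
    ring

/-- The Jacobian is Toeplitz with series `A^{(k+1)/(ℓ+1) - 1}` in row `k`. Two such factors around
the Hankel matrix add exponents to exactly `n/(ℓ+1) - 1` for the coefficient `n = k + m + 1 - ℓ`, so
only `n = 0` survives. -/
theorem flatCoord_flat (a : Vec ℓ) (k m : Fin ℓ) :
    (jac flatCoord a * hankel a * (jac flatCoord a).transpose) k m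
      = if (k : ℕ) + m + 1 = ℓ then (ℓ + 1 : ℂ) else 0 := by
  have hN := succ_ne_zero_complex ℓ
  set Q : Fin ℓ → PowerSeries ℂ := fun k => powSeries (((k : ℕ) + 1 : ℂ) / (ℓ + 1) - 1) a with hQ
  have h1 : ∀ i, (hankel a * (jac flatCoord a).transpose) i m
      = if ℓ ≤ (i : ℕ) + m + 1 then
        PowerSeries.coeff ((i : ℕ) + m + 1 - ℓ) (Q m * hankelSeries a) else 0 := by
    intro i
    rw [add_comm (i : ℕ) m, ← sum_coeff_mul_coeff, Matrix.mul_apply]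
    refine Finset.sum_congr rfl fun j _ => ?_
    rw [Matrix.transpose_apply, jac_flatCoord, hankel_apply_eq_coeff, mul_comm, add_comm (i : ℕ) j]
  rw [Matrix.mul_assoc, Matrix.mul_apply]
  simp only [h1, jac_flatCoord]
  rw [sum_coeff_mul_coeff]
  by_cases h : ℓ ≤ (k : ℕ) + m + 1
  · rw [if_pos h]
    set n := (k : ℕ) + m + 1 - ℓ with hn
    have h2 : (n : ℂ) + ℓ = k + m + 1 := by exact_mod_cast (show n + ℓ = k + m + 1 by omega)
    have h3 : Q k * (Q m * hankelSeries a)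
        = powSeries ((n : ℂ) / (ℓ + 1) - 1) a * hankelSeries a := by
      rw [← mul_assoc, hQ, ← powSeries_add]
      congr 2
      field_simp
      linear_combination -h2
    rw [h3, coeff_powSeries_mul_hankelSeries]
    exact if_congr (by omega) rfl rfl
  · rw [if_neg h, if_neg (by omega)]

/-! ### The global inverse -/

/-- The nonlinear part of the flat coordinates is strictly triangular. -/
theorem flatCoord_sub_eq {a b : Vec ℓ} {k : Fin ℓ} (h : ∀ i < k, a i = b i) :
    flatCoord a k - a k = flatCoord b k - b k := by
  set v := b - a with hv
  have hline : ∀ ζ : ℂ, HasDerivAt (fun ζ : ℂ => a + ζ • v) v ζ := fun ζ => by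
    simpa using ((hasDerivAt_id ζ).smul_const v).const_add a
  have hd : ∀ ζ : ℂ, HasDerivAt
      (fun ζ : ℂ => flatCoord (a + ζ • v) k - (a + ζ • v) k) 0 ζ := by
    intro ζ
    have h1 := ((hasFDerivAt_flatCoord (a + ζ • v)).comp_hasDerivAt ζ (hline ζ))
    have h2 := (hasDerivAt_pi.1 h1 k).sub (hasDerivAt_pi.1 (hline ζ) k)
    refine h2.congr_deriv ?_
    change PowerSeries.coeff ((k : ℕ) + 1) (powSeries _ (a + ζ • v) * tailSeries v) - v k = 0
    -- Along the segment from `a` to `b` only the coordinates from `k` on move, so in the `k`-th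
    -- derivative only the constant term `1` of the power series contributes.
    have hlow : ∀ n ≤ (k : ℕ), PowerSeries.coeff n (tailSeries v) = 0 := by
      intro n hn
      rcases n with _ | n
      · exact coeff_tailSeries_zero v
      · have h3 := coeff_tailSeries_succ v ⟨n, by omega⟩
        simp only at h3
        rw [h3, hv, Pi.sub_apply, h ⟨n, by omega⟩ (Fin.lt_def.2 (by simp only; omega)), sub_self]
    rw [PowerSeries.coeff_mul, Finset.sum_eq_single (0, (k : ℕ) + 1)]
    · rw [coeff_zero_powSeries, coeff_tailSeries_succ, one_mul, sub_self]
    · intro p hp hne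
      have h4 := Finset.HasAntidiagonal.mem_antidiagonal.1 hp
      rw [hlow, mul_zero]
      by_contra hlt
      exact hne (Prod.ext (by simp only; omega) (by simp only; omega))
    · intro hp
      exact absurd (Finset.HasAntidiagonal.mem_antidiagonal.2 (by simp)) hp
  have hc := is_const_of_deriv_eq_zero (fun ζ => (hd ζ).differentiableAt)
    (fun ζ => (hd ζ).deriv) 0 1
  simpa [hv] using hc

/-- The iteration `z ↦ τ - (t(z) - z)` that inverts the flat coordinates. -/
noncomputable def flatIter (τ : Vec ℓ) : ℕ → Vec ℓ
  | 0 => 0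
  | n + 1 => τ - (flatCoord (flatIter τ n) - flatIter τ n)

/-- By triangularity each step fixes one more coordinate, so the iteration is stationary after `ℓ`
steps and its limit is holomorphic in `τ`. -/
theorem flatIter_succ_apply (τ : Vec ℓ) (n : ℕ) (k : Fin ℓ) (hk : (k : ℕ) < n) :
    flatIter τ (n + 1) k = flatIter τ n k := by
  induction n generalizing k with
  | zero => omega
  | succ n ih =>
    rw [flatIter]
    conv_rhs => rw [flatIter]
    simp only [Pi.sub_apply]
    rw [flatCoord_sub_eq fun i hi => ih i (by have := Fin.lt_def.1 hi; omega)]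

theorem flatCoord_flatIter (τ : Vec ℓ) : flatCoord (flatIter τ ℓ) = τ := by
  have h : flatIter τ (ℓ + 1) = flatIter τ ℓ := funext fun k => flatIter_succ_apply τ ℓ k k.2
  rw [flatIter] at h
  have h1 : τ - flatCoord (flatIter τ ℓ) = 0 := by
    have := sub_eq_zero.2 h
    rw [← this]
    abel
  exact (sub_eq_zero.1 h1).symm

theorem differentiable_flatIter (n : ℕ) : Differentiable ℂ fun τ : Vec ℓ => flatIter τ n := by
  induction n with
  | zero => exact differentiable_const _
  | succ n ih =>
    simp only [flatIter]
    exact differentiable_id.sub ((differentiable_flatCoord.comp ih).sub ih)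

theorem flatCoord_injective : Function.Injective (flatCoord : Vec ℓ → Vec ℓ) := by
  intro a b h
  have key : ∀ n, ∀ k : Fin ℓ, (k : ℕ) = n → a k = b k := by
    intro n
    induction n using Nat.strong_induction_on with
    | _ n ih =>
      intro k hk
      have h1 := flatCoord_sub_eq (a := a) (b := b) (k := k) fun i hi =>
        ih i (by rw [← hk]; exact Fin.lt_def.1 hi) i rfl
      rw [h] at h1
      exact sub_right_injective h1
  exact funext fun k => key k k rfl

theorem exists_isFlatDiagonal (ℓ : ℕ) :
    ∃ t s d, IsFlatDiagonal (hankel : Vec ℓ → Matrix (Fin ℓ) (Fin ℓ) ℂ) t s d := by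
  refine ⟨flatCoord, fun τ => flatIter τ ℓ, fun k => ((k : ℕ) + 1 : ℝ) / (ℓ + 1), ?_⟩
  refine ⟨fun a => flatCoord_injective (flatCoord_flatIter _), flatCoord_flatIter,
    differentiable_flatCoord, differentiable_flatIter ℓ, fun τ τ' => ?_, fun z => ?_⟩
  · ext k m
    rw [inCoords, inCoords, flatCoord_flat, flatCoord_flat]
  · ext k
    rw [fderiv_flatCoord_euler]
    push_cast
    rfl

end GenFrob

theorem mainTheorem5 (ℓ : ℕ) (hℓ : 1 ≤ ℓ) :
    -- on all of `ℂ^ℓ` the residue pairing is nondegenerate and the product is determined by it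
    (∀ a : GenFrob.Vec ℓ, IsUnit (GenFrob.lgGram a).det ∧
      ∀ X Y Z, GenFrob.lgMetric a (GenFrob.lgMul a X Y) Z = GenFrob.lgCubic a X Y Z) ∧
    -- the superpotentials with `a_ℓ ≠ 0` form a generalized Frobenius manifold of charge 1
    GenFrob.IsGenFrobenius (GenFrob.lgData ℓ) 1 ∧
    -- `e(u_i) = 1` and `E(u_i) = u_i` for the critical values `u_i = Λ(q_i)`
    (∀ a ∈ (GenFrob.lgData ℓ).carrier, ∀ q : ℂ, (GenFrob.dpLam a).IsRoot q →
      (GenFrob.dLam ((GenFrob.lgData ℓ).unit a)).eval q = 1 ∧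
      (GenFrob.dLam ((GenFrob.lgData ℓ).euler a)).eval q = (GenFrob.superpotential a).eval q) ∧
    -- the residue formula gives the inverse of the intersection form
    (∀ a : GenFrob.Vec ℓ, IsCoprime (GenFrob.superpotential a) (GenFrob.dpLam a) →
      GenFrob.lgIntersectionGram a * (GenFrob.lgData ℓ).intersectionForm a = 1) ∧
    -- the generators on the orbit space at `λ = e^{-2πi c}` and at `λ = 0`
    (∀ (c : ℂ) (x : GenFrob.Vec ℓ) (j : Fin ℓ),
      GenFrob.generators (Complex.exp (-(2 * Real.pi * Complex.I * c))) x j =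
        GenFrob.weylGenerator c x j) ∧
    (∀ (ε : ℂ) (x : GenFrob.Vec ℓ),
      GenFrob.superpotential (GenFrob.hMap ε (GenFrob.generators 0 x)) =
        Polynomial.X * ∏ k : Fin ℓ,
          (Polynomial.X + Polynomial.C (ε * GenFrob.orbitU 0 x k.castSucc))) ∧
    -- the metrics `g`, `η` on the orbit space exist and are unique
    (∃! p : (GenFrob.Vec ℓ → Matrix (Fin ℓ) (Fin ℓ) ℂ) × (GenFrob.Vec ℓ → Matrix (Fin ℓ) (Fin ℓ) ℂ),
      GenFrob.IsPencil p.1 p.2) ∧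
    ∀ g η : GenFrob.Vec ℓ → Matrix (Fin ℓ) (Fin ℓ) ℂ, GenFrob.IsPencil g η →
      -- flat coordinates exist, and every choice of them gives the following
      (∃ t s d, GenFrob.IsFlatDiagonal η t s d) ∧
      ∀ t s d, GenFrob.IsFlatDiagonal η t s d →
        (∃! Γ, GenFrob.IsContraLeviCivita (GenFrob.inCoords t s g) Γ) ∧
        ∀ Γ, GenFrob.IsContraLeviCivita (GenFrob.inCoords t s g) Γ →
          GenFrob.IsGenFrobenius (GenFrob.orbitData η t s d Γ) 1 ∧
          (∀ z ∈ (GenFrob.orbitData η t s d Γ).carrier,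
            (GenFrob.orbitData η t s d Γ).intersectionForm z = g z) ∧
          -- `a_α = y^α` is an isomorphism
          GenFrob.IsIso (GenFrob.orbitData η t s d Γ) (GenFrob.lgData ℓ) (GenFrob.hMap 1) ∧
          -- `a_α = (-1)^α y^α` is an isomorphism up to the sign `(-1)^{ℓ+1}`, and hence an
          -- isomorphism for odd `ℓ`
          GenFrob.IsIsoUpTo ((-1) ^ (ℓ + 1)) (GenFrob.orbitData η t s d Γ) (GenFrob.lgData ℓ)
            (GenFrob.hMap (-1)) := by
  obtain ⟨n, hn⟩ : ∃ n : Fin ℓ, (n : ℕ) + 1 = ℓ := ⟨⟨ℓ - 1, by omega⟩, by simp; omega⟩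
  obtain ⟨t₀, s₀, d₀, h₀⟩ := GenFrob.exists_isFlatDiagonal ℓ
  refine ⟨fun a => ⟨GenFrob.isUnit_det_lgGram a, GenFrob.lgMetric_lgMul a⟩,
    h₀.isGenFrobenius_lgData n hn, fun a ha q hq =>
      ⟨GenFrob.eval_dLam_unit n hn a ((GenFrob.mem_carrier_lgData n hn a).1 ha) hq,
        GenFrob.eval_dLam_euler a hq⟩,
    GenFrob.lgIntersectionGram_mul, GenFrob.generators_eq_weylGenerator,
    GenFrob.superpotential_hMap_generators, GenFrob.existsUnique_pencil, fun g η hp => ?_⟩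
  -- Any pencil is the intersection form together with the Hankel matrix, so the orbit space claims
  -- reduce to `lgData`.
  obtain ⟨rfl, rfl⟩ := hp.eq_lg
  refine ⟨⟨t₀, s₀, d₀, h₀⟩, fun t s d h => ⟨⟨_, h.isContraLeviCivita, fun Γ hΓ =>
    h.eq_contraGamma n hn hΓ⟩, fun Γ hΓ => ?_⟩⟩
  rw [h.eq_contraGamma n hn hΓ, h.orbitData_eq]
  refine ⟨h.isGenFrobenius_lgData n hn, fun _ _ => rfl, ?_, GenFrob.isIsoUpTo_hMap (by norm_num)⟩
  have h1 := GenFrob.isIsoUpTo_hMap (ℓ := ℓ) (ε := 1) (by norm_num)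
  rwa [one_pow] at h1
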